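/- **Theorem.** Let $\mathcal H$ be a Hopf algebra over $\mathbb C$ (coproduct $\Delta h=\sum h_0\otimes h_1$, counit $\epsilon$, antipode $S$), let $\delta:\mathcal H\to\mathbb C$ be a character (a unital algebra homomorphism), put $S_\delta(h)=\sum\delta(h_0)S(h_1)$, and assume $S_\delta^2=\mathrm{Id}$. Let $n\ge 0$. *The Weil complex.* $W=W(\mathcal H)$ is the non-unital DG algebra freely generated by symbols $i(h)$ of degree $1$ and $\omega_h$ of degree $2$, linear in $h\in\mathcal H$, with boundary the odd derivation $\partial=\partial_0+d$, where $$\partial_0 i(h)=-\sum i(h_0)i(h_1),\quad \partial_0\omega_h=\sum\omega_{h_0}i(h_1)-\sum i(h_0)\omega_{h_1},\quad d\,i(h)=\omega_h,\quad d\,\omega_h=0 .$$ $\mathcal H$ acts on $W$ by $g\cdot i(h)=i(gh)$, $g\cdot\omega_h=\omega_{gh}$, $g(xy)=\sum g_0(x)g_1(y)$; this action is extended to the algebra $\tilde W$ with unit adjoined by $g(1)=\epsilon(g)1$. $I=I(\mathcal H)\subset W$ is the ideal generated by the $\omega_h$, $I^0:=\tilde W$, and $W_n=W/I^{n+1}$.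 For a space $M$ with an action of $\mathcal H$, $M_\delta$ is the quotient of $M$ by the coinvariants, i.e. by the span of the elements $h(m)-\delta(h)m$. *The cyclic bicomplex.* For a generator $a$ (some $i(h)$ or $\omega_h$) and $x\in\tilde W$ let $$t(ax)=(-1)^{|a||x|}xa,\qquad b_t(ax)=t(\partial_0(a)x),\qquad b=\partial+b_t,$$ and let $N=1+t+\dots+t^{p-1}$ on products of $p$ generators. These operators descend to $(W_n)_\delta$. Write $(W_n)_\delta$ for this space with boundary $\partial$ and $(W_n^b)_\delta$ for the same space with boundary $b$. The localized cyclic bicomplex $CC_\delta^*(W_n)$ is the two-sided $2$-periodic bicomplex $$\cdots\to (W_n^b)_\delta\xrightarrow{\,t-1\,}(W_n)_\delta\xrightarrow{\,N\,}(W_n^b)_\delta\xrightarrow{\,t-1\,}(W_n)_\delta\to\cdots,$$ and $CC_\delta^*(\mathcal H,n)$ is $CC_\delta^*(W_n)$ shifted by one in the vertical direction (vertical degree $k$ being the part of $W_n$ of degree $k+1$). *The relative $X$-complex.* Put $\Omega^1(W)=\tilde W\otimes W$, with $x\otimes z$ written $x\,dz$, left multiplication $r(x\,dz)=(rx)\,dz$,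 right multiplication $(x\,dz)r=x\,d(zr)-xz\,dr$, boundary $\partial(x\,dz)=\partial x\,dz+(-1)^{|x|}x\,d(\partial z)$ and the diagonal action $h(x\,dz)=\sum h_0(x)\,d(h_1(z))$. Let $\Omega^1(W)_{\natural,\delta}$ be the quotient of $\Omega^1(W)$ by $[\Omega^1(W),W]$ (the span of the graded commutators) and the coinvariants, and let $\natural$ denote the projection onto it. Then $\mathcal X_\delta^{2n+1}(W,I)$ is the super-complex of complexes $$W/(I^{n+1}+\text{coinvariants})\;\rightleftarrows\;\Omega^1(W)_{\natural,\delta}\big/\natural(I^{n+1}dW+I^n dI),$$ the map from left to right being induced by $x\mapsto dx$ and the map from right to left by $b(x\,dy)=[x,y]$ (graded commutator). It is also regarded as a two-sided $2$-periodic bicomplex. *Conclusion.* There is an isomorphism of super-complexes of complexes $$\Big((W_n)_\delta\underset{t-1}{\overset{N}{\rightleftarrows}}(W_n^b)_\delta\Big)\;\cong\;\mathcal X_\delta^{2n+1}(W(\mathcal H),I(\mathcal H)),$$ in which $(W_n)_\delta$ corresponds to the even part and $(W_n^b)_\delta$ to the odd part. Consequently the bicomplex $CC_\delta^*(\mathcal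 H,n)$ is isomorphic to the two-sided $2$-periodic bicomplex of $\mathcal X_\delta^{2n+1}(W(\mathcal H),I(\mathcal H))$, shifted by one in the vertical direction. -/

import Mathlib

/- Overview of the main definitions.

`HDGAlgebra H A` : an `H`-DG algebra `R`, possibly without unit, presented by the augmented unital
  algebra `A = R̃` whose augmentation ideal is `R = HDGAlgebra.nonunital H A`.
`HDGAlgebra.Omega1`, `formBd`, `formAct`, `formComm`, `univDer`, `formB` : the bimodule `Ω¹(R)`
  with its boundary, diagonal action, commutator space, and the maps `d` and `b`.
`HDGIdeal.xComplex` : the localized relative X-complex `X_δ^{2n+1}(R, I)`.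
`WeilTilde`, `Weil.wBd`, `Weil.wAct`, `Weil.weilHDGAlgebra`, `Weil.weilIdeal` : the Weil complex
  `W(H)` (as augmentation ideal of the free unital algebra) with its boundary and action, and the
  ideal `I(H)`.
`Weil.tOp`, `Weil.nOp`, `Weil.bOp` : the operators `t`, `N` and `b = ∂ + b_t` on the Weil complex.
`Weil.ccSuper`, `Weil.ccWn`, `cyclicBicomplex` : the localized cyclic bicomplex, as a
  super-complex, as a two-sided periodic bicomplex, and shifted by one vertically.
-/

open TensorProduct

universe u

/-- The sign `(-1)^k`. -/
noncomputable def koszulSign (k : ℤ) : ℂ := (-1) ^ k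

theorem koszulSign_zero : koszulSign 0 = 1 := by simp [koszulSign]

theorem koszulSign_one : koszulSign 1 = -1 := by simp [koszulSign]

theorem koszulSign_add (a b : ℤ) : koszulSign (a + b) = koszulSign a * koszulSign b := by
  simp [koszulSign, zpow_add₀]

theorem koszulSign_cases (a : ℤ) : koszulSign a = 1 ∨ koszulSign a = -1 := by
  rcases Int.even_or_odd a with h | h
  · left; exact h.neg_one_zpow
  · right; exact h.neg_one_zpow

/-- The twisted antipode `S_δ(h) = ∑ δ(h₀) S(h₁)`. -/
noncomputable def twistedAntipode {H : Type u} [Ring H] [HopfAlgebra ℂ H] (δ : H →ₐ[ℂ] ℂ) :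
    H →ₗ[ℂ] H :=
  (TensorProduct.lid ℂ H).toLinearMap ∘ₗ
    TensorProduct.map δ.toLinearMap (HopfAlgebra.antipode ℂ) ∘ₗ Coalgebra.comul

/-- The space of coinvariants of an `H`-module `M` (with action `ρ`): the linear span of the
elements `h(m) - δ(h) m`. -/
def coinvariants {H M : Type u} [Ring H] [Algebra ℂ H] [AddCommGroup M] [Module ℂ M]
    (δ : H →ₐ[ℂ] ℂ) (ρ : H → M →ₗ[ℂ] M) : Submodule ℂ M :=
  Submodule.span ℂ {y | ∃ h m, y = ρ h m - δ h • m}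

/-- An `H`-DG algebra in augmented form. -/
class HDGAlgebra (H A : Type u) [Ring H] [HopfAlgebra ℂ H] [Ring A] [Algebra ℂ A] where
  /-- the augmentation -/
  aug : A →ₐ[ℂ] ℂ
  /-- the component of degree `k` -/
  gr : ℤ → Submodule ℂ A
  isInternal : DirectSum.IsInternal gr
  one_mem : (1 : A) ∈ gr 0
  mul_mem : ∀ {i j x y}, x ∈ gr i → y ∈ gr j → x * y ∈ gr (i + j)
  aug_of_mem : ∀ {k x}, x ∈ gr k → k ≠ 0 → aug x = 0
  /-- the differential -/
  bd : A →ₗ[ℂ] A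
  bd_mem : ∀ {k x}, x ∈ gr k → bd x ∈ gr (k + 1)
  bd_bd : ∀ x, bd (bd x) = 0
  bd_mul : ∀ {k x}, x ∈ gr k → ∀ y, bd (x * y) = bd x * y + koszulSign k • (x * bd y)
  aug_bd : ∀ x, aug (bd x) = 0
  /-- the action of `H` -/
  act : H →ₐ[ℂ] Module.End ℂ A
  act_one : ∀ h, act h 1 = Coalgebra.counit (R := ℂ) h • (1 : A)
  act_mul : ∀ h x y, act h (x * y) = LinearMap.mul' ℂ A
    (TensorProduct.map (act.toLinearMap.flip x) (act.toLinearMap.flip y) (Coalgebra.comul h))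
  act_mem : ∀ h {k x}, x ∈ gr k → act h x ∈ gr k
  act_bd : ∀ h x, act h (bd x) = bd (act h x)
  aug_act : ∀ h x, aug (act h x) = Coalgebra.counit (R := ℂ) h * aug x

namespace HDGAlgebra

variable (H A : Type u) [Ring H] [HopfAlgebra ℂ H] [Ring A] [Algebra ℂ A] [HDGAlgebra H A]

/-- The non-unital algebra `R`, as the augmentation ideal of `A = R̃`. -/
def nonunital : Submodule ℂ A := LinearMap.ker (aug H (A := A)).toLinearMap

theorem mem_nonunital {x : A} : x ∈ nonunital H A ↔ aug H x = 0 := Iff.rfl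

/-- The sign operator `x ↦ (-1)^{|x|} x`. -/
noncomputable def sgn : A →ₗ[ℂ] A :=
  DirectSum.toModule ℂ ℤ A (fun k => koszulSign k • (gr H (A := A) k).subtype) ∘ₗ
    (LinearEquiv.ofBijective (DirectSum.coeLinearMap (gr H (A := A)))
      (isInternal (H := H) (A := A))).symm.toLinearMap

variable {H A}

theorem sgn_of_mem {k : ℤ} {x : A} (hx : x ∈ gr H k) : sgn H A x = koszulSign k • x := by
  have h : (LinearEquiv.ofBijective (DirectSum.coeLinearMap (gr H (A := A)))
      (isInternal (H := H) (A := A))).symm x = DirectSum.lof ℂ ℤ (fun i => gr H (A := A) i) k ⟨x, hx⟩ := by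
    rw [LinearEquiv.symm_apply_eq]
    exact (DirectSum.coeLinearMap_lof (gr H (A := A)) k ⟨x, hx⟩).symm
  simp only [sgn, LinearMap.comp_apply, LinearEquiv.coe_coe]
  rw [h, DirectSum.toModule_lof]
  simp

theorem iSup_gr : ⨆ k, gr H (A := A) k = ⊤ := isInternal.submodule_iSup_eq_top

/-- Induction on homogeneous elements. -/
@[elab_as_elim]
theorem hom_induction {p : A → Prop} (hom : ∀ k x, x ∈ gr H k → p x)
    (add : ∀ x y, p x → p y → p (x + y)) (x : A) : p x := by
  have hx : x ∈ ⨆ k, gr H (A := A) k := by rw [iSup_gr]; trivial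
  exact Submodule.iSup_induction _ (motive := p) hx hom (hom 0 0 (zero_mem _)) add

theorem act_mul_repr {ι : Type*} (h : H) (x y : A) (r : Coalgebra.Repr ℂ h ι) :
    act h (x * y) = ∑ i ∈ r.index, act (r.left i) x * act (r.right i) y := by
  rw [act_mul, ← r.eq]
  simp

theorem bd_one : bd H (1 : A) = 0 := by
  have := bd_mul (H := H) (one_mem (H := H) (A := A)) 1
  simp only [mul_one, one_mul, koszulSign_zero, one_smul] at this
  simpa using this

variable (H A) in
/-- `(x, y) ↦ (-1)^{|x||y|} y x`. -/
noncomputable def signedOp : A →ₗ[ℂ] A →ₗ[ℂ] A :=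
  (LinearMap.mul ℂ A).flip.comp ((1 / 2 : ℂ) • (LinearMap.id + sgn H A)) +
    ((LinearMap.mul ℂ A).flip.comp ((1 / 2 : ℂ) • (LinearMap.id - sgn H A))).compl₂ (sgn H A)

theorem koszulSign_mul_of_one {i : ℤ} (h : koszulSign i = 1) (j : ℤ) : koszulSign (i * j) = 1 := by
  unfold koszulSign at *; rw [zpow_mul, h, one_zpow]

theorem koszulSign_mul_of_neg {i : ℤ} (h : koszulSign i = -1) (j : ℤ) :
    koszulSign (i * j) = koszulSign j := by
  unfold koszulSign at *; rw [zpow_mul, h]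

theorem signedOp_of_mem {i j : ℤ} {x y : A} (hx : x ∈ gr H i) (hy : y ∈ gr H j) :
    signedOp H A x y = koszulSign (i * j) • (y * x) := by
  simp only [signedOp, LinearMap.add_apply, LinearMap.comp_apply, LinearMap.smul_apply,
    LinearMap.sub_apply, LinearMap.id_apply, LinearMap.flip_apply, LinearMap.mul_apply',
    LinearMap.compl₂_apply, sgn_of_mem hx, sgn_of_mem hy]
  rcases koszulSign_cases i with h | h
  · rw [koszulSign_mul_of_one h, h]
    simp only [one_smul, sub_self, smul_zero, mul_zero, add_zero, mul_smul_comm, mul_add]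
    module
  · rw [koszulSign_mul_of_neg h, h]
    simp only [neg_smul, one_smul, sub_neg_eq_add, add_neg_cancel, smul_zero, mul_zero, zero_add,
      mul_smul_comm, mul_add, smul_mul_assoc]
    module

variable (H A) in
/-- The graded commutator `[x, y] = x y - (-1)^{|x||y|} y x`. -/
noncomputable def gcomm : A →ₗ[ℂ] A →ₗ[ℂ] A := LinearMap.mul ℂ A - signedOp H A

theorem gcomm_of_mem {i j : ℤ} {x y : A} (hx : x ∈ gr H i) (hy : y ∈ gr H j) :
    gcomm H A x y = x * y - koszulSign (i * j) • (y * x) := by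
  simp [gcomm, signedOp_of_mem hx hy]


theorem aug_sgn (x : A) : aug H (sgn H A x) = aug H x := by
  refine hom_induction (H := H) (fun k x hx => ?_) (fun x y hx hy => ?_) x
  · rw [sgn_of_mem hx]
    rcases eq_or_ne k 0 with rfl | hk
    · rw [koszulSign_zero, one_smul]
    · simp [aug_of_mem hx hk]
  · simp [hx, hy]

theorem sgn_mem {k : ℤ} {x : A} (hx : x ∈ gr H k) : sgn H A x ∈ gr H k := by
  rw [sgn_of_mem hx]; exact Submodule.smul_mem _ _ hx

theorem sgn_act (h : H) (x : A) : sgn H A (act h x) = act h (sgn H A x) := by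
  refine hom_induction (H := H) (fun k x hx => ?_) (fun x y hx hy => ?_) x
  · rw [sgn_of_mem hx, sgn_of_mem (act_mem h hx), map_smul]
  · simp [hx, hy]

theorem sgn_bd (x : A) : sgn H A (bd H x) = - bd H (sgn H A x) := by
  refine hom_induction (H := H) (fun k x hx => ?_) (fun x y hx hy => ?_) x
  · rw [sgn_of_mem hx, sgn_of_mem (bd_mem hx), map_smul, koszulSign_add, koszulSign_one]
    module
  · simp [hx, hy]; abel

variable (H A)

/-- The differential of `R`. -/
noncomputable def bdR : nonunital H A →ₗ[ℂ] nonunital H A :=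
  (bd H (A := A)).restrict fun x _ => aug_bd x

/-- The action of `H` on `R`. -/
noncomputable def actR : H →ₗ[ℂ] nonunital H A →ₗ[ℂ] nonunital H A where
  toFun h := LinearMap.restrict (act h : A →ₗ[ℂ] A) fun x (hx : aug H x = 0) => by
    rw [mem_nonunital, aug_act, hx, mul_zero]
  map_add' h h' := by ext x; exact congrArg (fun f : Module.End ℂ A => f x) (map_add _ h h')
  map_smul' c h := by ext x; exact congrArg (fun f : Module.End ℂ A => f x) (map_smul _ c h)

/-- Right multiplication by `r` on `R`. -/
noncomputable def mulRightR (r : nonunital H A) : nonunital H A →ₗ[ℂ] nonunital H A :=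
  (LinearMap.mulRight ℂ (r : A)).restrict fun x (hx : aug H x = 0) => by
    simp [mem_nonunital, hx]

/-- `Ω¹(R) = R̃ ⊗ R`, the element `x ⊗ z` being `x dz`. -/
abbrev Omega1 : Type u := A ⊗[ℂ] nonunital H A

/-- The universal derivation `d z = 1 ⊗ z`. -/
noncomputable def univDer : nonunital H A →ₗ[ℂ] Omega1 H A :=
  TensorProduct.mk ℂ A (nonunital H A) 1

variable {A} in
/-- Left multiplication by `a` on `Ω¹(R)`: `a (x dz) = (a x) dz`. -/
noncomputable def formL (a : A) : Omega1 H A →ₗ[ℂ] Omega1 H A :=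
  LinearMap.rTensor _ (LinearMap.mulLeft ℂ a)

/-- Right multiplication by `r` on `Ω¹(R)`: `(x dz) r = x d(z r) - (x z) dr`. -/
noncomputable def formR (r : nonunital H A) : Omega1 H A →ₗ[ℂ] Omega1 H A :=
  LinearMap.lTensor A (mulRightR H A r) -
    (TensorProduct.mk ℂ A (nonunital H A)).flip r ∘ₗ LinearMap.mul' ℂ A ∘ₗ
      LinearMap.lTensor A (nonunital H A).subtype

/-- The forms of degree `k`. -/
def formGr (k : ℤ) : Submodule ℂ (Omega1 H A) :=
  Submodule.span ℂ {ω | ∃ (i j : ℤ) (x : A) (z : nonunital H A),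
    x ∈ gr H i ∧ (z : A) ∈ gr H j ∧ i + j = k ∧ ω = x ⊗ₜ z}

/-- The linear span `[Ω¹(R), R]` of the graded commutators `ω r - (-1)^{|ω||r|} r ω`. -/
def formComm : Submodule ℂ (Omega1 H A) :=
  Submodule.span ℂ {η | ∃ (m k : ℤ) (ω : Omega1 H A) (r : nonunital H A),
    ω ∈ formGr H A m ∧ (r : A) ∈ gr H k ∧
      η = formR H A r ω - koszulSign (m * k) • formL H (r : A) ω}

/-- The differential on `Ω¹(R)`: `∂(x dz) = (∂x) dz + (-1)^{|x|} x d(∂z)`. -/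
noncomputable def formBd : Omega1 H A →ₗ[ℂ] Omega1 H A :=
  LinearMap.rTensor _ (bd H) + TensorProduct.map (sgn H A) (bdR H A)

/-- The diagonal action of `H` on `Ω¹(R)`: `h(x dz) = ∑ h₀(x) d(h₁(z))`. -/
noncomputable def formAct : H →ₗ[ℂ] Omega1 H A →ₗ[ℂ] Omega1 H A :=
  TensorProduct.map₂ (act (H := H) (A := A)).toLinearMap (actR H A) ∘ₗ Coalgebra.comul

/-- `b(x dz) = [x, z]`. -/
noncomputable def formB : Omega1 H A →ₗ[ℂ] nonunital H A :=
  (TensorProduct.lift ((gcomm H A).compl₂ (nonunital H A).subtype)).codRestrict _ fun ω => by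
    refine TensorProduct.induction_on ω ?_ (fun x z => ?_) (fun x y hx hy => ?_)
    · simp
    · have hz : aug H (z : A) = 0 := z.2
      have hz' : aug H (sgn H A (z : A)) = 0 := by rw [aug_sgn, hz]
      simp [mem_nonunital, gcomm, signedOp, hz, hz']
    · rw [map_add]; exact add_mem hx hy

variable {H A}

@[simp] theorem coe_bdR (x : nonunital H A) : (bdR H A x : A) = bd H (x : A) := rfl

@[simp] theorem coe_actR (h : H) (x : nonunital H A) : (actR H A h x : A) = act h (x : A) := rfl

@[simp] theorem coe_mulRightR (r x : nonunital H A) :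
    (mulRightR H A r x : A) = (x : A) * (r : A) := rfl

@[simp] theorem univDer_apply (z : nonunital H A) : univDer H A z = (1 : A) ⊗ₜ z := rfl

@[simp] theorem formL_tmul (a x : A) (z : nonunital H A) :
    formL H a (x ⊗ₜ z) = (a * x) ⊗ₜ z := rfl

@[simp] theorem formR_tmul (x : A) (r z : nonunital H A) :
    formR H A r (x ⊗ₜ z) = x ⊗ₜ mulRightR H A r z - (x * (z : A)) ⊗ₜ r := by
  simp [formR]

@[simp] theorem formBd_tmul (x : A) (z : nonunital H A) :
    formBd H A (x ⊗ₜ z) = bd H x ⊗ₜ z + sgn H A x ⊗ₜ bdR H A z := rfl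

@[simp] theorem coe_formB_tmul (x : A) (z : nonunital H A) :
    (formB H A (x ⊗ₜ z) : A) = gcomm H A x (z : A) := rfl

theorem formAct_tmul {ι : Type*} {h : H} (r : Coalgebra.Repr ℂ h ι) (x : A)
    (z : nonunital H A) :
    formAct H A h (x ⊗ₜ z) = ∑ i ∈ r.index, act (r.left i) x ⊗ₜ actR H A (r.right i) z := by
  simp [formAct, ← r.eq]

/-- The projection of `R̃` onto `R`. -/
noncomputable def projR : A →ₗ[ℂ] nonunital H A :=
  (LinearMap.id - (aug H (A := A)).toLinearMap.smulRight 1).codRestrict _ fun x => by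
    simp [mem_nonunital]

theorem coe_projR (x : A) : (projR (H := H) x : A) = x - aug H x • 1 := rfl

theorem projR_coe (z : nonunital H A) : projR (H := H) (z : A) = z := by
  have hz : aug H (z : A) = 0 := z.2
  ext; simp [coe_projR, hz]

theorem projR_mem {k : ℤ} {x : A} (hx : x ∈ gr H k) : (projR (H := H) x : A) ∈ gr H k := by
  rw [coe_projR]
  rcases eq_or_ne k 0 with rfl | hk
  · exact sub_mem hx (Submodule.smul_mem _ _ one_mem)
  · simpa [aug_of_mem hx hk] using hx

@[elab_as_elim]
theorem homR_induction {p : nonunital H A → Prop}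
    (hom : ∀ k (x : nonunital H A), (x : A) ∈ gr H k → p x)
    (add : ∀ x y, p x → p y → p (x + y)) (x : nonunital H A) : p x := by
  rw [← projR_coe x]
  refine hom_induction (H := H) (p := fun x => p (projR x)) (fun k x hx => ?_)
    (fun x y hx hy => ?_) (x : A)
  · exact hom k _ (projR_mem hx)
  · rw [map_add]; exact add _ _ hx hy

@[elab_as_elim]
theorem form_induction {p : Omega1 H A → Prop}
    (hom : ∀ i j (x : A) (z : nonunital H A), x ∈ gr H i → (z : A) ∈ gr H j → p (x ⊗ₜ z))
    (add : ∀ x y, p x → p y → p (x + y)) (ω : Omega1 H A) : p ω := by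
  refine TensorProduct.induction_on ω ?_ (fun x z => ?_) add
  · simpa using hom 0 0 0 0 (zero_mem _) (zero_mem _)
  · refine hom_induction (H := H) (p := fun x => p (x ⊗ₜ z)) (fun i x hx => ?_)
      (fun x y hx hy => ?_) x
    · refine homR_induction (p := fun z => p (x ⊗ₜ z)) (fun j z hz => ?_)
        (fun z w hz hw => ?_) z
      · exact hom i j x z hx hz
      · rw [TensorProduct.tmul_add]; exact add _ _ hz hw
    · rw [TensorProduct.add_tmul]; exact add _ _ hx hy

theorem formBd_formBd (ω : Omega1 H A) : formBd H A (formBd H A ω) = 0 := by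
  refine form_induction (fun i j x z hx hz => ?_) (fun x y hx hy => ?_) ω
  swap
  · simp [hx, hy]
  · have h1 : bdR H A (bdR H A z) = 0 := by ext; simp [bd_bd]
    simp [bd_bd, sgn_bd, h1, TensorProduct.neg_tmul]

theorem formAct_formBd (h : H) (ω : Omega1 H A) :
    formAct H A h (formBd H A ω) = formBd H A (formAct H A h ω) := by
  refine form_induction (fun i j x z hx hz => ?_) (fun x y hx hy => ?_) ω
  swap
  · simp [hx, hy]
  · have h1 : ∀ g, bdR H A (actR H A g z) = actR H A g (bdR H A z) := fun g => by
      ext; simp [act_bd]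
    simp only [formBd_tmul, map_add, formAct_tmul (Coalgebra.Repr.arbitrary ℂ h), map_sum,
      act_bd, sgn_act, h1, Finset.sum_add_distrib]

theorem formBd_mem {k : ℤ} {ω : Omega1 H A} (hω : ω ∈ formGr H A k) :
    formBd H A ω ∈ formGr H A (k + 1) := by
  induction hω using Submodule.span_induction with
  | zero => simp
  | add x y _ _ hx hy => rw [map_add]; exact add_mem hx hy
  | smul c x _ hx => rw [map_smul]; exact Submodule.smul_mem _ _ hx
  | mem ω h =>
    obtain ⟨i, j, x, z, hx, hz, rfl, rfl⟩ := h
    rw [formBd_tmul]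
    refine add_mem (Submodule.subset_span ⟨i + 1, j, _, _, bd_mem hx, hz, by ring, rfl⟩)
      (Submodule.subset_span ⟨i, j + 1, _, _, sgn_mem hx, ?_, by ring, rfl⟩)
    exact bd_mem hz

/-- The basic graded commutator. -/
theorem comm_mem {i j k : ℤ} {x : A} {z r : nonunital H A} (hx : x ∈ gr H i)
    (hz : (z : A) ∈ gr H j) (hr : (r : A) ∈ gr H k) :
    x ⊗ₜ mulRightR H A r z - (x * (z : A)) ⊗ₜ r - koszulSign ((i + j) * k) • ((r : A) * x) ⊗ₜ z
      ∈ formComm H A := by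
  refine Submodule.subset_span ⟨i + j, k, x ⊗ₜ z, r,
    Submodule.subset_span ⟨i, j, x, z, hx, hz, rfl, rfl⟩, hr, ?_⟩
  simp

/-- To check that a linear map sends commutators into `P`, use the basic ones. -/
theorem comm_le {M : Type*} [AddCommGroup M] [Module ℂ M] (f : Omega1 H A →ₗ[ℂ] M)
    (P : Submodule ℂ M)
    (hf : ∀ {i j k : ℤ} {x : A} {z r : nonunital H A}, x ∈ gr H i → (z : A) ∈ gr H j →
      (r : A) ∈ gr H k →
      f (x ⊗ₜ mulRightR H A r z - (x * (z : A)) ⊗ₜ r -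
        koszulSign ((i + j) * k) • ((r : A) * x) ⊗ₜ z) ∈ P) :
    formComm H A ≤ P.comap f := by
  refine Submodule.span_le.2 ?_
  rintro _ ⟨m, k, ω, r, hω, hr, rfl⟩
  rw [SetLike.mem_coe, Submodule.mem_comap]
  induction hω using Submodule.span_induction with
  | zero => simp
  | add x y _ _ hx hy =>
    have : formR H A r (x + y) - koszulSign (m * k) • formL H (r : A) (x + y) =
      (formR H A r x - koszulSign (m * k) • formL H (r : A) x) +
      (formR H A r y - koszulSign (m * k) • formL H (r : A) y) := by
      simp only [map_add]; module
    rw [this, map_add]; exact add_mem hx hy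
  | smul c x _ hx =>
    have : formR H A r (c • x) - koszulSign (m * k) • formL H (r : A) (c • x) =
      c • (formR H A r x - koszulSign (m * k) • formL H (r : A) x) := by
      simp only [map_smul]; module
    rw [this, map_smul]; exact Submodule.smul_mem _ _ hx
  | mem ω h =>
    obtain ⟨i, j, x, z, hx, hz, rfl, rfl⟩ := h
    simpa using hf hx hz hr

theorem formBd_comm : formComm H A ≤ (formComm H A).comap (formBd H A) := by
  refine comm_le _ _ ?_
  intro i j k x z r hx hz hr
  have h1 := comm_mem (bd_mem hx) hz hr
  have h2 := comm_mem (z := bdR H A z) hx (bd_mem hz) hr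
  have h3 := comm_mem (r := bdR H A r) hx hz (bd_mem hr)
  have e1 : bdR H A (mulRightR H A r z) =
      mulRightR H A r (bdR H A z) + koszulSign j • mulRightR H A (bdR H A r) z := by
    ext; simp [bd_mul hz]
  have e2 := bd_mul hx (z : A)
  have e3 := bd_mul hr x
  have e4 := sgn_of_mem hx
  have e5 := sgn_of_mem (mul_mem hx hz)
  have e6 := sgn_of_mem (mul_mem hr hx)
  convert add_mem (add_mem h1 (Submodule.smul_mem _ (koszulSign i) h2))
    (Submodule.smul_mem _ (koszulSign (i + j)) h3) using 1
  simp only [map_sub, map_smul, formBd_tmul, e1, e2, e3, e4, e5, e6, coe_bdR,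
    TensorProduct.tmul_add, TensorProduct.add_tmul, TensorProduct.tmul_smul, ← TensorProduct.smul_tmul',
    koszulSign_add, add_mul, mul_add, mul_one, one_mul]
  rcases koszulSign_cases i with h | h <;> rcases koszulSign_cases j with h' | h' <;>
  rcases koszulSign_cases k with h'' | h'' <;>
  simp only [h, h', h''] <;> module

theorem twistedAntipode_repr {ι : Type*} (δ : H →ₐ[ℂ] ℂ) {h : H} (r : Coalgebra.Repr ℂ h ι) :
    twistedAntipode δ h = ∑ i ∈ r.index, δ (r.left i) • HopfAlgebra.antipode ℂ (r.right i) := by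
  simp [twistedAntipode, ← r.eq]

theorem twistedAntipode_one (δ : H →ₐ[ℂ] ℂ) : twistedAntipode δ (1 : H) = 1 := by
  simp [twistedAntipode, Algebra.TensorProduct.one_def]

open Coalgebra in
theorem twistedAntipode_mul (δ : H →ₐ[ℂ] ℂ) (g h : H) :
    twistedAntipode δ (g * h) = twistedAntipode δ h * twistedAntipode δ g := by
  rw [twistedAntipode_repr δ ((ℛ ℂ g).mul (ℛ ℂ h)), twistedAntipode_repr δ (ℛ ℂ g),
    twistedAntipode_repr δ (ℛ ℂ h), Finset.sum_mul_sum, Finset.sum_comm, ← Finset.sum_product']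
  refine Finset.sum_congr rfl fun i _ => ?_
  simp only [Coalgebra.Repr.mul, Coalgebra.Repr.induced, Coalgebra.Repr.tmul]
  simp [HopfAlgebra.antipode_mul_antidistrib, smul_smul]

open Coalgebra in
theorem sum_twistedAntipode_mul {ι : Type*} (δ : H →ₐ[ℂ] ℂ) {h : H} (r : Coalgebra.Repr ℂ h ι) :
    ∑ i ∈ r.index, twistedAntipode δ (r.left i) * r.right i = δ h • 1 := by
  have key := congrArg ((TensorProduct.lid ℂ H).toLinearMap ∘ₗ
    TensorProduct.map δ.toLinearMap (LinearMap.mul' ℂ H ∘ₗ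
      LinearMap.rTensor H (HopfAlgebra.antipode ℂ)))
    (sum_tmul_tmul_eq r (fun i => ℛ ℂ (r.left i)) (fun i => ℛ ℂ (r.right i)))
  simp only [map_sum, LinearMap.comp_apply, TensorProduct.map_tmul, LinearMap.rTensor_tmul,
    LinearEquiv.coe_coe, TensorProduct.lid_tmul, LinearMap.mul'_apply,
    AlgHom.toLinearMap_apply, ← Finset.smul_sum, HopfAlgebra.sum_antipode_mul_eq_smul] at key
  have e : ∀ i, twistedAntipode δ (r.left i) * r.right i =
      ∑ j ∈ (ℛ ℂ (r.left i)).index, δ ((ℛ ℂ (r.left i)).left j) •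
        (HopfAlgebra.antipode ℂ ((ℛ ℂ (r.left i)).right j) * r.right i) := fun i => by
    rw [twistedAntipode_repr δ (ℛ ℂ (r.left i)), Finset.sum_mul]
    simp
  simp only [e, key]
  have e2 := congrArg (TensorProduct.lift (LinearMap.lsmul ℂ ℂ ∘ₗ δ.toLinearMap))
    (sum_tmul_counit_eq r)
  simp only [map_sum, TensorProduct.lift.tmul, LinearMap.comp_apply, AlgHom.toLinearMap_apply,
    LinearMap.lsmul_apply, smul_eq_mul, mul_one] at e2
  simp only [smul_smul, ← Finset.sum_smul, e2]

/-- If `S_δ² = id` then `∑ S_δ(h₁) h₀ = δ(h) 1`. -/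
theorem sum_twistedAntipode_mul' {ι : Type*} (δ : H →ₐ[ℂ] ℂ)
    (hδ : twistedAntipode δ ∘ₗ twistedAntipode δ = LinearMap.id) {h : H}
    (r : Coalgebra.Repr ℂ h ι) :
    ∑ i ∈ r.index, twistedAntipode δ (r.right i) * r.left i = δ h • 1 := by
  have e := congrArg (twistedAntipode δ) (sum_twistedAntipode_mul δ r)
  have hh : ∀ x, twistedAntipode δ (twistedAntipode δ x) = x := fun x =>
    LinearMap.congr_fun hδ x
  simpa [twistedAntipode_mul, hh, twistedAntipode_one] using e

variable (H A) in
/-- The coinvariants of `R̃`. -/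
abbrev coinvA (δ : H →ₐ[ℂ] ℂ) : Submodule ℂ A := coinvariants δ fun h => (act h : A →ₗ[ℂ] A)

open Coalgebra in
theorem act_mul_antipode {ι : Type*} {h : H} (r : Coalgebra.Repr ℂ h ι) (z x : A) :
    ∑ i ∈ r.index, act (r.left i) (z * act (HopfAlgebra.antipode ℂ (r.right i)) x) =
      act h z * x := by
  let fz : H →ₗ[ℂ] A := (act (H := H) (A := A)).toLinearMap.flip z
  let fx : H →ₗ[ℂ] A := (act (H := H) (A := A)).toLinearMap.flip x
  have key := congrArg (LinearMap.mul' ℂ A ∘ₗ TensorProduct.map fz (fx ∘ₗ LinearMap.mul' ℂ H ∘ₗ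
      LinearMap.lTensor H (HopfAlgebra.antipode ℂ)))
    (sum_tmul_tmul_eq r (fun i => ℛ ℂ (r.left i)) (fun i => ℛ ℂ (r.right i)))
  have e1 : ∀ g, fz g = act g z := fun g => rfl
  have e2 : ∀ g, fx g = act g x := fun g => rfl
  simp only [map_sum, LinearMap.comp_apply, TensorProduct.map_tmul, LinearMap.lTensor_tmul,
    LinearMap.mul'_apply, e1, e2, map_mul, Module.End.mul_apply] at key
  simp only [act_mul_repr _ _ _ (ℛ ℂ (r.left _)), key]
  have e3 : ∀ i, ∑ j ∈ (ℛ ℂ (r.right i)).index, act (r.left i) z *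
      act ((ℛ ℂ (r.right i)).left j) (act (HopfAlgebra.antipode ℂ ((ℛ ℂ (r.right i)).right j)) x)
      = (counit (R := ℂ) (r.right i) • act (r.left i) z) * x := fun i => by
    have := congrArg (fun g => act (r.left i) z * act g x)
      (HopfAlgebra.sum_mul_antipode_eq_smul (ℛ ℂ (r.right i)))
    simp only [map_sum, LinearMap.sum_apply, Finset.mul_sum, map_mul, Module.End.mul_apply,
      map_smul, LinearMap.smul_apply, map_one, Module.End.one_apply] at this
    rw [this]; simp
  simp only [e3, ← Finset.sum_mul]
  have e4 := congrArg (fun g => act g z) (congrArg (TensorProduct.rid ℂ H) (sum_tmul_counit_eq r))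
  simp only [map_sum, TensorProduct.rid_tmul, LinearMap.sum_apply, map_smul, LinearMap.smul_apply,
    one_smul] at e4
  rw [e4]

open Coalgebra in
/-- Modulo coinvariants, `h(z) x ≡ z S_δ(h)(x)`. -/
theorem act_mul_sub_mem (δ : H →ₐ[ℂ] ℂ) (h : H) (z x : A) :
    act h z * x - z * act (twistedAntipode δ h) x ∈ coinvA H A δ := by
  have e : z * act (twistedAntipode δ h) x = ∑ i ∈ (ℛ ℂ h).index,
      δ ((ℛ ℂ h).left i) • (z * act (HopfAlgebra.antipode ℂ ((ℛ ℂ h).right i)) x) := by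
    rw [twistedAntipode_repr δ (ℛ ℂ h)]
    simp [Finset.mul_sum]
  rw [← act_mul_antipode (ℛ ℂ h), e, ← Finset.sum_sub_distrib]
  exact sum_mem fun i _ => Submodule.subset_span ⟨_, _, rfl⟩

open Coalgebra in
/-- If `S_δ² = id` then, modulo coinvariants, `∑ h₁(z) h₀(x) ≡ δ(h) z x`. -/
theorem act_swap_sub_mem (δ : H →ₐ[ℂ] ℂ)
    (hδ : twistedAntipode δ ∘ₗ twistedAntipode δ = LinearMap.id) {ι : Type*} {h : H}
    (r : Coalgebra.Repr ℂ h ι) (z x : A) :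
    ∑ i ∈ r.index, act (r.right i) z * act (r.left i) x - δ h • (z * x) ∈ coinvA H A δ := by
  have e : δ h • (z * x) = ∑ i ∈ r.index,
      z * act (twistedAntipode δ (r.right i)) (act (r.left i) x) := by
    have := congrArg (fun g => z * act g x) (sum_twistedAntipode_mul' δ hδ r)
    simp only [map_sum, LinearMap.sum_apply, Finset.mul_sum, map_mul, Module.End.mul_apply,
      map_smul, LinearMap.smul_apply, map_one, Module.End.one_apply] at this
    rw [this]; simp
  rw [e, ← Finset.sum_sub_distrib]
  exact sum_mem fun i _ => act_mul_sub_mem δ _ _ _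

/-- The coinvariants of `R`. -/
noncomputable abbrev coinvR (H A : Type u) [Ring H] [HopfAlgebra ℂ H] [Ring A] [Algebra ℂ A] [HDGAlgebra H A]
    (δ : H →ₐ[ℂ] ℂ) : Submodule ℂ (nonunital H A) := coinvariants δ fun h => actR H A h

/-- The coinvariants of `Ω¹(R)`. -/
noncomputable abbrev coinvForm (H A : Type u) [Ring H] [HopfAlgebra ℂ H] [Ring A] [Algebra ℂ A]
    [HDGAlgebra H A] (δ : H →ₐ[ℂ] ℂ) : Submodule ℂ (Omega1 H A) :=
  coinvariants δ fun h => formAct H A h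

theorem projR_act (h : H) (x : A) : projR (act h x) = actR H A h (projR x) := by
  ext; simp [coe_projR, aug_act, act_one, smul_smul, mul_comm]

theorem projR_coinv (δ : H →ₐ[ℂ] ℂ) : coinvA H A δ ≤ (coinvR H A δ).comap (projR (H := H)) := by
  refine Submodule.span_le.2 ?_
  rintro _ ⟨h, m, rfl⟩
  refine Submodule.subset_span ⟨h, projR m, ?_⟩
  rw [map_sub, projR_act, map_smul]

theorem coinv_le {M N : Type u} [AddCommGroup M] [Module ℂ M] [AddCommGroup N] [Module ℂ N]
    (δ : H →ₐ[ℂ] ℂ) {ρ : H → M →ₗ[ℂ] M} {ρ' : H → N →ₗ[ℂ] N} (f : M →ₗ[ℂ] N)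
    (hf : ∀ h m, f (ρ h m) = ρ' h (f m)) : coinvariants δ ρ ≤ (coinvariants δ ρ').comap f := by
  refine Submodule.span_le.2 ?_
  rintro _ ⟨h, m, rfl⟩
  refine Submodule.subset_span ⟨h, f m, ?_⟩
  rw [map_sub, hf, map_smul]

theorem formB_coinv (δ : H →ₐ[ℂ] ℂ)
    (hδ : twistedAntipode δ ∘ₗ twistedAntipode δ = LinearMap.id) :
    coinvForm H A δ ≤ (coinvR H A δ).comap (formB H A) := by
  refine Submodule.span_le.2 ?_
  rintro _ ⟨h, ω, rfl⟩
  rw [SetLike.mem_coe, Submodule.mem_comap]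
  refine form_induction (fun i j x z hx hz => ?_) (fun x y hx hy => ?_) ω
  swap
  · have : formAct H A h (x + y) - δ h • (x + y) = (formAct H A h x - δ h • x) +
      (formAct H A h y - δ h • y) := by rw [map_add]; module
    rw [this, map_add]; exact add_mem hx hy
  · let r := Coalgebra.Repr.arbitrary ℂ h
    have e : formB H A (formAct H A h (x ⊗ₜ z) - δ h • x ⊗ₜ z) =
        projR (H := H) (act h (x * (z : A)) - δ h • (x * (z : A))) - koszulSign (i * j) •
          projR (H := H) (∑ i ∈ r.index, act (r.right i) (z : A) * act (r.left i) x
            - δ h • ((z : A) * x)) := by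
      have hz0 : aug H (z : A) = 0 := z.2
      ext
      rw [act_mul_repr h x (z : A) r, formAct_tmul r]
      simp only [map_sub, map_sum, map_smul, Submodule.coe_sub, Submodule.coe_smul,
        coe_formB_tmul, coe_actR, gcomm_of_mem (act_mem _ hx) (act_mem _ hz), gcomm_of_mem hx hz,
        AddSubmonoidClass.coe_finsetSum, coe_projR, map_mul, hz0, aug_act, mul_zero, zero_mul,
        zero_smul, sub_zero, Finset.sum_sub_distrib, ← Finset.smul_sum]
      module
    rw [e]
    refine sub_mem (projR_coinv δ (Submodule.subset_span ⟨h, _, rfl⟩))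
      (Submodule.smul_mem _ _ (projR_coinv δ (act_swap_sub_mem δ hδ r _ _)))

theorem bd_mul' (x y : A) : bd H (x * y) = bd H x * y + sgn H A x * bd H y := by
  refine hom_induction (H := H) (fun k x hx => ?_) (fun x y hx hy => ?_) x
  · rw [bd_mul hx, sgn_of_mem hx, smul_mul_assoc]
  · simp only [add_mul, map_add, hx, hy]; abel

theorem sgn_mul (x y : A) : sgn H A (x * y) = sgn H A x * sgn H A y := by
  refine hom_induction (H := H) (fun k x hx => ?_) (fun x y hx hy => ?_) x
  · refine hom_induction (H := H) (fun l y hy => ?_) (fun x y hx hy => ?_) y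
    · rw [sgn_of_mem (mul_mem hx hy), sgn_of_mem hx, sgn_of_mem hy, koszulSign_add]
      simp only [smul_mul_assoc, mul_smul_comm, smul_smul, mul_comm (koszulSign k)]
    · simp only [mul_add, map_add, hx, hy]
  · simp only [add_mul, map_add, hx, hy]

variable (H) in
/-- A subspace is homogeneous if it is the sum of its components. -/
def IsHom (S : Submodule ℂ A) : Prop := S ≤ ⨆ k, S ⊓ gr H k

@[elab_as_elim]
theorem IsHom.induction {S : Submodule ℂ A} (hS : IsHom H S) {p : A → Prop}
    (hom : ∀ k x, x ∈ S → x ∈ gr H k → p x) (add : ∀ x y, p x → p y → p (x + y))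
    {x : A} (hx : x ∈ S) : p x :=
  Submodule.iSup_induction _ (motive := p) (hS hx) (fun k x h => hom k x h.1 h.2)
    (hom 0 0 (zero_mem _) (zero_mem _)) add

theorem IsHom.sgn_mem {S : Submodule ℂ A} (hS : IsHom H S) {x : A} (hx : x ∈ S) :
    sgn H A x ∈ S := by
  refine hS.induction (p := fun x => sgn H A x ∈ S) (fun k x h h' => ?_) (fun x y h h' => ?_) hx
  · rw [sgn_of_mem h']; exact Submodule.smul_mem _ _ h
  · rw [map_add]; exact add_mem h h'

theorem isHom_top : IsHom H (⊤ : Submodule ℂ A) := by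
  simp [IsHom, iSup_gr]

theorem IsHom.mul {S T : Submodule ℂ A} (hS : IsHom H S) (hT : IsHom H T) : IsHom H (S * T) := by
  refine Submodule.mul_le.2 fun x hx y hy => ?_
  refine hS.induction (p := fun x => x * y ∈ _) (fun k x h h' => ?_) (fun x y h h' => ?_) hx
  · refine hT.induction (p := fun y => x * y ∈ _) (fun l y g g' => ?_) (fun x y h h' => ?_) hy
    · exact Submodule.mem_iSup_of_mem (k + l) ⟨Submodule.mul_mem_mul h g, mul_mem h' g'⟩
    · rw [mul_add]; exact add_mem h h'
  · rw [add_mul]; exact add_mem h h'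

end HDGAlgebra

open HDGAlgebra

/-- A two-sided ideal of the non-unital algebra `R` that is homogeneous and stable under the
differential and the action of `H`. -/
structure HDGIdeal (H A : Type u) [Ring H] [HopfAlgebra ℂ H] [Ring A] [Algebra ℂ A]
    [HDGAlgebra H A] where
  /-- the underlying subspace -/
  carrier : Submodule ℂ A
  le : carrier ≤ nonunital H A
  mul_left : ∀ (a : A) {x}, x ∈ carrier → a * x ∈ carrier
  mul_right : ∀ (a : A) {x}, x ∈ carrier → x * a ∈ carrier
  isHom : IsHom H carrier
  bd_mem : ∀ {x}, x ∈ carrier → bd H x ∈ carrier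
  act_mem : ∀ (h : H) {x}, x ∈ carrier → act h x ∈ carrier

namespace HDGIdeal

variable {H A : Type u} [Ring H] [HopfAlgebra ℂ H] [Ring A] [Algebra ℂ A] [HDGAlgebra H A]
  (I : HDGIdeal H A)

/-- The powers of an ideal, with `I⁰ = R̃`. -/
def pow : ℕ → Submodule ℂ A
  | 0 => ⊤
  | n + 1 => pow n * I.carrier

theorem pow_isHom (n : ℕ) : IsHom H (I.pow n) := by
  induction n with
  | zero => exact isHom_top
  | succ n ih => exact ih.mul I.isHom

theorem pow_one : I.pow 1 = I.carrier := by
  refine le_antisymm (Submodule.mul_le.2 fun a _ x hx => I.mul_left a hx) fun x hx => ?_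
  rw [← one_mul x]
  exact Submodule.mul_mem_mul trivial hx

theorem pow_mul_left (n : ℕ) (a : A) {x : A} (hx : x ∈ I.pow n) : a * x ∈ I.pow n := by
  induction n generalizing x with
  | zero => trivial
  | succ n ih =>
    refine Submodule.mul_induction_on hx (fun y hy z hz => ?_) fun y z hy hz => ?_
    · rw [← mul_assoc]; exact Submodule.mul_mem_mul (ih hy) hz
    · rw [mul_add]; exact add_mem hy hz

theorem pow_mul_right (n : ℕ) (a : A) {x : A} (hx : x ∈ I.pow n) : x * a ∈ I.pow n := by
  cases n with
  | zero => trivial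
  | succ n =>
    refine Submodule.mul_induction_on hx (fun y hy z hz => ?_) fun y z hy hz => ?_
    · rw [mul_assoc]; exact Submodule.mul_mem_mul hy (I.mul_right a hz)
    · rw [add_mul]; exact add_mem hy hz

theorem mul_mem_pow (n : ℕ) {v x : A} (hv : v ∈ I.carrier) (hx : x ∈ I.pow n) :
    v * x ∈ I.pow (n + 1) := by
  induction n generalizing x with
  | zero => rw [zero_add, I.pow_one]; exact I.mul_right x hv
  | succ n ih =>
    refine Submodule.mul_induction_on hx (fun y hy z hz => ?_) fun y z hy hz => ?_
    · rw [← mul_assoc]; exact Submodule.mul_mem_mul (ih hy) hz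
    · rw [mul_add]; exact add_mem hy hz

theorem pow_mul_pow (a b : ℕ) {x y : A} (hx : x ∈ I.pow a) (hy : y ∈ I.pow b) :
    x * y ∈ I.pow (a + b) := by
  induction b generalizing y with
  | zero => exact I.pow_mul_right _ _ hx
  | succ b ih =>
    refine Submodule.mul_induction_on hy (fun p hp q hq => ?_) fun p q hp hq => ?_
    · rw [← mul_assoc]; exact Submodule.mul_mem_mul (ih hp) hq
    · rw [mul_add]; exact add_mem hp hq

theorem pow_le (n : ℕ) : I.pow (n + 1) ≤ nonunital H A := by
  refine Submodule.mul_le.2 fun x _ y hy => ?_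
  have : aug H y = 0 := I.le hy
  rw [mem_nonunital, map_mul, this, mul_zero]

theorem pow_bd (n : ℕ) {x : A} (hx : x ∈ I.pow n) : bd H x ∈ I.pow n := by
  induction n generalizing x with
  | zero => trivial
  | succ n ih =>
    refine Submodule.mul_induction_on hx (fun y hy z hz => ?_) fun y z hy hz => ?_
    · rw [bd_mul']
      exact add_mem (Submodule.mul_mem_mul (ih hy) hz)
        (Submodule.mul_mem_mul ((I.pow_isHom n).sgn_mem hy) (I.bd_mem hz))
    · rw [map_add]; exact add_mem hy hz

theorem pow_act (n : ℕ) (h : H) {x : A} (hx : x ∈ I.pow n) : act h x ∈ I.pow n := by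
  induction n generalizing x h with
  | zero => trivial
  | succ n ih =>
    refine Submodule.mul_induction_on hx (fun y hy z hz => ?_) fun y z hy hz => ?_
    · rw [act_mul_repr h y z (Coalgebra.Repr.arbitrary ℂ h)]
      exact sum_mem fun i _ => Submodule.mul_mem_mul (ih _ hy) (I.act_mem _ hz)
    · rw [map_add]; exact add_mem hy hz

/-- `I^{n+1}`, as a subspace of `R`. -/
def powR (n : ℕ) : Submodule ℂ (nonunital H A) := (I.pow (n + 1)).comap (nonunital H A).subtype

/-- The subspace `I^{n+1} dR + I^n dI` of `Ω¹(R)`. -/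
def formPow (n : ℕ) : Submodule ℂ (Omega1 H A) :=
  Submodule.span ℂ {ω | ∃ (x : A) (z : nonunital H A), x ∈ I.pow (n + 1) ∧ ω = x ⊗ₜ z} ⊔
    Submodule.span ℂ {ω | ∃ (x : A) (z : nonunital H A),
      x ∈ I.pow n ∧ (z : A) ∈ I.carrier ∧ ω = x ⊗ₜ z}

/-- `I^{n+1} + coinv`, the subspace of `R` by which one divides in even degree. -/
noncomputable def evenRel (δ : H →ₐ[ℂ] ℂ) (n : ℕ) : Submodule ℂ (nonunital H A) :=
  I.powR n ⊔ coinvR H A δ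

/-- `[Ω¹(R), R] + coinv + I^{n+1} dR + I^n dI`, the subspace of `Ω¹(R)` by which one divides in
odd degree. -/
noncomputable def oddRel (δ : H →ₐ[ℂ] ℂ) (n : ℕ) : Submodule ℂ (Omega1 H A) :=
  (formComm H A ⊔ coinvForm H A δ) ⊔ I.formPow n

theorem powR_bd (n : ℕ) : I.powR n ≤ (I.powR n).comap (bdR H A) := fun x hx => by
  change bd H (x : A) ∈ I.pow (n + 1)
  exact I.pow_bd _ hx

theorem evenRel_bd (δ : H →ₐ[ℂ] ℂ) (n : ℕ) : I.evenRel δ n ≤ (I.evenRel δ n).comap (bdR H A) :=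
  sup_le ((I.powR_bd n).trans (Submodule.comap_mono le_sup_left))
    ((coinv_le δ (ρ' := fun h => actR H A h) _ fun h m => by ext; simp [act_bd]).trans
      (Submodule.comap_mono le_sup_right))

theorem formPow_bd (n : ℕ) : I.formPow n ≤ (I.formPow n).comap (formBd H A) := by
  refine sup_le (Submodule.span_le.2 ?_) (Submodule.span_le.2 ?_)
  · rintro _ ⟨x, z, hx, rfl⟩
    rw [SetLike.mem_coe, Submodule.mem_comap, formBd_tmul]
    exact Submodule.mem_sup_left (add_mem (Submodule.subset_span ⟨_, _, I.pow_bd _ hx, rfl⟩)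
      (Submodule.subset_span ⟨_, _, (I.pow_isHom _).sgn_mem hx, rfl⟩))
  · rintro _ ⟨x, z, hx, hz, rfl⟩
    rw [SetLike.mem_coe, Submodule.mem_comap, formBd_tmul]
    exact Submodule.mem_sup_right (add_mem (Submodule.subset_span ⟨_, _, I.pow_bd _ hx, hz, rfl⟩)
      (Submodule.subset_span ⟨_, _, (I.pow_isHom _).sgn_mem hx, I.bd_mem hz, rfl⟩))

theorem oddRel_bd (δ : H →ₐ[ℂ] ℂ) (n : ℕ) : I.oddRel δ n ≤ (I.oddRel δ n).comap (formBd H A) :=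
  sup_le (sup_le
    (formBd_comm.trans (Submodule.comap_mono (le_sup_left.trans le_sup_left)))
    ((coinv_le δ (ρ' := fun h => formAct H A h) _ fun h m => (formAct_formBd h m).symm).trans
      (Submodule.comap_mono (le_sup_right.trans le_sup_left))))
    ((I.formPow_bd n).trans (Submodule.comap_mono le_sup_right))

theorem formB_le (δ : H →ₐ[ℂ] ℂ)
    (hδ : twistedAntipode δ ∘ₗ twistedAntipode δ = LinearMap.id) (n : ℕ) :
    I.oddRel δ n ≤ (I.evenRel δ n).comap (formB H A) := by
  refine sup_le (sup_le ?_ ?_) (sup_le (Submodule.span_le.2 ?_) (Submodule.span_le.2 ?_))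
  · refine comm_le _ _ fun {i j k x z r} hx hz hr => ?_
    convert zero_mem (I.evenRel δ n)
    ext
    simp only [map_sub, map_smul, Submodule.coe_sub, Submodule.coe_smul, coe_formB_tmul,
      coe_mulRightR, gcomm_of_mem hx (mul_mem hz hr), gcomm_of_mem (mul_mem hx hz) hr,
      gcomm_of_mem (mul_mem hr hx) hz, Submodule.coe_zero, mul_assoc]
    simp only [add_mul, mul_add, koszulSign_add, mul_comm k j]
    rcases koszulSign_cases (i * j) with h | h <;> rcases koszulSign_cases (i * k) with h' | h' <;>
    rcases koszulSign_cases (j * k) with h'' | h'' <;>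
    simp only [h, h', h''] <;> module
  · exact (formB_coinv δ hδ).trans (Submodule.comap_mono le_sup_right)
  · rintro _ ⟨x, z, hx, rfl⟩
    refine Submodule.mem_sup_left ?_
    change gcomm H A x (z : A) ∈ I.pow (n + 1)
    simp only [gcomm, signedOp, LinearMap.sub_apply, LinearMap.add_apply, LinearMap.comp_apply,
      LinearMap.compl₂_apply, LinearMap.smul_apply, LinearMap.id_apply, LinearMap.flip_apply,
      LinearMap.mul_apply', mul_smul_comm]
    have hs := (I.pow_isHom (n + 1)).sgn_mem hx
    exact sub_mem (I.pow_mul_right _ _ hx) (add_mem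
      (Submodule.smul_mem _ _ (I.pow_mul_left _ _ (add_mem hx hs)))
      (Submodule.smul_mem _ _ (I.pow_mul_left _ _ (sub_mem hx hs))))
  · rintro _ ⟨x, z, hx, hz, rfl⟩
    refine Submodule.mem_sup_left ?_
    change gcomm H A x (z : A) ∈ I.pow (n + 1)
    simp only [gcomm, signedOp, LinearMap.sub_apply, LinearMap.add_apply, LinearMap.comp_apply,
      LinearMap.compl₂_apply, LinearMap.smul_apply, LinearMap.id_apply, LinearMap.flip_apply,
      LinearMap.mul_apply', mul_smul_comm]
    have hs := (I.pow_isHom n).sgn_mem hx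
    exact sub_mem (Submodule.mul_mem_mul hx hz) (add_mem
      (Submodule.smul_mem _ _ (I.mul_mem_pow _ hz (add_mem hx hs)))
      (Submodule.smul_mem _ _ (I.mul_mem_pow _ (I.isHom.sgn_mem hz) (sub_mem hx hs))))

theorem tmul_mem (δ : H →ₐ[ℂ] ℂ) (n b : ℕ) : ∀ a, a + b = n → ∀ y ∈ I.pow a,
    I.pow (b + 1) ≤ (I.oddRel δ n).comap
      (TensorProduct.mk ℂ A (nonunital H A) y ∘ₗ projR (H := H)) := by
  induction b with
  | zero =>
    rintro a rfl y hy x hx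
    rw [zero_add, I.pow_one] at hx
    refine Submodule.mem_sup_right (Submodule.mem_sup_right
      (Submodule.subset_span ⟨y, projR x, hy, ?_, rfl⟩))
    have := projR_coe ⟨x, I.le hx⟩
    rw [this]; exact hx
  | succ b ih =>
    intro a hab y hy
    refine Submodule.mul_le.2 fun u hu v hv => ?_
    refine (I.pow_isHom a).induction (p := fun y => _ ∈ Submodule.comap
      (TensorProduct.mk ℂ A (nonunital H A) y ∘ₗ projR (H := H)) _) (fun i y hy hy' => ?_)
      (fun x y h h' => ?_) hy
    swap
    · rw [Submodule.mem_comap] at *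
      simp only [LinearMap.comp_apply, map_add, LinearMap.add_apply] at *
      exact add_mem h h'
    refine (I.pow_isHom (b + 1)).induction (fun j u hu hu' => ?_) (fun x y h h' => ?_) hu
    swap
    · rw [add_mul]; exact add_mem h h'
    refine I.isHom.induction (fun k v hv hv' => ?_) (fun x y h h' => ?_) hv
    swap
    · rw [mul_add]; exact add_mem h h'
    have hu0 : u ∈ nonunital H A := I.pow_le b hu
    have hv0 : v ∈ nonunital H A := I.le hv
    have e : (TensorProduct.mk ℂ A (nonunital H A) y ∘ₗ projR (H := H)) (u * v) =
        (y ⊗ₜ mulRightR H A ⟨v, hv0⟩ ⟨u, hu0⟩ - (y * u) ⊗ₜ (⟨v, hv0⟩ : nonunital H A) -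
          koszulSign ((i + j) * k) • (v * y) ⊗ₜ (⟨u, hu0⟩ : nonunital H A)) +
        (y * u) ⊗ₜ (⟨v, hv0⟩ : nonunital H A) +
        koszulSign ((i + j) * k) • (v * y) ⊗ₜ (⟨u, hu0⟩ : nonunital H A) := by
      have : projR (H := H) (u * v) = mulRightR H A ⟨v, hv0⟩ ⟨u, hu0⟩ :=
        projR_coe (mulRightR H A ⟨v, hv0⟩ ⟨u, hu0⟩)
      rw [LinearMap.comp_apply, this, TensorProduct.mk_apply]; abel
    rw [Submodule.mem_comap, e]
    refine add_mem (add_mem ?_ ?_) (Submodule.smul_mem _ _ ?_)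
    · exact Submodule.mem_sup_left (Submodule.mem_sup_left (comm_mem hy' hu' hv'))
    · subst hab
      exact Submodule.mem_sup_right (Submodule.mem_sup_right
        (Submodule.subset_span ⟨y * u, ⟨v, hv0⟩, I.pow_mul_pow a (b + 1) hy hu, hv, rfl⟩))
    · have h1 := ih (a + 1) (by omega) (v * y) (I.mul_mem_pow a hv hy) hu
      rw [Submodule.mem_comap, LinearMap.comp_apply] at h1
      rwa [projR_coe ⟨u, hu0⟩] at h1

theorem univDer_le (δ : H →ₐ[ℂ] ℂ) (n : ℕ) :
    I.evenRel δ n ≤ (I.oddRel δ n).comap (univDer H A) := by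
  refine sup_le (fun x hx => ?_) ?_
  · have := I.tmul_mem δ n n 0 (by omega) 1 trivial hx
    rw [Submodule.mem_comap, LinearMap.comp_apply] at this
    erw [projR_coe x] at this
    exact this
  · refine (coinv_le δ (ρ' := fun h => formAct H A h) _ fun h m => ?_).trans
      (Submodule.comap_mono (le_sup_right.trans le_sup_left))
    let r := Coalgebra.Repr.arbitrary ℂ h
    have e := congrArg (fun g => actR H A g m)
      (congrArg (TensorProduct.lid ℂ H) (Coalgebra.sum_counit_tmul_eq r))
    simp only [map_sum, TensorProduct.lid_tmul, LinearMap.sum_apply, map_smul,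
      LinearMap.smul_apply, one_smul] at e
    rw [univDer_apply, univDer_apply, formAct_tmul r, ← e, TensorProduct.tmul_sum]
    exact Finset.sum_congr rfl fun i _ => by
      rw [act_one, TensorProduct.smul_tmul]

end HDGIdeal

open CategoryTheory

/-- The cochain complex of a graded vector space with a differential of degree `1`. -/
noncomputable def gradedComplex {M : Type u} [AddCommGroup M] [Module ℂ M]
    (g : ℤ → Submodule ℂ M) (D : M →ₗ[ℂ] M) (hD : ∀ k, g k ≤ (g (k + 1)).comap D)
    (hDD : ∀ x, D (D x) = 0) : CochainComplex (ModuleCat.{u} ℂ) ℤ where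
  X k := ModuleCat.of ℂ (g k)
  d i j := if h : i + 1 = j then
      ModuleCat.ofHom (D.restrict (p := g i) (q := g j) fun _ hx => h ▸ hD i hx)
    else 0
  shape i j h := dif_neg h
  d_comp_d' i j k h h' := by
    change i + 1 = j at h
    change j + 1 = k at h'
    rw [dif_pos h, dif_pos h', ← ModuleCat.ofHom_comp]
    exact congrArg ModuleCat.ofHom (LinearMap.ext fun x => Subtype.ext (hDD (x : M)))

/-- The map of complexes given by a linear map of degree `0` that commutes with the
differentials. -/
noncomputable def gradedHom {M N : Type u} [AddCommGroup M] [Module ℂ M] [AddCommGroup N]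
    [Module ℂ N] {g : ℤ → Submodule ℂ M} {D : M →ₗ[ℂ] M}
    {hD : ∀ k, g k ≤ (g (k + 1)).comap D} {hDD : ∀ x, D (D x) = 0}
    {g' : ℤ → Submodule ℂ N} {D' : N →ₗ[ℂ] N}
    {hD' : ∀ k, g' k ≤ (g' (k + 1)).comap D'} {hDD' : ∀ x, D' (D' x) = 0}
    (f : M →ₗ[ℂ] N) (hf : ∀ k, g k ≤ (g' k).comap f) (hc : ∀ x, f (D x) = D' (f x)) :
    gradedComplex g D hD hDD ⟶ gradedComplex g' D' hD' hDD' where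
  f k := ModuleCat.ofHom (f.restrict (p := g k) (q := g' k) fun _ hx => hf k hx)
  comm' i j h := by
    change i + 1 = j at h
    simp only [gradedComplex, dif_pos h]
    rw [← ModuleCat.ofHom_comp, ← ModuleCat.ofHom_comp]
    exact congrArg ModuleCat.ofHom (LinearMap.ext fun x => Subtype.ext (hc (x : M)).symm)

theorem gradedHom_comp {M N : Type u} [AddCommGroup M] [Module ℂ M] [AddCommGroup N]
    [Module ℂ N] {g : ℤ → Submodule ℂ M} {D : M →ₗ[ℂ] M}
    {hD : ∀ k, g k ≤ (g (k + 1)).comap D} {hDD : ∀ x, D (D x) = 0}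
    {g' : ℤ → Submodule ℂ N} {D' : N →ₗ[ℂ] N}
    {hD' : ∀ k, g' k ≤ (g' (k + 1)).comap D'} {hDD' : ∀ x, D' (D' x) = 0}
    (f : M →ₗ[ℂ] N) (hf : ∀ k, g k ≤ (g' k).comap f) (hc : ∀ x, f (D x) = D' (f x))
    (f' : N →ₗ[ℂ] M) (hf' : ∀ k, g' k ≤ (g k).comap f') (hc' : ∀ x, f' (D' x) = D (f' x))
    (h : ∀ x, f' (f x) = 0) :
    (gradedHom f hf hc : gradedComplex g D hD hDD ⟶ gradedComplex g' D' hD' hDD') ≫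
      (gradedHom f' hf' hc' : gradedComplex g' D' hD' hDD' ⟶ gradedComplex g D hD hDD) = 0 := by
  refine HomologicalComplex.Hom.ext (funext fun k => ?_)
  refine (ModuleCat.ofHom_comp _ _).symm.trans ?_
  exact congrArg ModuleCat.ofHom (LinearMap.ext fun x => Subtype.ext (h (x : M)))

/-- The grading of a quotient. -/
def quotGr {M : Type u} [AddCommGroup M] [Module ℂ M] (g : ℤ → Submodule ℂ M)
    (Q : Submodule ℂ M) (k : ℤ) : Submodule ℂ (M ⧸ Q) := (g k).map Q.mkQ

theorem quotGr_le {M N : Type u} [AddCommGroup M] [Module ℂ M] [AddCommGroup N] [Module ℂ N]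
    {g : ℤ → Submodule ℂ M} {g' : ℤ → Submodule ℂ N} {Q : Submodule ℂ M} {Q' : Submodule ℂ N}
    (f : M →ₗ[ℂ] N) (hQ : Q ≤ Q'.comap f) {k l : ℤ} (hf : g k ≤ (g' l).comap f) :
    quotGr g Q k ≤ (quotGr g' Q' l).comap (Q.mapQ Q' f hQ) := by
  rintro _ ⟨x, hx, rfl⟩
  exact ⟨f x, hf hx, rfl⟩

/-- A `ℤ/2`-graded complex (super-complex) of complexes `E ⇄ O`, with `E` in even degree and `O`
in odd degree. -/
noncomputable def superComplex {C : Type*} [Category* C] [Limits.HasZeroMorphisms C] {E O : C}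
    (d : E ⟶ O) (b : O ⟶ E) (hdb : d ≫ b = 0) (hbd : b ≫ d = 0) :
    HomologicalComplex C (ComplexShape.up (ZMod 2)) where
  X := fun (i : Fin 2) => match i with
    | 0 => E
    | 1 => O
  d := fun (i j : Fin 2) => match i, j with
    | 0, 1 => d
    | 1, 0 => b
    | 0, 0 => 0
    | 1, 1 => 0
  shape := fun (i j : Fin 2) h => by
    fin_cases i <;> fin_cases j
    · rfl
    · exact absurd (by decide +revert : (0 : ZMod 2) + 1 = 1) h
    · exact absurd (by decide +revert : (1 : ZMod 2) + 1 = 0) h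
    · rfl
  d_comp_d' := fun (i j k : Fin 2) _ _ => by
    fin_cases i <;> fin_cases j <;> fin_cases k <;> simp [hdb, hbd]

/-- The two-sided `2`-periodic complex `… → E → O → E → O → …` of a super-complex, with `E` in
even degrees and `O` in odd degrees. -/
noncomputable def periodicComplex {C : Type*} [Category* C] [Limits.HasZeroMorphisms C]
    (K : HomologicalComplex C (ComplexShape.up (ZMod 2))) :
    HomologicalComplex C (ComplexShape.up ℤ) where
  X p := K.X (p : ZMod 2)
  d i j := if i + 1 = j then K.d (i : ZMod 2) (j : ZMod 2) else 0
  shape i j h := if_neg h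
  d_comp_d' i j k h h' := by
    change i + 1 = j at h
    change j + 1 = k at h'
    rw [if_pos h, if_pos h', K.d_comp_d]

namespace HDGAlgebra

variable {H A : Type u} [Ring H] [HopfAlgebra ℂ H] [Ring A] [Algebra ℂ A] [HDGAlgebra H A]

variable (H A) in
/-- The component of `R` of degree `k`. -/
def grR (k : ℤ) : Submodule ℂ (nonunital H A) := (gr H k).comap (nonunital H A).subtype

theorem bdR_gr (k : ℤ) : grR H A k ≤ (grR H A (k + 1)).comap (bdR H A) := fun _ hx =>
  bd_mem (H := H) hx

theorem univDer_gr (k : ℤ) : grR H A k ≤ (formGr H A k).comap (univDer H A) := fun x hx =>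
  Submodule.subset_span ⟨0, k, 1, x, one_mem, hx, by ring, rfl⟩

theorem formB_gr (k : ℤ) : formGr H A k ≤ (grR H A k).comap (formB H A) := by
  refine Submodule.span_le.2 ?_
  rintro _ ⟨i, j, x, z, hx, hz, rfl, rfl⟩
  change gcomm H A x (z : A) ∈ gr H (i + j)
  rw [gcomm_of_mem hx hz]
  have := mul_mem hz hx
  rw [add_comm] at this
  exact sub_mem (mul_mem hx hz) (Submodule.smul_mem _ _ this)

theorem bdR_bdR (x : nonunital H A) : bdR H A (bdR H A x) = 0 := by ext; simp [bd_bd]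

theorem univDer_bdR (x : nonunital H A) : univDer H A (bdR H A x) = formBd H A (univDer H A x) := by
  simp [bd_one, sgn_of_mem (one_mem (H := H)), koszulSign_zero]

theorem formB_univDer (x : nonunital H A) : formB H A (univDer H A x) = 0 := by
  refine homR_induction (p := fun x => formB H A (univDer H A x) = 0) (fun k x hx => ?_)
    (fun x y hx hy => ?_) x
  · ext
    rw [univDer_apply, coe_formB_tmul, gcomm_of_mem one_mem hx]
    simp [koszulSign_zero]
  · rw [map_add, map_add, hx, hy, add_zero]

theorem formB_formBd (ω : Omega1 H A) : formB H A (formBd H A ω) = bdR H A (formB H A ω) := by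
  refine form_induction (fun i j x z hx hz => ?_) (fun x y hx hy => ?_) ω
  swap
  · simp [hx, hy]
  ext
  have hbz : (bdR H A z : A) ∈ gr H (j + 1) := bd_mem (H := H) hz
  rw [coe_bdR, formBd_tmul, map_add, Submodule.coe_add, coe_formB_tmul, coe_formB_tmul,
    coe_formB_tmul, sgn_of_mem hx, gcomm_of_mem (bd_mem hx) hz, map_smul, LinearMap.smul_apply,
    gcomm_of_mem hx hbz, gcomm_of_mem hx hz, map_sub, map_smul, bd_mul hx, bd_mul hz, coe_bdR]
  simp only [add_mul, mul_add, one_mul, mul_one, koszulSign_add]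
  rcases koszulSign_cases (i * j) with h | h <;> rcases koszulSign_cases i with h' | h' <;>
  rcases koszulSign_cases j with h'' | h'' <;>
  simp only [h, h', h''] <;> module

theorem univDer_formB (ω : Omega1 H A) : univDer H A (formB H A ω) ∈ formComm H A := by
  refine form_induction (p := fun ω => univDer H A (formB H A ω) ∈ formComm H A)
    (fun i j x z hx hz => ?_) (fun x y hx hy => ?_) ω
  swap
  · rw [map_add, map_add]; exact add_mem hx hy
  have h1 := comm_mem (x := (1 : A)) one_mem (projR_mem hx) hz
  have h2 := comm_mem (x := (1 : A)) one_mem hz (projR_mem hx)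
  have e : formB H A (x ⊗ₜ z) = mulRightR H A z (projR x) - koszulSign (i * j) •
      mulRightR H A (projR x) z := by
    ext
    rw [coe_formB_tmul, gcomm_of_mem hx hz]
    simp only [Submodule.coe_sub, Submodule.coe_smul, coe_mulRightR, coe_projR, sub_mul, mul_sub,
      smul_mul_assoc, mul_smul_comm, one_mul, mul_one]
    rcases eq_or_ne i 0 with rfl | hi
    · simp [koszulSign_zero]
    · simp [aug_of_mem hx hi]
  rw [univDer_apply, e]
  convert sub_mem h1 (Submodule.smul_mem _ (koszulSign (i * j)) h2) using 1
  simp only [zero_add, one_mul, mul_one, TensorProduct.tmul_sub, TensorProduct.tmul_smul,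
    mul_comm j i]
  rcases koszulSign_cases (i * j) with h | h <;> simp only [h] <;> module

end HDGAlgebra

namespace HDGIdeal

variable {H A : Type u} [Ring H] [HopfAlgebra ℂ H] [Ring A] [Algebra ℂ A] [HDGAlgebra H A]

/-- The even part `R / (I^{n+1} + coinv)`. -/
noncomputable def xEven (I : HDGIdeal H A) (δ : H →ₐ[ℂ] ℂ) (n : ℕ) :
    CochainComplex (ModuleCat.{u} ℂ) ℤ :=
  gradedComplex (quotGr (grR H A) (I.evenRel δ n))
    ((I.evenRel δ n).mapQ _ (bdR H A) (I.evenRel_bd δ n))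
    (fun k => quotGr_le _ _ (bdR_gr k)) fun x => by
      obtain ⟨x, rfl⟩ := Submodule.mkQ_surjective _ x
      simp [bdR_bdR]

/-- The odd part `Ω¹(R)_{♮,δ} / ♮(I^{n+1} dR + I^n dI)`. -/
noncomputable def xOdd (I : HDGIdeal H A) (δ : H →ₐ[ℂ] ℂ) (n : ℕ) :
    CochainComplex (ModuleCat.{u} ℂ) ℤ :=
  gradedComplex (quotGr (formGr H A) (I.oddRel δ n))
    ((I.oddRel δ n).mapQ _ (formBd H A) (I.oddRel_bd δ n))
    (fun k => quotGr_le _ _ fun _ hx => formBd_mem hx) fun x => by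
      obtain ⟨x, rfl⟩ := Submodule.mkQ_surjective _ x
      simp [formBd_formBd]

/-- The localized relative `X`-complex `X_δ^{2n+1}(R, I)`, a super-complex of complexes with even
part `R / (I^{n+1} + coinv)`, odd part `Ω¹(R)_{♮,δ} / ♮(I^{n+1} dR + I^n dI)`, and boundaries `d`
(even to odd) and `b` (odd to even). -/
noncomputable def xComplex (I : HDGIdeal H A) (δ : H →ₐ[ℂ] ℂ)
    (hδ : twistedAntipode δ ∘ₗ twistedAntipode δ = LinearMap.id) (n : ℕ) :
    HomologicalComplex₂ (ModuleCat.{u} ℂ) (ComplexShape.up (ZMod 2)) (ComplexShape.up ℤ) :=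
  superComplex (E := I.xEven δ n) (O := I.xOdd δ n)
    (gradedHom ((I.evenRel δ n).mapQ _ (univDer H A) (I.univDer_le δ n))
      (fun k => quotGr_le _ _ (univDer_gr k)) fun x => by
        obtain ⟨x, rfl⟩ := Submodule.mkQ_surjective _ x
        exact congrArg (Submodule.mkQ _) (univDer_bdR x))
    (gradedHom ((I.oddRel δ n).mapQ _ (formB H A) (I.formB_le δ hδ n))
      (fun k => quotGr_le _ _ (formB_gr k)) fun x => by
        obtain ⟨x, rfl⟩ := Submodule.mkQ_surjective _ x
        exact congrArg (Submodule.mkQ _) (formB_formBd x))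
    (gradedHom_comp _ _ _ _ _ _ fun x => by
      obtain ⟨x, rfl⟩ := Submodule.mkQ_surjective _ x
      exact congrArg (Submodule.mkQ _) (formB_univDer x))
    (gradedHom_comp _ _ _ _ _ _ fun x => by
      obtain ⟨x, rfl⟩ := Submodule.mkQ_surjective _ x
      exact (Submodule.Quotient.mk_eq_zero _).2
        (Submodule.mem_sup_left (Submodule.mem_sup_left (univDer_formB x))))

end HDGIdeal

/-- The unital algebra `W̃(H)` underlying the Weil complex: the free unital algebra generated by
the symbols `i(h)` and `ω_h`, linear in `h ∈ H`. -/
abbrev WeilTilde (H : Type u) [Ring H] [HopfAlgebra ℂ H] : Type u := TensorAlgebra ℂ (H × H)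

namespace Weil

/-- The degree of a monomial, where `i(h)` has degree `1` and `ω_h` has degree `2`. -/
def weight {H : Type u} (w : List (H ⊕ H)) : ℤ := (w.map (Sum.elim (fun _ => 1) (fun _ => 2))).sum

@[simp] theorem weight_nil {H : Type u} : weight ([] : List (H ⊕ H)) = 0 := rfl

@[simp] theorem weight_inl {H : Type u} (h : H) (w : List (H ⊕ H)) :
    weight (Sum.inl h :: w) = 1 + weight w := by
  simp [weight]

@[simp] theorem weight_inr {H : Type u} (h : H) (w : List (H ⊕ H)) :
    weight (Sum.inr h :: w) = 2 + weight w := by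
  simp [weight]

theorem weight_append {H : Type u} (w w' : List (H ⊕ H)) : weight (w ++ w') = weight w + weight w' := by
  simp [weight]

variable {H : Type u} [Ring H] [HopfAlgebra ℂ H]

/-- The generator `i(h)`, of degree `1`. -/
noncomputable def gen : H →ₗ[ℂ] WeilTilde H := TensorAlgebra.ι ℂ ∘ₗ LinearMap.inl ℂ H H

/-- The generator `ω_h`, of degree `2`. -/
noncomputable def curv : H →ₗ[ℂ] WeilTilde H := TensorAlgebra.ι ℂ ∘ₗ LinearMap.inr ℂ H H

theorem ι_eq (v : H × H) : TensorAlgebra.ι ℂ v = gen v.1 + curv v.2 := by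
  simp [gen, curv, ← map_add]

/-- The generator attached to a letter: `i(h)` or `ω_h`. -/
noncomputable def letter : H ⊕ H → WeilTilde H := Sum.elim gen curv

/-- The monomial `a₁ a₂ ⋯ aₚ`. -/
noncomputable def word (w : List (H ⊕ H)) : WeilTilde H := (w.map letter).prod

@[simp] theorem word_nil : word ([] : List (H ⊕ H)) = 1 := rfl

@[simp] theorem word_inl (h : H) (w : List (H ⊕ H)) : word (Sum.inl h :: w) = gen h * word w := by
  simp [word, letter]

@[simp] theorem word_inr (h : H) (w : List (H ⊕ H)) :
    word (Sum.inr h :: w) = curv h * word w := by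
  simp [word, letter]

theorem word_append (w w' : List (H ⊕ H)) : word (w ++ w') = word w * word w' := by
  simp [word]

@[elab_as_elim]
theorem word_induction {p : WeilTilde H → Prop} (hw : ∀ w, p (word w))
    (add : ∀ x y, p x → p y → p (x + y)) (smul : ∀ (c : ℂ) x, p x → p (c • x))
    (x : WeilTilde H) : p x := by
  have key : x ∈ Submodule.span ℂ (Set.range (word (H := H))) := by
    induction x using TensorAlgebra.induction with
    | algebraMap r =>
      rw [Algebra.algebraMap_eq_smul_one]
      exact Submodule.smul_mem _ _ (Submodule.subset_span ⟨[], rfl⟩)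
    | ι v =>
      rw [ι_eq]
      exact add_mem (Submodule.subset_span ⟨[Sum.inl v.1], by simp⟩)
        (Submodule.subset_span ⟨[Sum.inr v.2], by simp⟩)
    | mul a b ha hb =>
      have := Submodule.mul_mem_mul ha hb
      rw [Submodule.span_mul_span] at this
      refine Submodule.span_mono ?_ this
      rintro _ ⟨_, ⟨w, rfl⟩, _, ⟨w', rfl⟩, rfl⟩
      exact ⟨w ++ w', word_append w w'⟩
    | add a b ha hb => exact add_mem ha hb
  induction key using Submodule.span_induction with
  | mem x h => obtain ⟨w, rfl⟩ := h; exact hw w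
  | zero => simpa using smul 0 _ (hw [])
  | add x y _ _ hx hy => exact add x y hx hy
  | smul c x _ hx => exact smul c x hx

/-- Two linear maps that agree on monomials are equal. -/
theorem lin_ext {M : Type*} [AddCommGroup M] [Module ℂ M] {f g : WeilTilde H →ₗ[ℂ] M}
    (h : ∀ w, f (word w) = g (word w)) : f = g := by
  ext x
  refine word_induction (p := fun x => f x = g x) h (fun x y hx hy => ?_) (fun c x hx => ?_) x
  · rw [map_add, map_add, hx, hy]
  · rw [map_smul, map_smul, hx]

/-- The component of degree `k` of `W̃(H)`. -/
def wGr (k : ℤ) : Submodule ℂ (WeilTilde H) :=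
  Submodule.span ℂ {x | ∃ w, weight w = k ∧ x = word w}

theorem word_mem (w : List (H ⊕ H)) : word w ∈ wGr (weight w) := Submodule.subset_span ⟨w, rfl, rfl⟩

theorem gen_mem (h : H) : gen h ∈ wGr (H := H) 1 :=
  Submodule.subset_span ⟨[Sum.inl h], by simp, by simp⟩

theorem curv_mem (h : H) : curv h ∈ wGr (H := H) 2 :=
  Submodule.subset_span ⟨[Sum.inr h], by simp, by simp⟩

theorem wGr_mul {i j : ℤ} {x y : WeilTilde H} (hx : x ∈ wGr i) (hy : y ∈ wGr j) :
    x * y ∈ wGr (i + j) := by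
  have := Submodule.mul_mem_mul hx hy
  rw [wGr, wGr, Submodule.span_mul_span] at this
  refine Submodule.span_mono ?_ this
  rintro _ ⟨_, ⟨w, rfl, rfl⟩, _, ⟨w', rfl, rfl⟩, rfl⟩
  exact ⟨w ++ w', weight_append w w', (word_append w w').symm⟩

instance wGr_gradedMonoid : SetLike.GradedMonoid (wGr (H := H)) where
  one_mem := word_mem []
  mul_mem _ _ _ _ hx hy := wGr_mul hx hy

open DirectSum in
/-- The projection onto the homogeneous components. -/
noncomputable def decomp : WeilTilde H →ₐ[ℂ] ⨁ k, wGr (H := H) k :=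
  TensorAlgebra.lift ℂ
    (DirectSum.lof ℂ ℤ (fun k => wGr (H := H) k) 1 ∘ₗ
        (gen.codRestrict (wGr 1) gen_mem) ∘ₗ LinearMap.fst ℂ H H +
      DirectSum.lof ℂ ℤ (fun k => wGr (H := H) k) 2 ∘ₗ
        (curv.codRestrict (wGr 2) curv_mem) ∘ₗ LinearMap.snd ℂ H H)

theorem decomp_gen (h : H) : decomp (gen h) =
    DirectSum.of (fun k => wGr (H := H) k) 1 ⟨gen h, gen_mem h⟩ := by
  refine (TensorAlgebra.lift_ι_apply _ ((h, 0) : H × H)).trans ?_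
  change DirectSum.lof ℂ ℤ (fun k => wGr (H := H) k) 1 ⟨gen h, gen_mem h⟩ +
    DirectSum.lof ℂ ℤ (fun k => wGr (H := H) k) 2 ((curv.codRestrict (wGr 2) curv_mem) 0) = _
  rw [map_zero, map_zero, add_zero, DirectSum.lof_eq_of]

theorem decomp_curv (h : H) : decomp (curv h) =
    DirectSum.of (fun k => wGr (H := H) k) 2 ⟨curv h, curv_mem h⟩ := by
  refine (TensorAlgebra.lift_ι_apply _ ((0, h) : H × H)).trans ?_
  change DirectSum.lof ℂ ℤ (fun k => wGr (H := H) k) 1 ((gen.codRestrict (wGr 1) gen_mem) 0) +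
    DirectSum.lof ℂ ℤ (fun k => wGr (H := H) k) 2 ⟨curv h, curv_mem h⟩ = _
  rw [map_zero, map_zero, zero_add, DirectSum.lof_eq_of]

theorem decomp_word (w : List (H ⊕ H)) : decomp (word w) =
    DirectSum.of (fun k => wGr (H := H) k) (weight w) ⟨word w, word_mem w⟩ := by
  induction w with
  | nil => exact map_one decomp
  | cons a w ih =>
    rcases a with h | h
    · refine (congrArg decomp (word_inl h w)).trans ?_
      rw [map_mul, ih, decomp_gen, DirectSum.of_mul_of]
      exact DirectSum.of_eq_of_gradedMonoid_eq (Sigma.subtype_ext (weight_inl h w).symm (word_inl h w).symm)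
    · refine (congrArg decomp (word_inr h w)).trans ?_
      rw [map_mul, ih, decomp_curv, DirectSum.of_mul_of]
      exact DirectSum.of_eq_of_gradedMonoid_eq (Sigma.subtype_ext (weight_inr h w).symm (word_inr h w).symm)

noncomputable instance wGr_gradedAlgebra : GradedAlgebra (wGr (H := H)) :=
  GradedAlgebra.ofAlgHom _ decomp
    (by
      refine TensorAlgebra.hom_ext (LinearMap.ext fun v => ?_)
      simp only [LinearMap.comp_apply, AlgHom.toLinearMap_apply, AlgHom.comp_apply, AlgHom.id_apply]
      rw [ι_eq, map_add, map_add, decomp_gen, decomp_curv, DirectSum.coeAlgHom_of,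
        DirectSum.coeAlgHom_of])
    fun k x => by
      obtain ⟨x, hx⟩ := x
      induction hx using Submodule.span_induction with
      | mem x h => obtain ⟨w, rfl, rfl⟩ := h; exact decomp_word w
      | zero => rw [map_zero]; exact (map_zero _).symm
      | add x y hx hy ihx ihy => rw [map_add, ihx, ihy, ← map_add]; rfl
      | smul c x hx ih =>
        rw [map_smul, ih, ← DirectSum.lof_eq_of ℂ, ← DirectSum.lof_eq_of ℂ, ← map_smul]; rfl

theorem wGr_isInternal : DirectSum.IsInternal (wGr (H := H)) :=
  DirectSum.Decomposition.isInternal _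

/-- The sign automorphism `x ↦ (-1)^{|x|} x`. -/
noncomputable def sign : WeilTilde H →ₐ[ℂ] WeilTilde H :=
  TensorAlgebra.lift ℂ (-gen ∘ₗ LinearMap.fst ℂ H H + curv ∘ₗ LinearMap.snd ℂ H H)

@[simp] theorem sign_gen (h : H) : sign (gen h) = -gen h := by
  simp [sign, gen]

@[simp] theorem sign_curv (h : H) : sign (curv h) = curv h := by
  simp [sign, curv]

theorem sign_word (w : List (H ⊕ H)) : sign (word w) = koszulSign (weight w) • word w := by
  induction w with
  | nil => simp [koszulSign_zero]
  | cons a w ih =>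
    rcases a with h | h
    · simp [ih, koszulSign_add, koszulSign_one]
    · have : koszulSign 2 = 1 := by simp [koszulSign]
      simp [ih, koszulSign_add, this]

theorem sign_of_mem {k : ℤ} {x : WeilTilde H} (hx : x ∈ wGr k) :
    sign x = koszulSign k • x := by
  induction hx using Submodule.span_induction with
  | mem x h => obtain ⟨w, rfl, rfl⟩ := h; exact sign_word w
  | zero => simp
  | add x y _ _ hx hy => rw [map_add, hx, hy, smul_add]
  | smul c x _ hx => rw [map_smul, hx, smul_comm]

@[simp] theorem sign_sign (x : WeilTilde H) : sign (sign x) = x := by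
  have : (sign (H := H)).comp sign = AlgHom.id ℂ _ :=
    TensorAlgebra.hom_ext (LinearMap.ext fun v => by simp [ι_eq])
  exact DFunLike.congr_fun this x

/-- The algebra homomorphism into `2 × 2` matrices that encodes an odd derivation. -/
noncomputable def oddDerMat (f : H × H →ₗ[ℂ] WeilTilde H) :
    WeilTilde H →ₐ[ℂ] Matrix (Fin 2) (Fin 2) (WeilTilde H) :=
  TensorAlgebra.lift ℂ
    { toFun := fun v => !![sign (TensorAlgebra.ι ℂ v), f v; 0, TensorAlgebra.ι ℂ v]
      map_add' := fun v w => by ext i j; fin_cases i <;> fin_cases j <;> simp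
      map_smul' := fun c v => by ext i j; fin_cases i <;> fin_cases j <;> simp }

/-- The odd derivation with prescribed values on the generators: the unique linear map `D` with
`D v = f v` on generators and `D (x y) = D(x) y + (-1)^{|x|} x D(y)`. -/
noncomputable def oddDer (f : H × H →ₗ[ℂ] WeilTilde H) : WeilTilde H →ₗ[ℂ] WeilTilde H where
  toFun x := oddDerMat f x 0 1
  map_add' x y := by simp
  map_smul' c x := by simp

theorem oddDerMat_eq (f : H × H →ₗ[ℂ] WeilTilde H) (x : WeilTilde H) :
    oddDerMat f x = !![sign x, oddDer f x; 0, x] := by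
  have h : oddDerMat f x 0 0 = sign x ∧ oddDerMat f x 1 0 = 0 ∧ oddDerMat f x 1 1 = x := by
    induction x using TensorAlgebra.induction with
    | algebraMap r =>
      rw [AlgHom.commutes]
      simp [Matrix.algebraMap_matrix_apply]
    | ι v => simp [oddDerMat]
    | mul a b ha hb =>
      simp [Matrix.mul_apply, ha.1, ha.2.1, ha.2.2, hb.1, hb.2.1, hb.2.2]
    | add a b ha hb =>
      simp [ha.1, ha.2.1, ha.2.2, hb.1, hb.2.1, hb.2.2]
  ext i j
  fin_cases i <;> fin_cases j
  · exact h.1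
  · rfl
  · exact h.2.1
  · exact h.2.2

theorem oddDer_mul (f : H × H →ₗ[ℂ] WeilTilde H) (x y : WeilTilde H) :
    oddDer f (x * y) = oddDer f x * y + sign x * oddDer f y := by
  have : oddDerMat f (x * y) 0 1 = _ := congrFun (congrFun (map_mul (oddDerMat f) x y) 0) 1
  rw [oddDerMat_eq, oddDerMat_eq, oddDerMat_eq] at this
  simp [Matrix.mul_apply] at this
  rw [this, add_comm]

theorem oddDer_ι (f : H × H →ₗ[ℂ] WeilTilde H) (v : H × H) :
    oddDer f (TensorAlgebra.ι ℂ v) = f v := by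
  simp [oddDer, oddDerMat]

theorem oddDer_gen (f : H × H →ₗ[ℂ] WeilTilde H) (h : H) : oddDer f (gen h) = f (h, 0) :=
  oddDer_ι f _

theorem oddDer_curv (f : H × H →ₗ[ℂ] WeilTilde H) (h : H) : oddDer f (curv h) = f (0, h) :=
  oddDer_ι f _

theorem oddDer_one (f : H × H →ₗ[ℂ] WeilTilde H) : oddDer f 1 = 0 := by
  simp [oddDer]

/-- An additive map that vanishes on generators and satisfies the Leibniz rule is zero. -/
theorem der_ext {D : WeilTilde H →ₗ[ℂ] WeilTilde H} (r s : WeilTilde H → WeilTilde H)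
    (hmul : ∀ x y, D (x * y) = D x * r y + s x * D y) (hone : D 1 = 0)
    (hg : ∀ h, D (gen h) = 0) (hc : ∀ h, D (curv h) = 0) (x : WeilTilde H) : D x = 0 := by
  have : D = 0 := lin_ext fun w => by
    induction w with
    | nil => simpa using hone
    | cons a w ih =>
      rcases a with h | h
      · rw [word_inl, hmul, ih, hg]; simp
      · rw [word_inr, hmul, ih, hc]; simp
  rw [this]; rfl

end Weil

namespace Weil

variable {H : Type u} [Ring H] [HopfAlgebra ℂ H]

/-- `conv f g (h) = ∑ f(h₀) g(h₁)`. -/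
noncomputable def conv (f g : H →ₗ[ℂ] WeilTilde H) : H →ₗ[ℂ] WeilTilde H :=
  LinearMap.mul' ℂ (WeilTilde H) ∘ₗ TensorProduct.map f g ∘ₗ Coalgebra.comul

theorem conv_repr {ι : Type*} {h : H} (r : Coalgebra.Repr ℂ h ι) (f g : H →ₗ[ℂ] WeilTilde H) :
    conv f g h = ∑ i ∈ r.index, f (r.left i) * g (r.right i) := by
  simp [conv, ← r.eq]

theorem conv_assoc (f g k : H →ₗ[ℂ] WeilTilde H) : conv (conv f g) k = conv f (conv g k) :=
  congrArg WithConv.ofConv (mul_assoc (WithConv.toConv f) (WithConv.toConv g) (WithConv.toConv k))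

open Coalgebra in
theorem conv_add_left (f g k : H →ₗ[ℂ] WeilTilde H) : conv (f + g) k = conv f k + conv g k := by
  ext h; simp [conv_repr (ℛ ℂ h), add_mul, Finset.sum_add_distrib]

open Coalgebra in
theorem conv_sub_left (f g k : H →ₗ[ℂ] WeilTilde H) : conv (f - g) k = conv f k - conv g k := by
  ext h; simp [conv_repr (ℛ ℂ h), sub_mul, Finset.sum_sub_distrib]

open Coalgebra in
theorem conv_sub_right (f g k : H →ₗ[ℂ] WeilTilde H) : conv f (g - k) = conv f g - conv f k := by
  ext h; simp [conv_repr (ℛ ℂ h), mul_sub, Finset.sum_sub_distrib]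

open Coalgebra in
theorem conv_neg_left (f k : H →ₗ[ℂ] WeilTilde H) : conv (-f) k = -conv f k := by
  ext h; simp [conv_repr (ℛ ℂ h)]

open Coalgebra in
theorem conv_neg_right (f k : H →ₗ[ℂ] WeilTilde H) : conv f (-k) = -conv f k := by
  ext h; simp [conv_repr (ℛ ℂ h)]

/-- The values of `∂₀` on the generators: `∂₀ i(h) = - ∑ i(h₀) i(h₁)` and
`∂₀ ω_h = ∑ ω_{h₀} i(h₁) - ∑ i(h₀) ω_{h₁}`. -/
noncomputable def bd0Gen : H × H →ₗ[ℂ] WeilTilde H :=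
  -conv gen gen ∘ₗ LinearMap.fst ℂ H H + (conv curv gen - conv gen curv) ∘ₗ LinearMap.snd ℂ H H

/-- The values of `d` on the generators: `d i(h) = ω_h` and `d ω_h = 0`. -/
noncomputable def dGen : H × H →ₗ[ℂ] WeilTilde H := curv ∘ₗ LinearMap.fst ℂ H H

/-- The odd derivation `∂₀`. -/
noncomputable def bd0 : WeilTilde H →ₗ[ℂ] WeilTilde H := oddDer bd0Gen

/-- The odd derivation `d`. -/
noncomputable def dd : WeilTilde H →ₗ[ℂ] WeilTilde H := oddDer dGen

/-- The boundary `∂ = ∂₀ + d` of the Weil complex. -/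
noncomputable def wBd : WeilTilde H →ₗ[ℂ] WeilTilde H := bd0 + dd

theorem bd0_mul (x y : WeilTilde H) : bd0 (x * y) = bd0 x * y + sign x * bd0 y := oddDer_mul _ x y

theorem dd_mul (x y : WeilTilde H) : dd (x * y) = dd x * y + sign x * dd y := oddDer_mul _ x y

theorem wBd_mul (x y : WeilTilde H) : wBd (x * y) = wBd x * y + sign x * wBd y := by
  simp only [wBd, LinearMap.add_apply, bd0_mul, dd_mul, add_mul, mul_add]; abel

@[simp] theorem bd0_one : bd0 (1 : WeilTilde H) = 0 := oddDer_one _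

@[simp] theorem dd_one : dd (1 : WeilTilde H) = 0 := oddDer_one _

@[simp] theorem wBd_one : wBd (1 : WeilTilde H) = 0 := by simp [wBd]

@[simp] theorem bd0_gen (h : H) : bd0 (gen h) = -conv gen gen h := by simp [bd0, oddDer_gen, bd0Gen]

@[simp] theorem bd0_curv (h : H) : bd0 (curv h) = conv curv gen h - conv gen curv h := by
  simp [bd0, oddDer_curv, bd0Gen]

@[simp] theorem dd_gen (h : H) : dd (gen h) = curv h := by simp [dd, oddDer_gen, dGen]

@[simp] theorem dd_curv (h : H) : dd (curv h) = 0 := by simp [dd, oddDer_curv, dGen]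

open Coalgebra in
theorem sign_conv (f g : H →ₗ[ℂ] WeilTilde H) (h : H) :
    sign (conv f g h) = conv (sign.toLinearMap ∘ₗ f) (sign.toLinearMap ∘ₗ g) h := by
  simp [conv_repr (ℛ ℂ h)]

theorem sign_comp_gen : (sign (H := H)).toLinearMap ∘ₗ gen = -gen := by ext h; simp

theorem sign_comp_curv : (sign (H := H)).toLinearMap ∘ₗ curv = curv := by ext h; simp

open Coalgebra in
theorem bd0_conv (f g : H →ₗ[ℂ] WeilTilde H) (h : H) :
    bd0 (conv f g h) = conv (bd0 ∘ₗ f) g h + conv (sign.toLinearMap ∘ₗ f) (bd0 ∘ₗ g) h := by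
  simp [conv_repr (ℛ ℂ h), bd0_mul, Finset.sum_add_distrib]

open Coalgebra in
theorem dd_conv (f g : H →ₗ[ℂ] WeilTilde H) (h : H) :
    dd (conv f g h) = conv (dd ∘ₗ f) g h + conv (sign.toLinearMap ∘ₗ f) (dd ∘ₗ g) h := by
  simp [conv_repr (ℛ ℂ h), dd_mul, Finset.sum_add_distrib]

theorem bd0_comp_gen : bd0 (H := H) ∘ₗ gen = -conv gen gen := by ext h; simp

theorem bd0_comp_curv : bd0 (H := H) ∘ₗ curv = conv curv gen - conv gen curv := by ext h; simp

theorem dd_comp_gen : dd (H := H) ∘ₗ gen = curv := by ext h; simp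

theorem dd_comp_curv : dd (H := H) ∘ₗ curv = 0 := by ext h; simp

theorem conv_zero_left (f : H →ₗ[ℂ] WeilTilde H) : conv 0 f = 0 := by
  have := conv_sub_left 0 0 f; simpa using this

theorem conv_zero_right (f : H →ₗ[ℂ] WeilTilde H) : conv f 0 = 0 := by
  have := conv_sub_right f 0 0; simpa using this

theorem sign_bd0 (x : WeilTilde H) : sign (bd0 x) = -bd0 (sign x) := by
  have := der_ext (D := sign.toLinearMap ∘ₗ bd0 + bd0 ∘ₗ sign.toLinearMap) sign (fun x => x)
    (fun x y => ?_) ?_ (fun h => ?_) (fun h => ?_) x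
  · exact eq_neg_of_add_eq_zero_left this
  · simp [bd0_mul, add_mul, mul_add]; abel
  · simp
  · simp [sign_conv, sign_comp_gen, conv_neg_left, conv_neg_right]
  · simp [sign_conv, sign_comp_gen, sign_comp_curv, conv_neg_left, conv_neg_right]

theorem sign_dd (x : WeilTilde H) : sign (dd x) = -dd (sign x) := by
  have := der_ext (D := sign.toLinearMap ∘ₗ dd + dd ∘ₗ sign.toLinearMap) sign (fun x => x)
    (fun x y => ?_) ?_ (fun h => ?_) (fun h => ?_) x
  · exact eq_neg_of_add_eq_zero_left this
  · simp [dd_mul, add_mul, mul_add]; abel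
  · simp
  · simp
  · simp

theorem bd0_bd0 (x : WeilTilde H) : bd0 (bd0 x) = 0 := by
  refine der_ext (D := bd0 ∘ₗ bd0) (fun x => x) (fun x => x) (fun x y => ?_) ?_ (fun h => ?_) (fun h => ?_) x
  · simp [bd0_mul, sign_bd0]
  · simp
  · simp [bd0_conv, bd0_comp_gen, sign_comp_gen, conv_neg_left, conv_neg_right, conv_assoc]
  · simp only [LinearMap.comp_apply, bd0_curv, map_sub, bd0_conv, bd0_comp_gen, bd0_comp_curv,
      sign_comp_gen, sign_comp_curv, conv_neg_left, conv_neg_right, conv_sub_left, conv_sub_right,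
      conv_assoc, LinearMap.neg_apply, LinearMap.sub_apply]
    abel

theorem dd_dd (x : WeilTilde H) : dd (dd x) = 0 := by
  refine der_ext (D := dd ∘ₗ dd) (fun x => x) (fun x => x) (fun x y => ?_) ?_ (fun h => ?_) (fun h => ?_) x
  · simp [dd_mul, sign_dd]
  · simp
  · simp
  · simp

theorem bd0_dd (x : WeilTilde H) : bd0 (dd x) + dd (bd0 x) = 0 := by
  refine der_ext (D := bd0 ∘ₗ dd + dd ∘ₗ bd0) (fun x => x) (fun x => x) (fun x y => ?_) ?_ (fun h => ?_)
    (fun h => ?_) x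
  · simp [bd0_mul, dd_mul, sign_bd0, sign_dd, add_mul, mul_add]; abel
  · simp
  · simp only [LinearMap.comp_apply, LinearMap.add_apply, dd_gen, bd0_curv, bd0_gen, map_neg,
      dd_conv, dd_comp_gen, sign_comp_gen, conv_neg_left, LinearMap.neg_apply]
    abel
  · simp only [LinearMap.comp_apply, LinearMap.add_apply, dd_curv, bd0_curv, map_sub, map_zero,
      dd_conv, dd_comp_gen, dd_comp_curv, sign_comp_gen, sign_comp_curv, conv_zero_left,
      conv_zero_right, LinearMap.zero_apply]
    abel

theorem wBd_wBd (x : WeilTilde H) : wBd (wBd x) = 0 := by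
  simp only [wBd, LinearMap.add_apply, map_add, bd0_bd0, dd_dd, zero_add, add_zero]
  rw [add_comm]; exact bd0_dd x

open Coalgebra in
theorem conv_mem {f g : H →ₗ[ℂ] WeilTilde H} {i j : ℤ} (hf : ∀ h, f h ∈ wGr i)
    (hg : ∀ h, g h ∈ wGr j) (h : H) : conv f g h ∈ wGr (i + j) := by
  rw [conv_repr (ℛ ℂ h)]
  exact sum_mem fun _ _ => wGr_mul (hf _) (hg _)

/-- A derivation of odd degree one on generators raises the degree by one. -/
theorem der_mem {D : WeilTilde H →ₗ[ℂ] WeilTilde H}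
    (hmul : ∀ x y, D (x * y) = D x * y + sign x * D y) (hone : D 1 = 0)
    (hg : ∀ h, D (gen h) ∈ wGr (H := H) 2) (hc : ∀ h, D (curv h) ∈ wGr (H := H) 3) {k : ℤ}
    {x : WeilTilde H} (hx : x ∈ wGr k) : D x ∈ wGr (k + 1) := by
  induction hx using Submodule.span_induction with
  | mem x h =>
    obtain ⟨w, rfl, rfl⟩ := h
    induction w with
    | nil => simp [hone]
    | cons a w ih =>
      rcases a with h | h
      · rw [word_inl, hmul, weight_inl, sign_gen]
        refine add_mem ?_ ?_
        · convert wGr_mul (hg h) (word_mem w) using 1; ring_nf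
        · convert wGr_mul (neg_mem (gen_mem h)) ih using 1; ring_nf
      · rw [word_inr, hmul, weight_inr, sign_curv]
        refine add_mem ?_ ?_
        · convert wGr_mul (hc h) (word_mem w) using 1; ring_nf
        · convert wGr_mul (curv_mem h) ih using 1; ring_nf
  | zero => simp
  | add x y _ _ hx hy => rw [map_add]; exact add_mem hx hy
  | smul c x _ hx => rw [map_smul]; exact Submodule.smul_mem _ _ hx

theorem wBd_mem {k : ℤ} {x : WeilTilde H} (hx : x ∈ wGr k) : wBd x ∈ wGr (k + 1) := by
  refine der_mem wBd_mul wBd_one (fun h => ?_) (fun h => ?_) hx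
  · simp only [wBd, LinearMap.add_apply, bd0_gen, dd_gen]
    exact add_mem (neg_mem (conv_mem gen_mem gen_mem h)) (curv_mem h)
  · simp only [wBd, LinearMap.add_apply, bd0_curv, dd_curv, add_zero]
    exact sub_mem (conv_mem curv_mem gen_mem h) (conv_mem gen_mem curv_mem h)

/-- The coaction-like algebra map `x ↦ (h ↦ h(x))` into the convolution algebra. -/
noncomputable def actConv : WeilTilde H →ₐ[ℂ] WithConv (H →ₗ[ℂ] WeilTilde H) :=
  TensorAlgebra.lift ℂ
    { toFun := fun v => WithConv.toConv
        (gen ∘ₗ (LinearMap.mul ℂ H).flip v.1 + curv ∘ₗ (LinearMap.mul ℂ H).flip v.2)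
      map_add' := fun v w => by ext h; simp; abel
      map_smul' := fun c v => by ext h; simp }

/-- The action of `h ∈ H` on `W̃(H)`, determined by `g i(h) = i(g h)`, `g ω_h = ω_{g h}`,
`g(1) = ε(g)` and `g (x y) = ∑ g₀(x) g₁(y)`. -/
noncomputable def actLin : H →ₗ[ℂ] WeilTilde H →ₗ[ℂ] WeilTilde H :=
  LinearMap.flip
    { toFun := fun x => (actConv x).ofConv
      map_add' := fun x y => by simp
      map_smul' := fun c x => by simp }

theorem actLin_one (h : H) : actLin h (1 : WeilTilde H) = Coalgebra.counit (R := ℂ) h • 1 := by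
  simp [actLin, Algebra.algebraMap_eq_smul_one]

theorem actLin_mul (h : H) (x y : WeilTilde H) : actLin h (x * y) = LinearMap.mul' ℂ (WeilTilde H)
    (TensorProduct.map (actLin.flip x) (actLin.flip y) (Coalgebra.comul h)) := by
  simp [actLin]

theorem actLin_mul_repr {ι : Type*} {h : H} (r : Coalgebra.Repr ℂ h ι) (x y : WeilTilde H) :
    actLin h (x * y) = ∑ i ∈ r.index, actLin (r.left i) x * actLin (r.right i) y := by
  rw [actLin_mul, ← r.eq]; simp

@[simp] theorem actLin_gen (g h : H) : actLin g (gen h) = gen (g * h) := by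
  simp [actLin, actConv, gen]

@[simp] theorem actLin_curv (g h : H) : actLin g (curv h) = curv (g * h) := by
  simp [actLin, actConv, curv]

end Weil

namespace Weil

variable {H : Type u} [Ring H] [HopfAlgebra ℂ H]

open Coalgebra in
theorem actLin_conv {f k : H →ₗ[ℂ] WeilTilde H} (hf : ∀ g h, actLin g (f h) = f (g * h))
    (hk : ∀ g h, actLin g (k h) = k (g * h)) (g h : H) :
    actLin g (conv f k h) = conv f k (g * h) := by
  rw [conv_repr ((ℛ ℂ g).mul (ℛ ℂ h)), conv_repr (ℛ ℂ h), map_sum]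
  simp only [actLin_mul_repr (ℛ ℂ g), hf, hk]
  rw [Finset.sum_comm, ← Finset.sum_product']
  refine Finset.sum_congr rfl fun i _ => ?_
  simp only [Coalgebra.Repr.mul, Coalgebra.Repr.induced, Coalgebra.Repr.tmul]
  simp

open Coalgebra in
theorem actLin_actLin (g k : H) (x : WeilTilde H) : actLin g (actLin k x) = actLin (g * k) x := by
  have key : ∀ w, ∀ g k : H, actLin g (actLin k (word w)) = actLin (g * k) (word w) := by
    intro w
    induction w with
    | nil => intro g k; simp [actLin_one, mul_comm, smul_smul]
    | cons a w ih =>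
      intro g k
      have main : ∀ y : WeilTilde H, (∀ g k : H, actLin g (actLin k y) = actLin (g * k) y) →
          actLin g (actLin k (y * word w)) = actLin (g * k) (y * word w) := fun y hy => by
        rw [actLin_mul_repr ((ℛ ℂ g).mul (ℛ ℂ k)), actLin_mul_repr (ℛ ℂ k), map_sum]
        simp only [actLin_mul_repr (ℛ ℂ g), hy, ih]
        rw [Finset.sum_comm, ← Finset.sum_product']
        refine Finset.sum_congr rfl fun i _ => ?_
        simp only [Coalgebra.Repr.mul, Coalgebra.Repr.induced, Coalgebra.Repr.tmul]
        simp
      rcases a with h | h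
      · rw [word_inl]; exact main _ fun g k => by simp [mul_assoc]
      · rw [word_inr]; exact main _ fun g k => by simp [mul_assoc]
  have : actLin g ∘ₗ actLin k = actLin (g * k) := lin_ext fun w => key w g k
  exact LinearMap.congr_fun this x

theorem one_actLin (x : WeilTilde H) : actLin (1 : H) x = x := by
  have : actLin (1 : H) = LinearMap.id := lin_ext fun w => by
    induction w with
    | nil => simp [actLin_one]
    | cons a w ih =>
      rcases a with h | h
      · rw [word_inl, actLin_mul]; simp_all [Algebra.TensorProduct.one_def]
      · rw [word_inr, actLin_mul]; simp_all [Algebra.TensorProduct.one_def]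
  rw [this]; rfl

/-- The action of `H` on `W̃(H)`. -/
noncomputable def wAct : H →ₐ[ℂ] Module.End ℂ (WeilTilde H) :=
  AlgHom.ofLinearMap actLin (LinearMap.ext one_actLin) fun g k =>
    LinearMap.ext fun x => (actLin_actLin g k x).symm

/-- To check that an operator commutes with the action. -/
theorem act_comm (D : WeilTilde H →ₗ[ℂ] WeilTilde H) (s : WeilTilde H →ₗ[ℂ] WeilTilde H)
    (hs : ∀ h x, actLin h (s x) = s (actLin h x))
    (hmul : ∀ x y, D (x * y) = D x * y + s x * D y) (hone : D 1 = 0)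
    (hg : ∀ g h, actLin g (D (gen h)) = D (gen (H := H) (g * h)))
    (hc : ∀ g h, actLin g (D (curv h)) = D (curv (H := H) (g * h))) (g : H) (x : WeilTilde H) :
    actLin g (D x) = D (actLin g x) := by
  have key : ∀ w, ∀ g : H, actLin g (D (word w)) = D (actLin g (word w)) := by
    intro w
    induction w with
    | nil => intro g; simp [actLin_one, hone]
    | cons a w ih =>
      intro g
      have main : ∀ y : WeilTilde H, (∀ g : H, actLin g (D y) = D (actLin g y)) →
          actLin g (D (y * word w)) = D (actLin g (y * word w)) := fun y hy => by
        simp only [actLin_mul_repr (Coalgebra.Repr.arbitrary ℂ g), map_sum, hmul, map_add, hy, ih,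
          hs, Finset.sum_add_distrib]
      rcases a with h | h
      · rw [word_inl]; exact main _ fun g => by rw [hg, actLin_gen]
      · rw [word_inr]; exact main _ fun g => by rw [hc, actLin_curv]
  have : actLin g ∘ₗ D = D ∘ₗ actLin g := lin_ext fun w => key w g
  exact LinearMap.congr_fun this x

theorem actLin_mem (h : H) {k : ℤ} {x : WeilTilde H} (hx : x ∈ wGr k) : actLin h x ∈ wGr k := by
  induction hx using Submodule.span_induction with
  | mem x hx =>
    obtain ⟨w, rfl, rfl⟩ := hx
    induction w generalizing h with
    | nil => rw [word_nil, actLin_one]; exact Submodule.smul_mem _ _ (word_mem [])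
    | cons a w ih =>
      rcases a with g | g
      · rw [word_inl, actLin_mul_repr (Coalgebra.Repr.arbitrary ℂ h), weight_inl]
        exact sum_mem fun i _ => by rw [actLin_gen]; exact wGr_mul (gen_mem _) (ih _)
      · rw [word_inr, actLin_mul_repr (Coalgebra.Repr.arbitrary ℂ h), weight_inr]
        exact sum_mem fun i _ => by rw [actLin_curv]; exact wGr_mul (curv_mem _) (ih _)
  | zero => simp
  | add x y _ _ hx hy => rw [map_add]; exact add_mem hx hy
  | smul c x _ hx => rw [map_smul]; exact Submodule.smul_mem _ _ hx

theorem actLin_sign (h : H) (x : WeilTilde H) : actLin h (sign x) = sign (actLin h x) := by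
  have : actLin h ∘ₗ sign.toLinearMap = sign.toLinearMap ∘ₗ actLin h := lin_ext fun w => by
    simp [sign_word, sign_of_mem (actLin_mem h (word_mem w))]
  exact LinearMap.congr_fun this x

theorem actLin_bd0 (h : H) (x : WeilTilde H) : actLin h (bd0 x) = bd0 (actLin h x) := by
  refine act_comm bd0 sign.toLinearMap actLin_sign bd0_mul bd0_one (fun g h => ?_)
    (fun g h => ?_) h x
  · simp [actLin_conv]
  · simp [actLin_conv]

theorem actLin_dd (h : H) (x : WeilTilde H) : actLin h (dd x) = dd (actLin h x) :=
  act_comm dd sign.toLinearMap actLin_sign dd_mul dd_one (fun g h => by simp) (fun g h => by simp) h x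

theorem actLin_wBd (h : H) (x : WeilTilde H) : actLin h (wBd x) = wBd (actLin h x) := by
  simp [wBd, actLin_bd0, actLin_dd]

/-- The augmentation of `W̃(H)`, which kills all the generators. -/
noncomputable abbrev wAug : WeilTilde H →ₐ[ℂ] ℂ := TensorAlgebra.algebraMapInv

@[simp] theorem wAug_gen (h : H) : wAug (gen h) = 0 := by simp [wAug, gen, TensorAlgebra.algebraMapInv]

@[simp] theorem wAug_curv (h : H) : wAug (curv h) = 0 := by
  simp [wAug, curv, TensorAlgebra.algebraMapInv]

theorem wAug_of_mem {k : ℤ} {x : WeilTilde H} (hx : x ∈ wGr k) (hk : k ≠ 0) : wAug x = 0 := by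
  induction hx using Submodule.span_induction with
  | mem x hx =>
    obtain ⟨w, rfl, rfl⟩ := hx
    rcases w with _ | ⟨h | h, w⟩
    · exact absurd weight_nil hk
    · simp
    · simp
  | zero => simp
  | add x y _ _ hx hy => rw [map_add, hx, hy, add_zero]
  | smul c x _ hx => rw [map_smul, hx, smul_zero]

theorem wAug_wBd (x : WeilTilde H) : wAug (wBd x) = 0 := by
  have : (wAug (H := H)).toLinearMap ∘ₗ wBd = 0 := lin_ext fun w => by
    have hw : 0 ≤ weight w := by
      induction w with
      | nil => simp
      | cons a w ih => rcases a with h | h <;> simp <;> omega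
    exact wAug_of_mem (wBd_mem (word_mem w)) (by omega)
  exact LinearMap.congr_fun this x

theorem wAug_actLin (h : H) (x : WeilTilde H) :
    wAug (actLin h x) = Coalgebra.counit (R := ℂ) h * wAug x := by
  have : (wAug (H := H)).toLinearMap ∘ₗ actLin h =
      Coalgebra.counit (R := ℂ) h • wAug.toLinearMap := lin_ext fun w => by
    rcases w with _ | ⟨g | g, w⟩
    · simp [actLin_one]
    · rw [word_inl]
      simp [actLin_mul_repr (Coalgebra.Repr.arbitrary ℂ h)]
    · rw [word_inr]
      simp [actLin_mul_repr (Coalgebra.Repr.arbitrary ℂ h)]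
  exact LinearMap.congr_fun this x

/-- The Weil complex `W(H)`, as an `H`-DG algebra. -/
noncomputable instance weilHDGAlgebra : HDGAlgebra H (WeilTilde H) where
  aug := wAug
  gr := wGr
  isInternal := wGr_isInternal
  one_mem := word_mem []
  mul_mem := wGr_mul
  aug_of_mem := wAug_of_mem
  bd := wBd
  bd_mem := wBd_mem
  bd_bd := wBd_wBd
  bd_mul := fun hx y => by rw [wBd_mul, sign_of_mem hx, smul_mul_assoc]
  aug_bd := wAug_wBd
  act := wAct
  act_one := actLin_one
  act_mul := actLin_mul
  act_mem := fun h _ _ hx => actLin_mem h hx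
  act_bd := actLin_wBd
  aug_act := wAug_actLin

/-- The number of letters `ω` in a monomial. -/
def curvCount {H : Type u} (w : List (H ⊕ H)) : ℕ :=
  (w.map (Sum.elim (fun _ => 0) (fun _ => 1))).sum

@[simp] theorem curvCount_nil {H : Type u} : curvCount ([] : List (H ⊕ H)) = 0 := rfl

@[simp] theorem curvCount_inl {H : Type u} (h : H) (w : List (H ⊕ H)) :
    curvCount (Sum.inl h :: w) = curvCount w := by
  simp [curvCount]

@[simp] theorem curvCount_inr {H : Type u} (h : H) (w : List (H ⊕ H)) :
    curvCount (Sum.inr h :: w) = curvCount w + 1 := by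
  simp [curvCount, add_comm]

theorem curvCount_append {H : Type u} (w w' : List (H ⊕ H)) :
    curvCount (w ++ w') = curvCount w + curvCount w' := by
  simp [curvCount]

variable (H) in
/-- The ideal `I(H)` generated by the `ω_h`: the linear span of the elements `x ω_h y`. -/
def curvIdeal : Submodule ℂ (WeilTilde H) :=
  Submodule.span ℂ {z | ∃ (x y : WeilTilde H) (h : H), z = x * curv h * y}

theorem mul_curv_mul_mem (x y : WeilTilde H) (h : H) : x * curv h * y ∈ curvIdeal H :=
  Submodule.subset_span ⟨x, y, h, rfl⟩

theorem curvIdeal_mul_left (a : WeilTilde H) {x : WeilTilde H} (hx : x ∈ curvIdeal H) :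
    a * x ∈ curvIdeal H := by
  induction hx using Submodule.span_induction with
  | mem x h =>
    obtain ⟨x, y, h, rfl⟩ := h
    rw [← mul_assoc, ← mul_assoc]; exact mul_curv_mul_mem _ _ _
  | zero => simp
  | add x y _ _ hx hy => rw [mul_add]; exact add_mem hx hy
  | smul c x _ hx => rw [mul_smul_comm]; exact Submodule.smul_mem _ _ hx

theorem curvIdeal_mul_right (a : WeilTilde H) {x : WeilTilde H} (hx : x ∈ curvIdeal H) :
    x * a ∈ curvIdeal H := by
  induction hx using Submodule.span_induction with
  | mem x h =>
    obtain ⟨x, y, h, rfl⟩ := h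
    rw [mul_assoc]; exact mul_curv_mul_mem _ _ _
  | zero => simp
  | add x y _ _ hx hy => rw [add_mul]; exact add_mem hx hy
  | smul c x _ hx => rw [smul_mul_assoc]; exact Submodule.smul_mem _ _ hx

theorem curv_mem_ideal (h : H) : curv h ∈ curvIdeal H := by
  simpa using mul_curv_mul_mem 1 1 h

open Coalgebra in
theorem conv_mem_left {f : H →ₗ[ℂ] WeilTilde H} (hf : ∀ h, f h ∈ curvIdeal H)
    (g : H →ₗ[ℂ] WeilTilde H) (h : H) : conv f g h ∈ curvIdeal H := by
  rw [conv_repr (ℛ ℂ h)]; exact sum_mem fun i _ => curvIdeal_mul_right _ (hf _)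

open Coalgebra in
theorem conv_mem_right (f : H →ₗ[ℂ] WeilTilde H) {g : H →ₗ[ℂ] WeilTilde H}
    (hg : ∀ h, g h ∈ curvIdeal H) (h : H) : conv f g h ∈ curvIdeal H := by
  rw [conv_repr (ℛ ℂ h)]; exact sum_mem fun i _ => curvIdeal_mul_left _ (hg _)

theorem curvIdeal_eq : curvIdeal H = Submodule.span ℂ {x | ∃ w, 1 ≤ curvCount w ∧ x = word w} := by
  refine le_antisymm (Submodule.span_le.2 ?_) (Submodule.span_le.2 ?_)
  · rintro _ ⟨x, y, h, rfl⟩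
    refine word_induction (p := fun x => x * curv h * y ∈ _) (fun w => ?_)
      (fun a b ha hb => ?_) (fun c a ha => ?_) x
    · refine word_induction (p := fun y => word w * curv h * y ∈ _) (fun w' => ?_)
        (fun a b ha hb => ?_) (fun c a ha => ?_) y
      · refine Submodule.subset_span ⟨w ++ Sum.inr h :: w', ?_, ?_⟩
        · rw [curvCount_append, curvCount_inr]; omega
        · rw [word_append, word_inr, mul_assoc]
      · rw [mul_add]; exact add_mem ha hb
      · rw [mul_smul_comm]; exact Submodule.smul_mem _ _ ha
    · rw [add_mul, add_mul]; exact add_mem ha hb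
    · rw [smul_mul_assoc, smul_mul_assoc]; exact Submodule.smul_mem _ _ ha
  · rintro _ ⟨w, hw, rfl⟩
    induction w with
    | nil => simp at hw
    | cons a w ih =>
      rcases a with h | h
      · rw [word_inl]; exact curvIdeal_mul_left _ (ih (by simpa using hw))
      · rw [word_inr]; exact curvIdeal_mul_right _ (curv_mem_ideal h)

/-- The ideal `I(H)` of the Weil complex. -/
noncomputable def weilIdeal (H : Type u) [Ring H] [HopfAlgebra ℂ H] : HDGIdeal H (WeilTilde H) where
  carrier := curvIdeal H
  le := Submodule.span_le.2 <| by
    rintro _ ⟨x, y, h, rfl⟩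
    change wAug (x * curv h * y) = 0
    simp
  mul_left := curvIdeal_mul_left
  mul_right := curvIdeal_mul_right
  isHom := by
    intro x hx
    rw [curvIdeal_eq] at hx
    induction hx using Submodule.span_induction with
    | mem x h =>
      obtain ⟨w, hw, rfl⟩ := h
      refine Submodule.mem_iSup_of_mem (weight w) ⟨?_, word_mem w⟩
      rw [curvIdeal_eq]
      exact Submodule.subset_span ⟨w, hw, rfl⟩
    | zero => exact zero_mem _
    | add x y _ _ hx hy => exact add_mem hx hy
    | smul c x _ hx => exact Submodule.smul_mem _ _ hx
  bd_mem := by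
    intro x hx
    change wBd x ∈ curvIdeal H
    induction hx using Submodule.span_induction with
    | mem x h =>
      obtain ⟨x, y, h, rfl⟩ := h
      rw [wBd_mul, wBd_mul, map_mul, sign_curv, add_mul]
      refine add_mem (add_mem (mul_curv_mul_mem _ _ _) (curvIdeal_mul_right _
        (curvIdeal_mul_left _ ?_))) (mul_curv_mul_mem _ _ _)
      simp only [wBd, LinearMap.add_apply, bd0_curv, dd_curv, add_zero]
      exact sub_mem (conv_mem_left curv_mem_ideal _ _) (conv_mem_right _ curv_mem_ideal _)
    | zero => simp
    | add x y _ _ hx hy => rw [map_add]; exact add_mem hx hy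
    | smul c x _ hx => rw [map_smul]; exact Submodule.smul_mem _ _ hx
  act_mem := by
    intro h x hx
    change actLin h x ∈ curvIdeal H
    induction hx using Submodule.span_induction with
    | mem x hx =>
      obtain ⟨x, y, g, rfl⟩ := hx
      simp only [actLin_mul_repr (Coalgebra.Repr.arbitrary ℂ _), actLin_curv, Finset.sum_mul]
      exact sum_mem fun i _ => sum_mem fun j _ => mul_curv_mul_mem _ _ _
    | zero => simp
    | add x y _ _ hx hy => rw [map_add]; exact add_mem hx hy
    | smul c x _ hx => rw [map_smul]; exact Submodule.smul_mem _ _ hx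

end Weil

namespace Weil

variable {H : Type u} [Ring H] [HopfAlgebra ℂ H]

/-- An auxiliary representation used to split off the first letter of a monomial. -/
noncomputable def splitAux :
    WeilTilde H →ₐ[ℂ] Module.End ℂ (WeilTilde H × ((H × H) ⊗[ℂ] WeilTilde H)) :=
  TensorAlgebra.lift ℂ
    { toFun := fun v => LinearMap.prod
        (LinearMap.mulLeft ℂ (TensorAlgebra.ι ℂ v) ∘ₗ LinearMap.fst ℂ _ _)
        (TensorProduct.mk ℂ (H × H) (WeilTilde H) v ∘ₗ LinearMap.fst ℂ _ _)
      map_add' := fun v w => LinearMap.ext fun x => by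
        simp [add_mul]
      map_smul' := fun c v => LinearMap.ext fun x => by
        simp [TensorProduct.smul_tmul'] }

/-- The map splitting off the first letter of a monomial: `1 ↦ 0` and `a x ↦ a ⊗ x` for a
generator `a`. -/
noncomputable def split : WeilTilde H →ₗ[ℂ] (H × H) ⊗[ℂ] WeilTilde H :=
  LinearMap.snd ℂ _ _ ∘ₗ LinearMap.applyₗ (1, 0) ∘ₗ splitAux.toLinearMap

theorem splitAux_fst (x : WeilTilde H) (y) : (splitAux x y).1 = x * y.1 := by
  induction x using TensorAlgebra.induction generalizing y with
  | algebraMap r => rw [AlgHom.commutes]; simp [Algebra.smul_def]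
  | ι v => simp [splitAux]
  | mul a b ha hb => rw [map_mul, Module.End.mul_apply, ha, hb, mul_assoc]
  | add a b ha hb => rw [map_add, LinearMap.add_apply, Prod.fst_add, ha, hb, add_mul]

theorem split_one : split (1 : WeilTilde H) = 0 := by simp [split]

theorem split_ι_mul (v : H × H) (x : WeilTilde H) :
    split (TensorAlgebra.ι ℂ v * x) = v ⊗ₜ x := by
  have : split (TensorAlgebra.ι ℂ v * x) = v ⊗ₜ (splitAux x (1, 0)).1 := by
    simp only [split, LinearMap.comp_apply, AlgHom.toLinearMap_apply, map_mul,
      LinearMap.applyₗ_apply_apply, Module.End.mul_apply, LinearMap.snd_apply]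
    conv_lhs => rw [splitAux, TensorAlgebra.lift_ι_apply]
    rfl
  rw [this, splitAux_fst, mul_one]

/-- A linear map on `W̃(H)` with prescribed values `1 ↦ 0`, `a x ↦ f a x` for generators `a`. -/
noncomputable def leftRec (f : H × H →ₗ[ℂ] WeilTilde H →ₗ[ℂ] WeilTilde H) :
    WeilTilde H →ₗ[ℂ] WeilTilde H := TensorProduct.lift f ∘ₗ split

theorem leftRec_one (f : H × H →ₗ[ℂ] WeilTilde H →ₗ[ℂ] WeilTilde H) : leftRec f 1 = 0 := by
  simp [leftRec, split_one]

theorem leftRec_gen (f : H × H →ₗ[ℂ] WeilTilde H →ₗ[ℂ] WeilTilde H) (h : H) (x : WeilTilde H) :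
    leftRec f (gen h * x) = f (h, 0) x :=
  congrArg (TensorProduct.lift f) (split_ι_mul (h, 0) x)

theorem leftRec_curv (f : H × H →ₗ[ℂ] WeilTilde H →ₗ[ℂ] WeilTilde H) (h : H) (x : WeilTilde H) :
    leftRec f (curv h * x) = f (0, h) x :=
  congrArg (TensorProduct.lift f) (split_ι_mul (0, h) x)

/-- The backward cyclic permutation: `t(a x) = (-1)^{|a||x|} x a` for a generator `a`. -/
noncomputable def tOp : WeilTilde H →ₗ[ℂ] WeilTilde H :=
  leftRec <| LinearMap.flip <|
    LinearMap.mk₂ ℂ (fun x v => sign x * gen v.1 + x * curv v.2)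
      (fun x y v => by simp only [map_add, add_mul]; abel)
      (fun c x v => by simp only [map_smul, smul_mul_assoc, smul_add])
      (fun x v w => by simp only [Prod.fst_add, Prod.snd_add, map_add, mul_add]; abel)
      (fun c x v => by simp only [Prod.smul_fst, Prod.smul_snd, map_smul, mul_smul_comm, smul_add])

/-- The operator `a x ↦ ∂₀(a) x`, for a generator `a`. -/
noncomputable def pOp : WeilTilde H →ₗ[ℂ] WeilTilde H := leftRec (LinearMap.mul ℂ _ ∘ₗ bd0Gen)

@[simp] theorem tOp_one : tOp (1 : WeilTilde H) = 0 := leftRec_one _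

@[simp] theorem tOp_gen (h : H) (x : WeilTilde H) : tOp (gen h * x) = sign x * gen h := by
  simp [tOp, leftRec_gen]

@[simp] theorem tOp_curv (h : H) (x : WeilTilde H) : tOp (curv h * x) = x * curv h := by
  simp [tOp, leftRec_curv]

@[simp] theorem pOp_one : pOp (1 : WeilTilde H) = 0 := leftRec_one _

theorem pOp_gen (h : H) (x : WeilTilde H) : pOp (gen h * x) = bd0 (gen h) * x := by
  simp [pOp, leftRec_gen, bd0Gen]

theorem pOp_curv (h : H) (x : WeilTilde H) : pOp (curv h * x) = bd0 (curv h) * x := by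
  simp [pOp, leftRec_curv, bd0Gen, sub_mul]

/-- The boundary `b_t`: `b_t(a x) = t(∂₀(a) x)` for a generator `a`. -/
noncomputable def btOp : WeilTilde H →ₗ[ℂ] WeilTilde H := tOp ∘ₗ pOp

/-- The boundary `b = ∂ + b_t`. -/
noncomputable def bOp : WeilTilde H →ₗ[ℂ] WeilTilde H := wBd + btOp

variable (H) in
/-- The span of the monomials with `p` letters. -/
abbrev lenPart (p : ℕ) : Submodule ℂ (WeilTilde H) :=
  LinearMap.range (TensorAlgebra.ι ℂ : H × H →ₗ[ℂ] WeilTilde H) ^ p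

/-- The norm operator: `N = 1 + t + ⋯ + t^{p-1}` on monomials with `p` letters. -/
noncomputable def nOp : WeilTilde H →ₗ[ℂ] WeilTilde H :=
  DirectSum.toModule ℂ ℕ (WeilTilde H)
      (fun p => (∑ i ∈ Finset.range p, tOp ^ i) ∘ₗ (lenPart H p).subtype) ∘ₗ
    (DirectSum.decomposeLinearEquiv (lenPart H)).toLinearMap

theorem nOp_of_mem {p : ℕ} {x : WeilTilde H} (hx : x ∈ lenPart H p) :
    nOp x = ∑ i ∈ Finset.range p, (tOp ^ i) x := by
  simp only [nOp, LinearMap.comp_apply, LinearEquiv.coe_coe, DirectSum.decomposeLinearEquiv_apply]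
  rw [DirectSum.decompose_of_mem (lenPart H) hx, ← DirectSum.lof_eq_of ℂ, DirectSum.toModule_lof]
  simp

theorem left_ext {M : Type*} [AddCommGroup M] [Module ℂ M] {f g : WeilTilde H →ₗ[ℂ] M}
    (h1 : f 1 = g 1) (hg : ∀ h x, f (gen h * x) = g (gen h * x))
    (hc : ∀ h x, f (curv h * x) = g (curv h * x)) : f = g := lin_ext fun w => by
  rcases w with _ | ⟨h | h, w⟩
  · exact h1
  · rw [word_inl]; exact hg _ _
  · rw [word_inr]; exact hc _ _

theorem gen_len (h : H) : gen h ∈ lenPart H 1 := by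
  rw [lenPart, pow_one]; exact ⟨(h, 0), rfl⟩

theorem curv_len (h : H) : curv h ∈ lenPart H 1 := by
  rw [lenPart, pow_one]; exact ⟨(0, h), rfl⟩

theorem mul_len {p q : ℕ} {x y : WeilTilde H} (hx : x ∈ lenPart H p) (hy : y ∈ lenPart H q) :
    x * y ∈ lenPart H (p + q) := by
  rw [lenPart, pow_add]; exact Submodule.mul_mem_mul hx hy

theorem one_len : (1 : WeilTilde H) ∈ lenPart H 0 := by
  rw [lenPart, pow_zero]; exact Submodule.one_le.1 le_rfl

theorem word_len (w : List (H ⊕ H)) : word w ∈ lenPart H w.length := by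
  induction w with
  | nil => exact one_len
  | cons a w ih =>
    rw [List.length_cons, add_comm]
    rcases a with h | h
    · rw [word_inl]; exact mul_len (gen_len h) ih
    · rw [word_inr]; exact mul_len (curv_len h) ih

theorem lenPart_eq (p : ℕ) : lenPart H p = Submodule.span ℂ {x | ∃ w, w.length = p ∧ x = word w} := by
  refine le_antisymm ?_ (Submodule.span_le.2 ?_)
  · induction p with
    | zero =>
      rw [lenPart, pow_zero, Submodule.one_le]
      exact Submodule.subset_span ⟨[], rfl, rfl⟩
    | succ p ih =>
      rw [lenPart, pow_succ', Submodule.mul_le]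
      rintro _ ⟨v, rfl⟩ x hx
      refine Submodule.span_induction (p := fun x _ => TensorAlgebra.ι ℂ v * x ∈ _) ?_ ?_ ?_ ?_ (ih hx)
      · rintro _ ⟨w, hw, rfl⟩
        rw [ι_eq, add_mul, ← word_inl, ← word_inr]
        exact add_mem (Submodule.subset_span ⟨_, by simp [hw], rfl⟩)
          (Submodule.subset_span ⟨_, by simp [hw], rfl⟩)
      · simp
      · intro x y _ _ hx hy; rw [mul_add]; exact add_mem hx hy
      · intro c x _ hx; rw [mul_smul_comm]; exact Submodule.smul_mem _ _ hx
  · rintro _ ⟨w, rfl, rfl⟩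
    exact word_len w

theorem len_of_words {f : WeilTilde H →ₗ[ℂ] WeilTilde H} {p : ℕ} {S : Submodule ℂ (WeilTilde H)}
    (hf : ∀ w, w.length = p → f (word w) ∈ S) {x : WeilTilde H} (hx : x ∈ lenPart H p) : f x ∈ S := by
  rw [lenPart_eq] at hx
  refine Submodule.span_le (p := S.comap f).2 ?_ hx
  rintro _ ⟨w, hw, rfl⟩
  exact hf w hw

theorem sign_len {p : ℕ} {x : WeilTilde H} (hx : x ∈ lenPart H p) : sign x ∈ lenPart H p := by
  refine len_of_words (f := sign.toLinearMap) (fun w hw => ?_) hx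
  subst hw
  simpa [sign_word] using Submodule.smul_mem _ _ (word_len w)

theorem tOp_len {p : ℕ} {x : WeilTilde H} (hx : x ∈ lenPart H p) : tOp x ∈ lenPart H p := by
  refine len_of_words (fun w hw => ?_) hx
  subst hw
  rcases w with _ | ⟨h | h, w⟩
  · simp
  · rw [word_inl, tOp_gen]; exact mul_len (sign_len (word_len w)) (gen_len h)
  · rw [word_inr, tOp_curv]; exact mul_len (word_len w) (curv_len h)

theorem tOp_pow_len {p : ℕ} {x : WeilTilde H} (hx : x ∈ lenPart H p) (i : ℕ) :
    (tOp ^ i) x ∈ lenPart H p := by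
  induction i with
  | zero => exact hx
  | succ i ih => rw [pow_succ', Module.End.mul_apply]; exact tOp_len ih

theorem actLin_len {p : ℕ} {x : WeilTilde H} (hx : x ∈ lenPart H p) (h : H) :
    actLin h x ∈ lenPart H p := by
  refine len_of_words (fun w hw => ?_) hx
  subst hw
  clear hx
  induction w generalizing h with
  | nil => rw [word_nil, actLin_one]; exact Submodule.smul_mem _ _ one_len
  | cons a w ih =>
    rw [List.length_cons, add_comm]
    rcases a with g | g
    · rw [word_inl, actLin_mul_repr (Coalgebra.Repr.arbitrary ℂ h)]
      exact sum_mem fun i _ => by rw [actLin_gen]; exact mul_len (gen_len _) (ih _)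
    · rw [word_inr, actLin_mul_repr (Coalgebra.Repr.arbitrary ℂ h)]
      exact sum_mem fun i _ => by rw [actLin_curv]; exact mul_len (curv_len _) (ih _)

open Coalgebra in
theorem conv_len {f g : H →ₗ[ℂ] WeilTilde H} (hf : ∀ h, f h ∈ lenPart H 1)
    (hg : ∀ h, g h ∈ lenPart H 1) (h : H) : conv f g h ∈ lenPart H 2 := by
  rw [conv_repr (ℛ ℂ h)]
  exact sum_mem fun _ _ => mul_len (hf _) (hg _)

theorem bd0_gen_len (h : H) : bd0 (gen h) ∈ lenPart H 2 := by
  rw [bd0_gen]; exact neg_mem (conv_len gen_len gen_len h)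

theorem bd0_curv_len (h : H) : bd0 (curv h) ∈ lenPart H 2 := by
  rw [bd0_curv]; exact sub_mem (conv_len curv_len gen_len h) (conv_len gen_len curv_len h)

theorem bd0_len {p : ℕ} {x : WeilTilde H} (hx : x ∈ lenPart H p) : bd0 x ∈ lenPart H (p + 1) := by
  refine len_of_words (fun w hw => ?_) hx
  subst hw
  clear hx
  induction w with
  | nil => simp
  | cons a w ih =>
    rcases a with h | h
    · rw [word_inl, bd0_mul, sign_gen]
      refine add_mem ?_ ?_
      · convert mul_len (bd0_gen_len h) (word_len w) using 1; simp; ring_nf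
      · convert mul_len (neg_mem (gen_len h)) ih using 1; simp; ring_nf
    · rw [word_inr, bd0_mul, sign_curv]
      refine add_mem ?_ ?_
      · convert mul_len (bd0_curv_len h) (word_len w) using 1; simp; ring_nf
      · convert mul_len (curv_len h) ih using 1; simp; ring_nf

theorem dd_len {p : ℕ} {x : WeilTilde H} (hx : x ∈ lenPart H p) : dd x ∈ lenPart H p := by
  refine len_of_words (fun w hw => ?_) hx
  subst hw
  clear hx
  induction w with
  | nil => simp
  | cons a w ih =>
    rw [List.length_cons, add_comm]
    rcases a with h | h
    · rw [word_inl, dd_mul, sign_gen, dd_gen]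
      exact add_mem (mul_len (curv_len h) (word_len w)) (mul_len (neg_mem (gen_len h)) ih)
    · rw [word_inr, dd_mul, sign_curv, dd_curv, zero_mul, zero_add]
      exact mul_len (curv_len h) ih

theorem koszulSign_two_mul (a : ℤ) : koszulSign (2 * a) = 1 := by
  simp [koszulSign, zpow_mul]

theorem koszulSign_mul_self (a : ℤ) : koszulSign a * koszulSign a = 1 := by
  rcases koszulSign_cases a with h | h <;> simp [h]

/-- Rotating a monomial `u x` past `u`. -/
theorem tOp_rotate (u : List (H ⊕ H)) {j : ℤ} {x : WeilTilde H} (hx : x ∈ wGr j) :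
    (tOp ^ u.length) (word u * x) = koszulSign (weight u * j) • (x * word u) := by
  induction u generalizing j x with
  | nil => simp [koszulSign_zero]
  | cons a u ih =>
    rw [List.length_cons, pow_succ, Module.End.mul_apply]
    rcases a with h | h
    · rw [word_inl, mul_assoc, tOp_gen, sign_of_mem (wGr_mul (word_mem u) hx), smul_mul_assoc,
        mul_assoc, map_smul, ih (wGr_mul hx (gen_mem h)), smul_smul, weight_inl, mul_assoc]
      congr 1
      simp only [koszulSign_add, mul_add, add_mul, one_mul, mul_one]
      have := koszulSign_mul_self (weight u)
      linear_combination (koszulSign j * koszulSign (weight u * j)) * this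
    · rw [word_inr, mul_assoc, tOp_curv, mul_assoc, ih (wGr_mul hx (curv_mem h)), weight_inr,
        mul_assoc]
      congr 1
      simp only [koszulSign_add, mul_add, add_mul, mul_comm (weight u) 2, koszulSign_two_mul]
      ring

theorem tOp_pow_eq {p : ℕ} {x : WeilTilde H} (hx : x ∈ lenPart H p) : (tOp ^ p) x = x := by
  have : (tOp ^ p - 1 : Module.End ℂ (WeilTilde H)) x ∈ (⊥ : Submodule ℂ (WeilTilde H)) := by
    refine len_of_words (f := (tOp ^ p - 1 : Module.End ℂ (WeilTilde H))) (fun w hw => ?_) hx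
    subst hw
    have := tOp_rotate w (x := 1) (word_mem [])
    rw [mul_one, one_mul, weight_nil, mul_zero, koszulSign_zero, one_smul] at this
    rw [LinearMap.sub_apply, this]
    simp
  rw [Submodule.mem_bot, LinearMap.sub_apply, sub_eq_zero] at this
  exact this

theorem nOp_len {p : ℕ} {x : WeilTilde H} (hx : x ∈ lenPart H p) : nOp x ∈ lenPart H p := by
  rw [nOp_of_mem hx]; exact sum_mem fun i _ => tOp_pow_len hx i

theorem tOp_nOp (x : WeilTilde H) : tOp (nOp x) = nOp x := by
  have : tOp ∘ₗ nOp = nOp (H := H) := lin_ext fun w => by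
    have h1 := Finset.sum_range_succ (fun i => (tOp ^ i) (word w)) w.length
    rw [Finset.sum_range_succ', tOp_pow_eq (word_len w)] at h1
    have h2 := add_right_cancel h1
    rw [LinearMap.comp_apply, nOp_of_mem (word_len w), map_sum, ← h2]
    exact Finset.sum_congr rfl fun i _ => by rw [pow_succ', Module.End.mul_apply]
  exact LinearMap.congr_fun this x

theorem nOp_tOp (x : WeilTilde H) : nOp (tOp x) = nOp x := by
  have : nOp ∘ₗ tOp = nOp (H := H) := lin_ext fun w => by
    have h1 := Finset.sum_range_succ (fun i => (tOp ^ i) (word w)) w.length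
    rw [Finset.sum_range_succ', tOp_pow_eq (word_len w)] at h1
    have h2 := add_right_cancel h1
    rw [LinearMap.comp_apply, nOp_of_mem (word_len w), nOp_of_mem (tOp_len (word_len w)), ← h2]
    exact Finset.sum_congr rfl fun i _ => by rw [pow_succ, Module.End.mul_apply]
  exact LinearMap.congr_fun this x

theorem tOp_pow_nOp (x : WeilTilde H) (i : ℕ) : (tOp ^ i) (nOp x) = nOp x := by
  induction i with
  | zero => rfl
  | succ i ih => rw [pow_succ, Module.End.mul_apply, tOp_nOp, ih]

theorem nOp_tOp_pow (x : WeilTilde H) (i : ℕ) : nOp ((tOp ^ i) x) = nOp x := by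
  induction i with
  | zero => rfl
  | succ i ih => rw [pow_succ', Module.End.mul_apply, nOp_tOp, ih]

end Weil

namespace Weil

variable {H : Type u} [Ring H] [HopfAlgebra ℂ H]

theorem btOp_apply (x : WeilTilde H) : btOp x = tOp (pOp x) := rfl

theorem bOp_apply (x : WeilTilde H) : bOp x = wBd x + tOp (pOp x) := rfl

theorem sign_wBd (x : WeilTilde H) : sign (wBd x) = -wBd (sign x) := by
  simp [wBd, sign_bd0, sign_dd]; abel

open Coalgebra in
theorem tOp_tOp_bd0_gen (h : H) (y : WeilTilde H) :
    tOp (tOp (bd0 (gen h) * y)) = y * bd0 (gen h) := by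
  rw [bd0_gen, conv_repr (ℛ ℂ h)]
  simp only [neg_mul, map_neg, Finset.sum_mul, map_sum, mul_assoc, tOp_gen, map_mul, sign_gen,
    Finset.mul_sum, mul_neg, sign_sign, neg_neg]

open Coalgebra in
theorem tOp_tOp_bd0_curv (h : H) (y : WeilTilde H) :
    tOp (tOp (bd0 (curv h) * y)) = sign y * bd0 (curv h) := by
  rw [bd0_curv, conv_repr (ℛ ℂ h), conv_repr (ℛ ℂ h)]
  simp only [sub_mul, map_sub, Finset.sum_mul, map_sum, mul_assoc, tOp_gen, tOp_curv, map_mul,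
    sign_curv, Finset.mul_sum, mul_sub]

theorem wBd_tOp (x : WeilTilde H) :
    wBd (tOp x) = tOp (wBd x) + tOp (tOp (pOp x)) - tOp (pOp x) := by
  have : wBd ∘ₗ tOp = tOp ∘ₗ wBd + tOp ∘ₗ tOp ∘ₗ pOp - tOp ∘ₗ pOp (H := H) := by
    refine left_ext ?_ (fun h y => ?_) (fun h y => ?_)
    · simp
    · simp only [LinearMap.comp_apply, LinearMap.add_apply, LinearMap.sub_apply, tOp_gen, pOp_gen,
        tOp_tOp_bd0_gen, wBd_mul, sign_sign, map_add, sign_gen, neg_mul, map_neg]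
      have e : wBd (gen h) = bd0 (gen h) + curv h := by simp [wBd]
      rw [e, sign_wBd, add_mul, map_add, tOp_curv, mul_add]
      simp only [neg_mul, neg_neg]
      abel
    · simp only [LinearMap.comp_apply, LinearMap.add_apply, LinearMap.sub_apply, tOp_curv, pOp_curv,
        tOp_tOp_bd0_curv, wBd_mul, map_add, sign_curv]
      have e : wBd (curv h) = bd0 (curv h) := by simp [wBd]
      rw [e]
      abel
  exact LinearMap.congr_fun this x

theorem dd_tOp (x : WeilTilde H) : dd (tOp x) = tOp (dd x) := by
  have : dd ∘ₗ tOp = tOp ∘ₗ dd (H := H) := by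
    refine left_ext ?_ (fun h y => ?_) (fun h y => ?_)
    · simp
    · simp only [LinearMap.comp_apply, tOp_gen, dd_mul, sign_sign, dd_gen, map_add, sign_gen,
        neg_mul, map_neg, tOp_curv, sign_dd]
      simp only [neg_neg]
      abel
    · simp [dd_mul]
  exact LinearMap.congr_fun this x

theorem bd0_tOp (x : WeilTilde H) :
    bd0 (tOp x) = tOp (bd0 x) + tOp (tOp (pOp x)) - tOp (pOp x) := by
  have h1 := wBd_tOp x
  simp only [wBd, LinearMap.add_apply, map_add, dd_tOp] at h1
  have : bd0 (tOp x) = (bd0 (tOp x) + tOp (dd x)) - tOp (dd x) := by abel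
  rw [this, h1]; abel

/-- `∂ (t - 1) = (t - 1) b`. -/
theorem wBd_tSub (x : WeilTilde H) : wBd (tOp x - x) = tOp (bOp x) - bOp x := by
  rw [map_sub, wBd_tOp, bOp_apply, map_add]; abel

/-- The operator `∑_{i<q} t^{q-i} P t^i`. -/
noncomputable def eOp (q : ℕ) : WeilTilde H →ₗ[ℂ] WeilTilde H :=
  ∑ i ∈ Finset.range q, (tOp ^ (q - i) * pOp * tOp ^ i : Module.End ℂ (WeilTilde H))

theorem eOp_succ (q : ℕ) (x : WeilTilde H) :
    eOp (q + 1) x = (tOp ^ (q + 1)) (pOp x) + eOp q (tOp x) := by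
  simp only [eOp, Finset.sum_range_succ', LinearMap.add_apply, LinearMap.sum_apply]
  rw [add_comm]
  congr 1
  refine Finset.sum_congr rfl fun i _ => ?_
  rw [Nat.add_sub_add_right, pow_succ tOp i]
  rfl

theorem eOp_word (u : List (H ⊕ H)) (x : WeilTilde H) :
    eOp u.length (word u * x) = (tOp ^ u.length) (bd0 (word u) * x) := by
  induction u generalizing x with
  | nil => simp [eOp]
  | cons a u ih =>
    rw [List.length_cons, eOp_succ]
    rcases a with h | h
    · rw [word_inl, mul_assoc, tOp_gen, map_mul sign, sign_word, smul_mul_assoc, smul_mul_assoc, map_smul,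
        mul_assoc, ih, pOp_gen, bd0_mul, add_mul, map_add, mul_assoc]
      congr 1
      rw [pow_succ, Module.End.mul_apply, sign_gen, mul_assoc, neg_mul, map_neg, tOp_gen, map_mul sign,
        sign_bd0, sign_word, map_smul, ← map_smul]
      congr 1
      simp only [neg_mul, neg_neg, smul_mul_assoc, mul_assoc]
    · rw [word_inr, mul_assoc, tOp_curv, mul_assoc, ih, pOp_curv, bd0_mul, add_mul, map_add,
        mul_assoc]
      congr 1
      rw [pow_succ, Module.End.mul_apply, sign_curv, mul_assoc, tOp_curv, mul_assoc]

theorem eOp_len {p : ℕ} {x : WeilTilde H} (hx : x ∈ lenPart H p) :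
    eOp p x = (tOp ^ p) (bd0 x) := by
  have : (eOp p - (tOp ^ p : WeilTilde H →ₗ[ℂ] WeilTilde H) ∘ₗ bd0 : WeilTilde H →ₗ[ℂ] WeilTilde H) x ∈
      (⊥ : Submodule ℂ (WeilTilde H)) := by
    refine len_of_words (fun w hw => ?_) hx
    subst hw
    have := eOp_word w 1
    rw [mul_one, mul_one] at this
    simp [this]
  rw [Submodule.mem_bot, LinearMap.sub_apply, sub_eq_zero] at this
  exact this

theorem pOp_len {p : ℕ} {x : WeilTilde H} (hx : x ∈ lenPart H p) : pOp x ∈ lenPart H (p + 1) := by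
  refine len_of_words (fun w hw => ?_) hx
  subst hw
  rcases w with _ | ⟨h | h, w⟩
  · simp
  · rw [word_inl, pOp_gen]
    convert mul_len (bd0_gen_len h) (word_len w) using 1; simp; ring_nf
  · rw [word_inr, pOp_curv]
    convert mul_len (bd0_curv_len h) (word_len w) using 1; simp; ring_nf

/-- `b N = N ∂`. -/
theorem bOp_nOp (x : WeilTilde H) : bOp (nOp x) = nOp (wBd x) := by
  have : bOp ∘ₗ nOp = nOp ∘ₗ wBd (H := H) := lin_ext fun w => by
    set p := w.length with hp
    set x := word w with hx
    have hxl : x ∈ lenPart H p := word_len w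
    have hd : dd (nOp x) = nOp (dd x) := by
      rw [nOp_of_mem hxl, nOp_of_mem (dd_len hxl), map_sum]
      refine Finset.sum_congr rfl fun i hi => ?_
      clear hi
      induction i with
      | zero => rfl
      | succ i ih => rw [pow_succ', Module.End.mul_apply, Module.End.mul_apply, dd_tOp, ih]
    set y := pOp (nOp x) with hy
    have hyl : y ∈ lenPart H (p + 1) := pOp_len (nOp_len hxl)
    have e1 : nOp (bd0 x) = nOp y := by
      rw [← nOp_tOp_pow (bd0 x) p, ← eOp_len hxl, hy, nOp_of_mem hxl, eOp, LinearMap.sum_apply,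
        map_sum, map_sum, map_sum]
      exact Finset.sum_congr rfl fun i _ => by
        rw [Module.End.mul_apply, Module.End.mul_apply, nOp_tOp_pow]
    have e2 : (tOp ^ p) (bd0 (nOp x)) = ∑ i ∈ Finset.range p, (tOp ^ (p - i)) y := by
      rw [← eOp_len (nOp_len hxl), eOp, LinearMap.sum_apply]
      exact Finset.sum_congr rfl fun i _ => by
        rw [Module.End.mul_apply, Module.End.mul_apply, tOp_pow_nOp]
    have e3 : ∑ i ∈ Finset.range p, (tOp ^ (p - i)) y = ∑ i ∈ Finset.range p, (tOp ^ (i + 1)) y := by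
      rw [← Finset.sum_range_reflect]
      refine Finset.sum_congr rfl fun i hi => ?_
      have := Finset.mem_range.1 hi
      congr 2; omega
    have e4 : bd0 (nOp x) = ∑ i ∈ Finset.range p, (tOp ^ (i + 2)) y := by
      rw [← tOp_pow_eq (bd0_len (nOp_len hxl)), pow_succ', Module.End.mul_apply, e2, e3, map_sum]
      exact Finset.sum_congr rfl fun i _ => by rw [pow_succ' tOp (i + 1), Module.End.mul_apply]
    have e5 : nOp y = bd0 (nOp x) + tOp y := by
      rw [← tOp_nOp, nOp_of_mem hyl, Finset.sum_range_succ', map_add, map_sum, e4]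
      congr 1
      exact Finset.sum_congr rfl fun i _ => by rw [pow_succ' tOp (i + 1), Module.End.mul_apply]
    rw [LinearMap.comp_apply, LinearMap.comp_apply, bOp_apply]
    simp only [wBd, LinearMap.add_apply, map_add]
    rw [e1, e5, hd]; abel
  exact LinearMap.congr_fun this x

/-- `tw f B y h = ∑ B(h₁) y f(h₀)`. -/
noncomputable def tw (f B : H →ₗ[ℂ] WeilTilde H) (y : WeilTilde H) : H →ₗ[ℂ] WeilTilde H :=
  LinearMap.mul' ℂ (WeilTilde H) ∘ₗ TensorProduct.map B (LinearMap.mulLeft ℂ y ∘ₗ f) ∘ₗ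
    (TensorProduct.comm ℂ H H).toLinearMap ∘ₗ Coalgebra.comul

theorem tw_repr {ι : Type*} {h : H} (r : Coalgebra.Repr ℂ h ι) (f B : H →ₗ[ℂ] WeilTilde H)
    (y : WeilTilde H) :
    tw f B y h = ∑ i ∈ r.index, B (r.right i) * (y * f (r.left i)) := by
  simp [tw, ← r.eq]

open Coalgebra in
theorem tw_sub (f B C : H →ₗ[ℂ] WeilTilde H) (y : WeilTilde H) (h : H) :
    tw f (B - C) y h = tw f B y h - tw f C y h := by
  simp [tw_repr (ℛ ℂ h), sub_mul]

open Coalgebra in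
theorem tw_neg (f B : H →ₗ[ℂ] WeilTilde H) (y : WeilTilde H) (h : H) :
    tw f (-B) y h = -tw f B y h := by
  simp [tw_repr (ℛ ℂ h)]

open Coalgebra in
theorem tOp_conv_gen (B : H →ₗ[ℂ] WeilTilde H) (y : WeilTilde H) (h : H) :
    tOp (conv gen B h * y) = tw gen (sign.toLinearMap ∘ₗ B) (sign y) h := by
  simp [tw_repr (ℛ ℂ h), conv_repr (ℛ ℂ h), Finset.sum_mul, mul_assoc]

open Coalgebra in
theorem tOp_conv_curv (B : H →ₗ[ℂ] WeilTilde H) (y : WeilTilde H) (h : H) :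
    tOp (conv curv B h * y) = tw curv B y h := by
  simp [tw_repr (ℛ ℂ h), conv_repr (ℛ ℂ h), Finset.sum_mul, mul_assoc]

open Coalgebra in
theorem pOp_conv_gen (B : H →ₗ[ℂ] WeilTilde H) (y : WeilTilde H) (h : H) :
    pOp (conv gen B h * y) = conv (bd0 ∘ₗ gen) B h * y := by
  simp [conv_repr (ℛ ℂ h), Finset.sum_mul, mul_assoc, pOp_gen]

open Coalgebra in
theorem pOp_conv_curv (B : H →ₗ[ℂ] WeilTilde H) (y : WeilTilde H) (h : H) :
    pOp (conv curv B h * y) = conv (bd0 ∘ₗ curv) B h * y := by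
  simp [conv_repr (ℛ ℂ h), Finset.sum_mul, mul_assoc, pOp_curv]

open Coalgebra in
theorem pOp_tw_gen (f : H →ₗ[ℂ] WeilTilde H) (y : WeilTilde H) (h : H) :
    pOp (tw f gen y h) = tw f (bd0 ∘ₗ gen) y h := by
  simp [tw_repr (ℛ ℂ h), pOp_gen]

open Coalgebra in
theorem pOp_tw_curv (f : H →ₗ[ℂ] WeilTilde H) (y : WeilTilde H) (h : H) :
    pOp (tw f curv y h) = tw f (bd0 ∘ₗ curv) y h := by
  simp [tw_repr (ℛ ℂ h), pOp_curv]

theorem sign_comp_conv (f g : H →ₗ[ℂ] WeilTilde H) :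
    (sign (H := H)).toLinearMap ∘ₗ conv f g =
      conv (sign.toLinearMap ∘ₗ f) (sign.toLinearMap ∘ₗ g) := by
  ext h; exact sign_conv f g h

theorem pOp_aux_gen (h : H) (y : WeilTilde H) :
    tOp (pOp (bd0 (gen h) * y)) + pOp (tOp (bd0 (gen h) * y)) = 0 := by
  simp only [bd0_gen, neg_mul, map_neg, pOp_conv_gen, bd0_comp_gen, conv_neg_left, conv_assoc,
    LinearMap.neg_apply, tOp_conv_gen, sign_comp_conv, sign_comp_gen, conv_neg_right, neg_neg,
    tw_neg, pOp_tw_gen]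
  abel

theorem pOp_aux_curv (h : H) (y : WeilTilde H) :
    tOp (pOp (bd0 (curv h) * y)) + pOp (tOp (bd0 (curv h) * y)) = 0 := by
  simp only [bd0_curv, sub_mul, neg_mul, map_sub, map_neg, pOp_conv_gen, pOp_conv_curv,
    bd0_comp_gen, bd0_comp_curv, conv_neg_left, conv_sub_left, conv_assoc, LinearMap.neg_apply,
    LinearMap.sub_apply, tOp_conv_gen, tOp_conv_curv, sign_comp_conv, sign_comp_gen,
    sign_comp_curv, conv_neg_right, neg_neg, tw_neg, tw_sub, pOp_tw_gen, pOp_tw_curv]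
  abel

theorem pOp_bracket (x : WeilTilde H) :
    wBd (pOp x) + pOp (wBd x) - pOp (pOp x) + (tOp (pOp (pOp x)) + pOp (tOp (pOp x))) = 0 := by
  have : wBd ∘ₗ pOp + pOp ∘ₗ wBd - pOp ∘ₗ pOp +
      (tOp ∘ₗ pOp ∘ₗ pOp + pOp ∘ₗ tOp ∘ₗ pOp) = (0 : WeilTilde H →ₗ[ℂ] WeilTilde H) := by
    refine left_ext ?_ (fun h y => ?_) (fun h y => ?_)
    · simp
    · simp only [LinearMap.comp_apply, LinearMap.add_apply, LinearMap.sub_apply, pOp_gen,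
        pOp_aux_gen, add_zero, LinearMap.zero_apply]
      have e1 : wBd (gen h) = bd0 (gen h) + curv h := by simp [wBd]
      have e2 : wBd (bd0 (gen h)) = -bd0 (curv h) := by
        have := bd0_dd (gen h)
        rw [dd_gen] at this
        simp only [wBd, LinearMap.add_apply, bd0_bd0, zero_add]
        exact eq_neg_of_add_eq_zero_right this
      rw [wBd_mul, wBd_mul, e1, e2, sign_bd0, sign_gen]
      simp only [add_mul, map_add, pOp_curv, neg_mul, map_neg, pOp_gen, neg_neg]
      abel
    · simp only [LinearMap.comp_apply, LinearMap.add_apply, LinearMap.sub_apply, pOp_curv,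
        pOp_aux_curv, add_zero, LinearMap.zero_apply]
      have e1 : wBd (curv h) = bd0 (curv h) := by simp [wBd]
      have e2 : wBd (bd0 (curv h)) = 0 := by
        have := bd0_dd (curv h)
        rw [dd_curv, map_zero, zero_add] at this
        simp only [wBd, LinearMap.add_apply, bd0_bd0, this, add_zero]
      rw [wBd_mul, wBd_mul, e1, e2, sign_bd0, sign_curv]
      simp only [zero_mul, zero_add, map_add, pOp_curv, neg_mul]
      abel
  exact LinearMap.congr_fun this x

/-- `b² = 0`. -/
theorem bOp_bOp (x : WeilTilde H) : bOp (bOp x) = 0 := by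
  have h1 := congrArg tOp (pOp_bracket x)
  simp only [map_add, map_sub, map_zero] at h1
  rw [bOp_apply, bOp_apply, map_add, wBd_wBd, wBd_tOp, map_add, map_add]
  refine Eq.trans ?_ h1
  abel

theorem sign_mem {k : ℤ} {x : WeilTilde H} (hx : x ∈ wGr k) : sign x ∈ wGr k := by
  rw [sign_of_mem hx]; exact Submodule.smul_mem _ _ hx

/-- To check something about an operator on homogeneous elements, use monomials. -/
theorem gr_of_words {f : WeilTilde H →ₗ[ℂ] WeilTilde H} {k : ℤ} {S : Submodule ℂ (WeilTilde H)}
    (hf : ∀ w, weight w = k → f (word w) ∈ S) {x : WeilTilde H} (hx : x ∈ wGr k) : f x ∈ S := by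
  refine Submodule.span_le (p := S.comap f).2 ?_ hx
  rintro _ ⟨w, hw, rfl⟩
  exact hf w hw

theorem tOp_mem {k : ℤ} {x : WeilTilde H} (hx : x ∈ wGr k) : tOp x ∈ wGr k := by
  refine gr_of_words (fun w hw => ?_) hx
  subst hw
  rcases w with _ | ⟨h | h, w⟩
  · simp
  · rw [word_inl, tOp_gen, weight_inl, add_comm]
    exact wGr_mul (sign_mem (word_mem w)) (gen_mem h)
  · rw [word_inr, tOp_curv, weight_inr, add_comm]
    exact wGr_mul (word_mem w) (curv_mem h)

theorem nOp_mem {k : ℤ} {x : WeilTilde H} (hx : x ∈ wGr k) : nOp x ∈ wGr k := by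
  refine gr_of_words (fun w hw => ?_) hx
  subst hw
  rw [nOp_of_mem (word_len w)]
  refine sum_mem fun i hi => ?_
  clear hi
  induction i with
  | zero => exact word_mem w
  | succ i ih => rw [pow_succ', Module.End.mul_apply]; exact tOp_mem ih

theorem pOp_mem {k : ℤ} {x : WeilTilde H} (hx : x ∈ wGr k) : pOp x ∈ wGr (k + 1) := by
  refine gr_of_words (fun w hw => ?_) hx
  subst hw
  rcases w with _ | ⟨h | h, w⟩
  · simp
  · rw [word_inl, pOp_gen, weight_inl, bd0_gen]
    convert wGr_mul (neg_mem (conv_mem gen_mem gen_mem h)) (word_mem w) using 1; ring_nf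
  · rw [word_inr, pOp_curv, weight_inr, bd0_curv]
    convert wGr_mul (sub_mem (conv_mem curv_mem gen_mem h) (conv_mem gen_mem curv_mem h))
      (word_mem w) using 1
    ring_nf

theorem bOp_mem {k : ℤ} {x : WeilTilde H} (hx : x ∈ wGr k) : bOp x ∈ wGr (k + 1) :=
  add_mem (wBd_mem hx) (tOp_mem (pOp_mem hx))

theorem wAug_tOp (x : WeilTilde H) : wAug (tOp x) = 0 := by
  have : (wAug (H := H)).toLinearMap ∘ₗ tOp = 0 :=
    left_ext (by simp) (fun h x => by simp) (fun h x => by simp)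
  exact LinearMap.congr_fun this x

theorem wAug_nOp (x : WeilTilde H) : wAug (nOp x) = 0 := by rw [← tOp_nOp, wAug_tOp]

theorem wAug_bOp (x : WeilTilde H) : wAug (bOp x) = 0 := by
  rw [bOp_apply, map_add, wAug_wBd, wAug_tOp, add_zero]

theorem pow_eq_span (k : ℕ) : (weilIdeal H).pow k =
    Submodule.span ℂ {x | ∃ w, k ≤ curvCount w ∧ x = word w} := by
  refine le_antisymm ?_ (Submodule.span_le.2 ?_)
  · induction k with
    | zero =>
      intro x _
      exact word_induction (p := fun x => x ∈ Submodule.span ℂ {x | ∃ w, 0 ≤ curvCount w ∧ x = word w})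
        (fun w => Submodule.subset_span ⟨w, Nat.zero_le _, rfl⟩) (fun _ _ => add_mem)
        (fun c _ => Submodule.smul_mem _ c) x
    | succ k ih =>
      refine (mul_le_mul' ih (curvIdeal_eq (H := H)).le).trans ?_
      rw [Submodule.span_mul_span]
      refine Submodule.span_mono ?_
      rintro _ ⟨_, ⟨w, hw, rfl⟩, _, ⟨w', hw', rfl⟩, rfl⟩
      exact ⟨w ++ w', by rw [curvCount_append]; omega, (word_append w w').symm⟩
  · rintro _ ⟨w, hw, rfl⟩
    induction w generalizing k with
    | nil =>
      obtain rfl : k = 0 := by simpa using hw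
      trivial
    | cons a w ih =>
      rcases a with h | h
      · rw [word_inl]; exact (weilIdeal H).pow_mul_left _ _ (ih k (by simpa using hw))
      · rw [word_inr]
        rcases k with _ | k
        · trivial
        · exact (weilIdeal H).mul_mem_pow k (curv_mem_ideal h) (ih k (by simpa using hw))

theorem pow_of_words {f : WeilTilde H →ₗ[ℂ] WeilTilde H} {k : ℕ} {S : Submodule ℂ (WeilTilde H)}
    (hf : ∀ w, k ≤ curvCount w → f (word w) ∈ S) {x : WeilTilde H} (hx : x ∈ (weilIdeal H).pow k) :
    f x ∈ S := by
  rw [pow_eq_span] at hx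
  refine Submodule.span_le (p := S.comap f).2 ?_ hx
  rintro _ ⟨w, hw, rfl⟩
  exact hf w hw

theorem word_pow {k : ℕ} {w : List (H ⊕ H)} (hw : k ≤ curvCount w) :
    word w ∈ (weilIdeal H).pow k := by
  rw [pow_eq_span]; exact Submodule.subset_span ⟨w, hw, rfl⟩

theorem tOp_pow {k : ℕ} {x : WeilTilde H} (hx : x ∈ (weilIdeal H).pow k) :
    tOp x ∈ (weilIdeal H).pow k := by
  refine pow_of_words (fun w hw => ?_) hx
  rcases w with _ | ⟨h | h, w⟩
  · simp
  · rw [word_inl, tOp_gen, sign_word, smul_mul_assoc]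
    exact Submodule.smul_mem _ _ ((weilIdeal H).pow_mul_right _ _ (word_pow (by simpa using hw)))
  · rw [word_inr, tOp_curv]
    have := word_pow (w := w ++ [Sum.inr h]) (k := k) (by
      rw [curvCount_append]; simpa using hw)
    rw [word_append] at this
    simpa using this

theorem nOp_pow {k : ℕ} {x : WeilTilde H} (hx : x ∈ (weilIdeal H).pow k) :
    nOp x ∈ (weilIdeal H).pow k := by
  refine pow_of_words (fun w hw => ?_) hx
  rw [nOp_of_mem (word_len w)]
  refine sum_mem fun i hi => ?_
  clear hi
  induction i with
  | zero => exact word_pow hw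
  | succ i ih => rw [pow_succ', Module.End.mul_apply]; exact tOp_pow ih

theorem pOp_pow {k : ℕ} {x : WeilTilde H} (hx : x ∈ (weilIdeal H).pow k) :
    pOp x ∈ (weilIdeal H).pow k := by
  refine pow_of_words (fun w hw => ?_) hx
  rcases w with _ | ⟨h | h, w⟩
  · simp
  · rw [word_inl, pOp_gen]
    exact (weilIdeal H).pow_mul_left _ _ (word_pow (by simpa using hw))
  · rw [word_inr, pOp_curv]
    rcases k with _ | k
    · trivial
    · refine (weilIdeal H).mul_mem_pow k ?_ (word_pow (by simpa using hw))
      rw [bd0_curv]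
      exact sub_mem (conv_mem_left curv_mem_ideal _ _) (conv_mem_right _ curv_mem_ideal _)

theorem bOp_pow {k : ℕ} {x : WeilTilde H} (hx : x ∈ (weilIdeal H).pow k) :
    bOp x ∈ (weilIdeal H).pow k :=
  add_mem ((weilIdeal H).pow_bd k hx) (tOp_pow (pOp_pow hx))

/-- To check that an operator sends coinvariants to coinvariants. -/
theorem coinv_of {δ : H →ₐ[ℂ] ℂ} {f : WeilTilde H →ₗ[ℂ] WeilTilde H}
    (h1 : ∀ h, f (actLin h 1 - δ h • 1) ∈ coinvA H (WeilTilde H) δ)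
    (hg : ∀ h g y, f (actLin h (gen g * y) - δ h • (gen g * y)) ∈ coinvA H (WeilTilde H) δ)
    (hc : ∀ h g y, f (actLin h (curv g * y) - δ h • (curv g * y)) ∈ coinvA H (WeilTilde H) δ) :
    coinvA H (WeilTilde H) δ ≤ (coinvA H (WeilTilde H) δ).comap f := by
  refine Submodule.span_le.2 ?_
  rintro _ ⟨h, m, rfl⟩
  have : (Submodule.mkQ (coinvA H (WeilTilde H) δ)) ∘ₗ f ∘ₗ (actLin h - δ h • LinearMap.id) = 0 :=
    left_ext ((Submodule.Quotient.mk_eq_zero _).2 (h1 h))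
      (fun g y => (Submodule.Quotient.mk_eq_zero _).2 (hg h g y))
      (fun g y => (Submodule.Quotient.mk_eq_zero _).2 (hc h g y))
  exact (Submodule.Quotient.mk_eq_zero (coinvA H (WeilTilde H) δ)).1 (LinearMap.congr_fun this m)

theorem act_eq (h : H) (x : WeilTilde H) : act h x = actLin h x := rfl

theorem tOp_coinv (δ : H →ₐ[ℂ] ℂ)
    (hδ : twistedAntipode δ ∘ₗ twistedAntipode δ = LinearMap.id) :
    coinvA H (WeilTilde H) δ ≤ (coinvA H (WeilTilde H) δ).comap tOp := by
  refine coinv_of (fun h => ?_) (fun h g y => ?_) (fun h g y => ?_)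
  · simp [actLin_one]
  · have := act_swap_sub_mem δ hδ (Coalgebra.Repr.arbitrary ℂ h) (sign y) (gen g)
    simp only [act_eq, actLin_gen] at this
    rw [actLin_mul_repr (Coalgebra.Repr.arbitrary ℂ h), map_sub, map_sum, map_smul, tOp_gen]
    simpa only [actLin_gen, tOp_gen, actLin_sign] using this
  · have := act_swap_sub_mem δ hδ (Coalgebra.Repr.arbitrary ℂ h) y (curv g)
    simp only [act_eq, actLin_curv] at this
    rw [actLin_mul_repr (Coalgebra.Repr.arbitrary ℂ h), map_sub, map_sum, map_smul, tOp_curv]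
    simpa only [actLin_curv, tOp_curv] using this

theorem actLin_pOp (h : H) (x : WeilTilde H) : actLin h (pOp x) = pOp (actLin h x) := by
  have : actLin h ∘ₗ pOp = pOp ∘ₗ actLin h := by
    refine left_ext ?_ (fun g y => ?_) (fun g y => ?_)
    · simp [actLin_one]
    · simp only [LinearMap.comp_apply, pOp_gen, actLin_mul_repr (Coalgebra.Repr.arbitrary ℂ h),
        map_sum, actLin_gen, actLin_bd0]
    · simp only [LinearMap.comp_apply, pOp_curv, actLin_mul_repr (Coalgebra.Repr.arbitrary ℂ h),
        map_sum, actLin_curv, actLin_bd0]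
  exact LinearMap.congr_fun this x

theorem bOp_coinv (δ : H →ₐ[ℂ] ℂ)
    (hδ : twistedAntipode δ ∘ₗ twistedAntipode δ = LinearMap.id) :
    coinvA H (WeilTilde H) δ ≤ (coinvA H (WeilTilde H) δ).comap bOp := fun x hx => by
  have h1 := coinv_le δ (ρ := fun h => (act h : WeilTilde H →ₗ[ℂ] WeilTilde H))
    (ρ' := fun h => (act h : WeilTilde H →ₗ[ℂ] WeilTilde H)) wBd
    (fun h m => (actLin_wBd h m).symm) hx
  have h2 := coinv_le δ (ρ := fun h => (act h : WeilTilde H →ₗ[ℂ] WeilTilde H))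
    (ρ' := fun h => (act h : WeilTilde H →ₗ[ℂ] WeilTilde H)) pOp
    (fun h m => (actLin_pOp h m).symm) hx
  exact Submodule.add_mem (coinvA H (WeilTilde H) δ) h1 (tOp_coinv δ hδ h2)

theorem nOp_coinv (δ : H →ₐ[ℂ] ℂ)
    (hδ : twistedAntipode δ ∘ₗ twistedAntipode δ = LinearMap.id) :
    coinvA H (WeilTilde H) δ ≤ (coinvA H (WeilTilde H) δ).comap nOp := by
  have key : ∀ h w, nOp (actLin h (word w) - δ h • word w) ∈ coinvA H (WeilTilde H) δ := by
    intro h w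
    rw [nOp_of_mem (sub_mem (actLin_len (word_len w) h) (Submodule.smul_mem _ _ (word_len w)))]
    refine sum_mem fun i hi => ?_
    clear hi
    induction i with
    | zero => exact Submodule.subset_span ⟨h, word w, rfl⟩
    | succ i ih => rw [pow_succ', Module.End.mul_apply]; exact tOp_coinv δ hδ ih
  refine Submodule.span_le.2 ?_
  rintro _ ⟨h, m, rfl⟩
  have : (Submodule.mkQ (coinvA H (WeilTilde H) δ)) ∘ₗ nOp ∘ₗ (actLin h - δ h • LinearMap.id) = 0 :=
    lin_ext fun w => (Submodule.Quotient.mk_eq_zero _).2 (key h w)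
  exact (Submodule.Quotient.mk_eq_zero (coinvA H (WeilTilde H) δ)).1 (LinearMap.congr_fun this m)

end Weil

namespace Weil

variable {H : Type u} [Ring H] [HopfAlgebra ℂ H]

variable (H) in
/-- The truncated Weil complex `W_n(H) = W(H) / I(H)^{n+1}`. -/
abbrev Wn (n : ℕ) : Type u := nonunital H (WeilTilde H) ⧸ (weilIdeal H).powR n

/-- The action of `H` on `W_n(H)`. -/
noncomputable def actWn (n : ℕ) (h : H) : Wn H n →ₗ[ℂ] Wn H n :=
  Submodule.mapQ _ _ (actR H (WeilTilde H) h) fun _ hx => (weilIdeal H).pow_act (n + 1) h hx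

/-- The localized truncated Weil complex `W_n(H)_δ = W_n(H) / coinv`. -/
abbrev WnLoc (δ : H →ₐ[ℂ] ℂ) (n : ℕ) : Type u := Wn H n ⧸ coinvariants δ (actWn (H := H) n)

/-- The operator `f` on `W̃(H)` induces operators on `W(H)`, on `W_n(H)` and on `W_n(H)_δ`. -/
structure Descends (δ : H →ₐ[ℂ] ℂ) (f : WeilTilde H →ₗ[ℂ] WeilTilde H) : Prop where
  aug : ∀ x, wAug x = 0 → wAug (f x) = 0
  pow : ∀ k x, x ∈ (weilIdeal H).pow k → f x ∈ (weilIdeal H).pow k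
  coinv : coinvA H (WeilTilde H) δ ≤ (coinvA H (WeilTilde H) δ).comap f

/-- The operator induced on `W(H)`. -/
noncomputable def opW {δ : H →ₐ[ℂ] ℂ} {f : WeilTilde H →ₗ[ℂ] WeilTilde H} (hf : Descends δ f) :
    nonunital H (WeilTilde H) →ₗ[ℂ] nonunital H (WeilTilde H) :=
  f.restrict fun x hx => hf.aug x hx

/-- The operator induced on `W_n(H)`. -/
noncomputable def opWn {δ : H →ₐ[ℂ] ℂ} {f : WeilTilde H →ₗ[ℂ] WeilTilde H} (hf : Descends δ f)
    (n : ℕ) : Wn H n →ₗ[ℂ] Wn H n :=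
  Submodule.mapQ _ _ (opW hf) fun x hx => hf.pow (n + 1) x hx

theorem opWn_coinv {δ : H →ₐ[ℂ] ℂ} {f : WeilTilde H →ₗ[ℂ] WeilTilde H} (hf : Descends δ f)
    (n : ℕ) : coinvariants δ (actWn (H := H) n) ≤ (coinvariants δ (actWn n)).comap (opWn hf n) := by
  refine Submodule.span_le.2 ?_
  rintro _ ⟨h, m, rfl⟩
  obtain ⟨m, rfl⟩ := Submodule.mkQ_surjective _ m
  have h1 : f (actLin h (m : WeilTilde H) - δ h • (m : WeilTilde H)) ∈ coinvA H (WeilTilde H) δ :=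
    hf.coinv (Submodule.subset_span ⟨h, _, rfl⟩)
  have h2 := projR_coinv δ h1
  have h3 : projR (H := H) (f (actLin h (m : WeilTilde H) - δ h • (m : WeilTilde H))) =
      opW hf (actR H _ h m - δ h • m) :=
    projR_coe (opW hf (actR H (WeilTilde H) h m - δ h • m))
  rw [Submodule.mem_comap, h3] at h2
  exact coinv_le δ (ρ' := actWn n) (Submodule.mkQ ((weilIdeal H).powR n)) (fun h m => rfl) h2

/-- The operator induced on `W_n(H)_δ`. -/
noncomputable def opLoc {δ : H →ₐ[ℂ] ℂ} {f : WeilTilde H →ₗ[ℂ] WeilTilde H} (hf : Descends δ f)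
    (n : ℕ) : WnLoc δ n →ₗ[ℂ] WnLoc δ n :=
  Submodule.mapQ _ _ (opWn hf n) (opWn_coinv hf n)

/-- The grading of `W_n(H)_δ`. -/
noncomputable def grLoc (δ : H →ₐ[ℂ] ℂ) (n : ℕ) : ℤ → Submodule ℂ (WnLoc δ n) :=
  quotGr (quotGr (grR H (WeilTilde H)) ((weilIdeal H).powR n)) (coinvariants δ (actWn n))

theorem opLoc_gr {δ : H →ₐ[ℂ] ℂ} {f : WeilTilde H →ₗ[ℂ] WeilTilde H} (hf : Descends δ f)
    (n : ℕ) {k l : ℤ} (h : ∀ x, x ∈ wGr k → f x ∈ wGr l) :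
    grLoc δ n k ≤ (grLoc δ n l).comap (opLoc hf n) :=
  quotGr_le _ _ (quotGr_le _ _ fun x hx => h x hx)

/-- The class in `W_n(H)_δ` of an element of `W(H)`. -/
noncomputable def cls (δ : H →ₐ[ℂ] ℂ) (n : ℕ) (x : nonunital H (WeilTilde H)) : WnLoc δ n :=
  Submodule.Quotient.mk (Submodule.Quotient.mk x)

theorem cls_surj (δ : H →ₐ[ℂ] ℂ) (n : ℕ) (y : WnLoc δ n) : ∃ x, cls δ n x = y := by
  obtain ⟨y, rfl⟩ := Submodule.mkQ_surjective _ y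
  obtain ⟨y, rfl⟩ := Submodule.mkQ_surjective _ y
  exact ⟨y, rfl⟩

theorem opLoc_cls {δ : H →ₐ[ℂ] ℂ} {f : WeilTilde H →ₗ[ℂ] WeilTilde H} (hf : Descends δ f)
    (n : ℕ) (x : nonunital H (WeilTilde H)) : opLoc hf n (cls δ n x) = cls δ n (opW hf x) := rfl

theorem cls_zero (δ : H →ₐ[ℂ] ℂ) (n : ℕ) : cls δ n 0 = 0 := rfl

theorem descends_wBd (δ : H →ₐ[ℂ] ℂ) : Descends δ (wBd (H := H)) where
  aug x _ := wAug_wBd x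
  pow k _ hx := (weilIdeal H).pow_bd k hx
  coinv := coinv_le δ (ρ' := fun h => (act h : WeilTilde H →ₗ[ℂ] WeilTilde H)) wBd
    fun h m => (actLin_wBd h m).symm

theorem descends_bOp {δ : H →ₐ[ℂ] ℂ}
    (hδ : twistedAntipode δ ∘ₗ twistedAntipode δ = LinearMap.id) : Descends δ (bOp (H := H)) where
  aug x _ := wAug_bOp x
  pow _ _ hx := bOp_pow hx
  coinv := bOp_coinv δ hδ

theorem descends_nOp {δ : H →ₐ[ℂ] ℂ}
    (hδ : twistedAntipode δ ∘ₗ twistedAntipode δ = LinearMap.id) : Descends δ (nOp (H := H)) where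
  aug x _ := wAug_nOp x
  pow _ _ hx := nOp_pow hx
  coinv := nOp_coinv δ hδ

theorem descends_tSub {δ : H →ₐ[ℂ] ℂ}
    (hδ : twistedAntipode δ ∘ₗ twistedAntipode δ = LinearMap.id) :
    Descends δ (tOp - LinearMap.id : WeilTilde H →ₗ[ℂ] WeilTilde H) where
  aug x hx := by simp [wAug_tOp, hx]
  pow _ _ hx := sub_mem (tOp_pow hx) hx
  coinv _ hx := Submodule.sub_mem (coinvA H (WeilTilde H) δ) (tOp_coinv δ hδ hx) hx

/-- The complex `W_n(H)_δ`, with boundary `∂`. -/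
noncomputable def ccEven (δ : H →ₐ[ℂ] ℂ) (n : ℕ) : CochainComplex (ModuleCat.{u} ℂ) ℤ :=
  gradedComplex (grLoc δ n) (opLoc (descends_wBd δ) n)
    (fun _ => opLoc_gr _ n fun _ hx => wBd_mem hx) fun y => by
      obtain ⟨x, rfl⟩ := cls_surj δ n y
      exact (congrArg (cls δ n) (Subtype.ext (wBd_wBd x.1))).trans (cls_zero δ n)

/-- The complex `W_n^b(H)_δ`, with boundary `b`. -/
noncomputable def ccOdd {δ : H →ₐ[ℂ] ℂ}
    (hδ : twistedAntipode δ ∘ₗ twistedAntipode δ = LinearMap.id) (n : ℕ) :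
    CochainComplex (ModuleCat.{u} ℂ) ℤ :=
  gradedComplex (grLoc δ n) (opLoc (descends_bOp hδ) n)
    (fun _ => opLoc_gr _ n fun _ hx => bOp_mem hx) fun y => by
      obtain ⟨x, rfl⟩ := cls_surj δ n y
      exact (congrArg (cls δ n) (Subtype.ext (bOp_bOp x.1))).trans (cls_zero δ n)

/-- The super-complex of complexes `W_n(H)_δ ⇄ W_n^b(H)_δ` with boundaries `N` (even to odd) and
`t - 1` (odd to even). -/
noncomputable def ccSuper {δ : H →ₐ[ℂ] ℂ}
    (hδ : twistedAntipode δ ∘ₗ twistedAntipode δ = LinearMap.id) (n : ℕ) :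
    HomologicalComplex₂ (ModuleCat.{u} ℂ) (ComplexShape.up (ZMod 2)) (ComplexShape.up ℤ) :=
  superComplex (E := ccEven δ n) (O := ccOdd hδ n)
    (gradedHom (opLoc (descends_nOp hδ) n) (fun _ => opLoc_gr _ n fun _ hx => nOp_mem hx)
      fun y => by
        obtain ⟨x, rfl⟩ := cls_surj δ n y
        exact congrArg (cls δ n) (Subtype.ext (bOp_nOp x.1).symm))
    (gradedHom (opLoc (descends_tSub hδ) n)
      (fun _ => opLoc_gr _ n fun _ hx => sub_mem (tOp_mem hx) hx)
      fun y => by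
        obtain ⟨x, rfl⟩ := cls_surj δ n y
        exact congrArg (cls δ n) (Subtype.ext (wBd_tSub x.1).symm))
    (gradedHom_comp _ _ _ _ _ _ fun y => by
      obtain ⟨x, rfl⟩ := cls_surj δ n y
      refine (congrArg (cls δ n) (Subtype.ext ?_)).trans (cls_zero δ n)
      exact sub_eq_zero.2 (tOp_nOp x.1))
    (gradedHom_comp _ _ _ _ _ _ fun y => by
      obtain ⟨x, rfl⟩ := cls_surj δ n y
      refine (congrArg (cls δ n) (Subtype.ext ?_)).trans (cls_zero δ n)
      exact (map_sub nOp _ _).trans (sub_eq_zero.2 (nOp_tOp x.1)))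

/-- The localized cyclic bicomplex `CC_δ(W_n(H))`:
`⋯ → W_n^b(H)_δ → W_n(H)_δ → W_n^b(H)_δ → W_n(H)_δ → ⋯` with horizontal boundaries `t - 1` and `N`,
and with the columns `W_n(H)_δ` in even horizontal degree. -/
noncomputable def ccWn {δ : H →ₐ[ℂ] ℂ}
    (hδ : twistedAntipode δ ∘ₗ twistedAntipode δ = LinearMap.id) (n : ℕ) :
    HomologicalComplex₂ (ModuleCat.{u} ℂ) (ComplexShape.up ℤ) (ComplexShape.up ℤ) :=
  periodicComplex (ccSuper hδ n)

end Weil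

/-- The cyclic bicomplex `CC_δ^*(H, n)`: the bicomplex `CC_δ(W_n(H))` shifted by one in the
vertical direction. -/
noncomputable def cyclicBicomplex {H : Type u} [Ring H] [HopfAlgebra ℂ H] {δ : H →ₐ[ℂ] ℂ}
    (hδ : twistedAntipode δ ∘ₗ twistedAntipode δ = LinearMap.id) (n : ℕ) :
    HomologicalComplex₂ (ModuleCat.{u} ℂ) (ComplexShape.up ℤ) (ComplexShape.up ℤ) :=
  (HomologicalComplex₂.shiftFunctor₂ (ModuleCat.{u} ℂ) 1).obj (Weil.ccWn hδ n)

/-- The localized relative `X`-complex `X_δ^{2n+1}(W(H), I(H))` of the Weil complex, as a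
super-complex of complexes. -/
noncomputable def weilX {H : Type u} [Ring H] [HopfAlgebra ℂ H] {δ : H →ₐ[ℂ] ℂ}
    (hδ : twistedAntipode δ ∘ₗ twistedAntipode δ = LinearMap.id) (n : ℕ) :
    HomologicalComplex₂ (ModuleCat.{u} ℂ) (ComplexShape.up (ZMod 2)) (ComplexShape.up ℤ) :=
  (Weil.weilIdeal H).xComplex δ hδ n

/-! The even parts agree for a formal reason: dividing $W$ by $I^{n+1}$ and then by the coinvariants
is the same as dividing by the sum of the two (`locEquiv`). The content lies in the odd part.

$W$ is free on the space $V$ of generators $i(h)$, $\omega_h$, so $\Omega^1(W)$ is the free bimodule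
$\tilde W\otimes V\otimes\tilde W$. Modulo graded commutators only $\tilde W\otimes V$ is left:
every form is congruent to a sum of forms $x\,da$ with $a$ a generator (`form_eq_zero`). On the
other hand, splitting off the first letter identifies $W$ with $V\otimes\tilde W$. Hence
$ax\leftrightarrow\pm x\,da$ identifies $W$ with the commutator quotient of $\Omega^1(W)$; this is
`toForm`. The inverse is dictated by the Leibniz rule: for $z=a_1\cdots a_p$ the form $x\,dz$ is
congruent to a sum over the letters $a_i$ of forms $\pm x_i\,da_i$, and the words $a_ix_i$ are the
first $p$ rotations of $\pm zx$. This is `ofForm`, and it kills commutators because of the splitting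
of rotations in `rotSum_mul`.

The operators then match. The form $dz=1\,dz$ corresponds to the full cyclic sum $Nz$
(`toForm_nOp_sub_mem`). The commutator map sends $\pm x\,da$ to $\pm[x,a]=(t-1)(ax)$
(`formB_toForm`). The boundary of $\pm x\,da$ contains $d(\partial a)$; the linear part of $\partial
a$ causes no trouble, while the quadratic part $\partial_0 a$ gives two forms by the Leibniz rule.
One comes from $\partial_0(a)x$ and the other from $t(\partial_0(a)x)=b_t(ax)$, so the boundary of
forms corresponds to $b=\partial+b_t$ (`toForm_bOp_sub_mem`).

Two kinds of relations remain. The identification reverses $a$ and $x$, so it carries $h(ax)$ to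
$\sum h_1(x)\,d(h_0(a))$, which is not the diagonal action on $x\,da$. Modulo coinvariants it is
still $\delta(h)\,x\,da$, and here $S_\delta^2=\mathrm{Id}$ enters (`act_tmul_swap_sub_mem`,
`rotSum_act`). The powers of $I$ are compared by counting the letters $\omega$ (`toForm_pow`,
`ofForm_formPow`). -/

/-! ### Isomorphisms of graded complexes, super-complexes and periodic complexes. -/

/-- A linear equivalence that respects the gradings and the differentials induces an isomorphism of
complexes. -/
noncomputable def gradedIso {M N : Type u} [AddCommGroup M] [Module ℂ M] [AddCommGroup N]
    [Module ℂ N] {g : ℤ → Submodule ℂ M} {D : M →ₗ[ℂ] M}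
    {hD : ∀ k, g k ≤ (g (k + 1)).comap D} {hDD : ∀ x, D (D x) = 0}
    {g' : ℤ → Submodule ℂ N} {D' : N →ₗ[ℂ] N}
    {hD' : ∀ k, g' k ≤ (g' (k + 1)).comap D'} {hDD' : ∀ x, D' (D' x) = 0}
    (e : M ≃ₗ[ℂ] N) (he : ∀ k, g k ≤ (g' k).comap e.toLinearMap)
    -- The gradings are mere families of subspaces, not assumed to be direct decompositions, so the
    -- inverse of a degree-preserving equivalence need not preserve degrees by itself.
    (he' : ∀ k, g' k ≤ (g k).comap e.symm.toLinearMap) (hc : ∀ x, e (D x) = D' (e x)) :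
    gradedComplex g D hD hDD ≅ gradedComplex g' D' hD' hDD' where
  hom := gradedHom e.toLinearMap he hc
  inv := gradedHom e.symm.toLinearMap he' fun x => by
    have := hc (e.symm x)
    rw [e.apply_symm_apply] at this
    exact e.symm_apply_eq.2 this.symm
  hom_inv_id := by
    refine HomologicalComplex.Hom.ext (funext fun k => ?_)
    refine (ModuleCat.ofHom_comp _ _).symm.trans ?_
    exact congrArg ModuleCat.ofHom (LinearMap.ext fun x => Subtype.ext (e.symm_apply_apply (x : M)))
  inv_hom_id := by
    refine HomologicalComplex.Hom.ext (funext fun k => ?_)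
    refine (ModuleCat.ofHom_comp _ _).symm.trans ?_
    exact congrArg ModuleCat.ofHom (LinearMap.ext fun x => Subtype.ext (e.apply_symm_apply (x : N)))

/-- Serves the two squares of the final isomorphism, $N$ against $d$ and $t-1$ against $b$:
commutation of maps of complexes is reduced to an identity between elements. -/
theorem gradedHom_square {M N M' N' : Type u} [AddCommGroup M] [Module ℂ M] [AddCommGroup N]
    [Module ℂ N] [AddCommGroup M'] [Module ℂ M'] [AddCommGroup N'] [Module ℂ N']
    {gM : ℤ → Submodule ℂ M} {DM : M →ₗ[ℂ] M} {hM : ∀ k, gM k ≤ (gM (k + 1)).comap DM}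
    {hMM : ∀ x, DM (DM x) = 0}
    {gN : ℤ → Submodule ℂ N} {DN : N →ₗ[ℂ] N} {hN : ∀ k, gN k ≤ (gN (k + 1)).comap DN}
    {hNN : ∀ x, DN (DN x) = 0}
    {gM' : ℤ → Submodule ℂ M'} {DM' : M' →ₗ[ℂ] M'} {hM' : ∀ k, gM' k ≤ (gM' (k + 1)).comap DM'}
    {hMM' : ∀ x, DM' (DM' x) = 0}
    {gN' : ℤ → Submodule ℂ N'} {DN' : N' →ₗ[ℂ] N'} {hN' : ∀ k, gN' k ≤ (gN' (k + 1)).comap DN'}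
    {hNN' : ∀ x, DN' (DN' x) = 0}
    (f : M →ₗ[ℂ] N) (hf : ∀ k, gM k ≤ (gN k).comap f) (hfc : ∀ x, f (DM x) = DN (f x))
    (f' : M' →ₗ[ℂ] N') (hf' : ∀ k, gM' k ≤ (gN' k).comap f') (hfc' : ∀ x, f' (DM' x) = DN' (f' x))
    (a : M →ₗ[ℂ] M') (ha : ∀ k, gM k ≤ (gM' k).comap a) (hac : ∀ x, a (DM x) = DM' (a x))
    (c : N →ₗ[ℂ] N') (hcg : ∀ k, gN k ≤ (gN' k).comap c) (hcc : ∀ x, c (DN x) = DN' (c x))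
    (h : ∀ x, f' (a x) = c (f x)) :
    (gradedHom a ha hac : gradedComplex gM DM hM hMM ⟶ gradedComplex gM' DM' hM' hMM') ≫
      (gradedHom f' hf' hfc' : _ ⟶ gradedComplex gN' DN' hN' hNN') =
    (gradedHom f hf hfc : _ ⟶ gradedComplex gN DN hN hNN) ≫ gradedHom c hcg hcc := by
  refine HomologicalComplex.Hom.ext (funext fun k => ?_)
  refine (ModuleCat.ofHom_comp _ _).symm.trans (Eq.trans ?_ (ModuleCat.ofHom_comp _ _))
  exact congrArg ModuleCat.ofHom (LinearMap.ext fun x => Subtype.ext (h (x : M)))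

/-- An isomorphism of super-complexes, from isomorphisms of the even and odd parts. -/
noncomputable def superIso {C : Type*} [Category* C] [Limits.HasZeroMorphisms C] {E O E' O' : C}
    {d : E ⟶ O} {b : O ⟶ E} {hdb : d ≫ b = 0} {hbd : b ≫ d = 0}
    {d' : E' ⟶ O'} {b' : O' ⟶ E'} {hdb' : d' ≫ b' = 0} {hbd' : b' ≫ d' = 0}
    (eE : E ≅ E') (eO : O ≅ O') (hd : eE.hom ≫ d' = d ≫ eO.hom) (hb : eO.hom ≫ b' = b ≫ eE.hom) :
    superComplex d b hdb hbd ≅ superComplex d' b' hdb' hbd' :=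
  HomologicalComplex.Hom.isoOfComponents
    (fun (i : Fin 2) => match i with
      | 0 => eE
      | 1 => eO)
    (fun (i j : Fin 2) _ => by
      fin_cases i <;> fin_cases j
      -- Between equal parities both differentials are zero by construction, so only the cases
      -- $0\to1$ and $1\to0$ use the hypotheses.
      · exact Limits.comp_zero.trans Limits.zero_comp.symm
      · exact hd
      · exact hb
      · exact Limits.comp_zero.trans Limits.zero_comp.symm)

/-- Isomorphic super-complexes have isomorphic periodic complexes. -/
noncomputable def periodicIso {C : Type*} [Category* C] [Limits.HasZeroMorphisms C]
    {K L : HomologicalComplex C (ComplexShape.up (ZMod 2))} (e : K ≅ L) :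
    periodicComplex K ≅ periodicComplex L :=
  HomologicalComplex.Hom.isoOfComponents
    (fun p => HomologicalComplex.Hom.isoApp e (p : ZMod 2))
    (fun i j h => by
      change i + 1 = j at h
      simp [periodicComplex, h])

/-! ### The twisted antipode on forms, modulo coinvariants. -/

namespace HDGAlgebra

variable {H A : Type u} [Ring H] [HopfAlgebra ℂ H] [Ring A] [Algebra ℂ A] [HDGAlgebra H A]

theorem actR_mul (g h : H) (z : nonunital H A) :
    actR H A (g * h) z = actR H A g (actR H A h z) := by
  ext; simp

theorem actR_one (z : nonunital H A) : actR H A 1 z = z := by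
  ext; simp

open Coalgebra in
-- The computation is $\sum h_0(x)\otimes h_1S(h_2)(z)=\sum h_0(x)\otimes\epsilon(h_1)z=h(x)\otimes
-- z$. It is the tensor counterpart of `act_mul_antipode`, with $\otimes$ in place of the product.
theorem formAct_antipode {ι : Type*} {h : H} (r : Coalgebra.Repr ℂ h ι) (x : A)
    (z : nonunital H A) :
    ∑ i ∈ r.index, formAct H A (r.left i)
      (x ⊗ₜ actR H A (HopfAlgebra.antipode ℂ (r.right i)) z) = act h x ⊗ₜ z := by
  let fx : H →ₗ[ℂ] A := (act (H := H) (A := A)).toLinearMap.flip x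
  let fz : H →ₗ[ℂ] nonunital H A := (actR H A).flip z
  have e1 : ∀ g, fx g = act g x := fun g => rfl
  have e2 : ∀ g, fz g = actR H A g z := fun g => rfl
  -- Coassociativity, evaluated through $a\otimes b\otimes c\mapsto a(x)\otimes bS(c)(z)$.
  have key := congrArg (TensorProduct.map fx (fz ∘ₗ LinearMap.mul' ℂ H ∘ₗ
      LinearMap.lTensor H (HopfAlgebra.antipode ℂ)))
    (sum_tmul_tmul_eq r (fun i => ℛ ℂ (r.left i)) (fun i => ℛ ℂ (r.right i)))
  simp only [map_sum, LinearMap.comp_apply, TensorProduct.map_tmul, LinearMap.lTensor_tmul,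
    LinearMap.mul'_apply, e1, e2, actR_mul] at key
  simp only [formAct_tmul (ℛ ℂ (r.left _)), key]
  -- The antipode axiom $\sum h_1S(h_2)=\epsilon(h)$ collapses the inner sum; the scalar is then
  -- moved to the left factor.
  have e3 : ∀ i, ∑ j ∈ (ℛ ℂ (r.right i)).index, act (r.left i) x ⊗ₜ[ℂ]
      actR H A ((ℛ ℂ (r.right i)).left j)
        (actR H A (HopfAlgebra.antipode ℂ ((ℛ ℂ (r.right i)).right j)) z)
      = (counit (R := ℂ) (r.right i) • act (r.left i) x) ⊗ₜ[ℂ] z := fun i => by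
    have := congrArg (fun g => act (r.left i) x ⊗ₜ[ℂ] actR H A g z)
      (HopfAlgebra.sum_mul_antipode_eq_smul (ℛ ℂ (r.right i)))
    simp only [map_sum, LinearMap.sum_apply, TensorProduct.tmul_sum, actR_mul,
      map_smul, LinearMap.smul_apply, actR_one] at this
    rw [this, TensorProduct.smul_tmul]
  simp only [e3, ← TensorProduct.sum_tmul]
  -- The counit axiom $\sum\epsilon(h_1)h_0=h$.
  have e4 := congrArg (fun g => act g x) (congrArg (TensorProduct.rid ℂ H) (sum_tmul_counit_eq r))
  simp only [map_sum, TensorProduct.rid_tmul, LinearMap.sum_apply, map_smul, LinearMap.smul_apply,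
    one_smul] at e4
  rw [e4]

open Coalgebra in
/-- Modulo coinvariants, `h(x) dz ≡ x d(S_δ(h)(z))`. -/
theorem act_tmul_sub_mem (δ : H →ₐ[ℂ] ℂ) (h : H) (x : A) (z : nonunital H A) :
    act h x ⊗ₜ z - x ⊗ₜ actR H A (twistedAntipode δ h) z ∈ coinvForm H A δ := by
  have e : x ⊗ₜ[ℂ] actR H A (twistedAntipode δ h) z = ∑ i ∈ (ℛ ℂ h).index,
      δ ((ℛ ℂ h).left i) • (x ⊗ₜ actR H A (HopfAlgebra.antipode ℂ ((ℛ ℂ h).right i)) z) := by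
    rw [twistedAntipode_repr δ (ℛ ℂ h)]
    simp [TensorProduct.tmul_sum]
  rw [← formAct_antipode (ℛ ℂ h), e, ← Finset.sum_sub_distrib]
  -- Each summand is $h_0(m)-\delta(h_0)m$ with $m=x\otimes S(h_1)(z)$, a defining element of the
  -- coinvariants.
  exact sum_mem fun i _ => Submodule.subset_span ⟨_, _, rfl⟩

/-- If `S_δ² = id` then, modulo coinvariants, `∑ h₁(x) d(h₀(z)) ≡ δ(h) x dz`. -/
theorem act_tmul_swap_sub_mem (δ : H →ₐ[ℂ] ℂ)
    (hδ : twistedAntipode δ ∘ₗ twistedAntipode δ = LinearMap.id) {ι : Type*} {h : H}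
    (r : Coalgebra.Repr ℂ h ι) (x : A) (z : nonunital H A) :
    ∑ i ∈ r.index, act (r.right i) x ⊗ₜ actR H A (r.left i) z - δ h • (x ⊗ₜ[ℂ] z)
      ∈ coinvForm H A δ := by
  -- Here $S_\delta^2=\mathrm{Id}$ is used: it gives $\sum S_\delta(h_1)h_0=\delta(h)1$, with the
  -- two legs of the coproduct in the reversed order.
  have e : δ h • (x ⊗ₜ[ℂ] z) = ∑ i ∈ r.index,
      x ⊗ₜ actR H A (twistedAntipode δ (r.right i)) (actR H A (r.left i) z) := by
    have := congrArg (fun g => x ⊗ₜ[ℂ] actR H A g z) (sum_twistedAntipode_mul' δ hδ r)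
    simp only [map_sum, LinearMap.sum_apply, TensorProduct.tmul_sum, actR_mul,
      map_smul, LinearMap.smul_apply, actR_one, TensorProduct.tmul_smul] at this
    exact this.symm
  rw [e, ← Finset.sum_sub_distrib]
  exact sum_mem fun i _ => act_tmul_sub_mem δ _ _ _

end HDGAlgebra

/-! ### Generators of the Weil algebra and forms modulo commutators. -/

namespace Weil

variable {H : Type u} [Ring H] [HopfAlgebra ℂ H]

theorem sgn_eq_sign (x : WeilTilde H) : sgn H (WeilTilde H) x = sign x := by
  refine hom_induction (H := H) (fun k x hx => ?_) (fun x y hx hy => ?_) x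
  · rw [sgn_of_mem hx, sign_of_mem hx]
  · rw [map_add, map_add, hx, hy]

variable (H) in
/-- The generator `i(h)`, as an element of `W(H)`. -/
noncomputable def genR : H →ₗ[ℂ] nonunital H (WeilTilde H) :=
  gen.codRestrict _ fun h => wAug_gen h

variable (H) in
/-- The generator `ω_h`, as an element of `W(H)`. -/
noncomputable def curvR : H →ₗ[ℂ] nonunital H (WeilTilde H) :=
  curv.codRestrict _ fun h => wAug_curv h

@[simp] theorem coe_genR (h : H) : (genR H h : WeilTilde H) = gen h := rfl

@[simp] theorem coe_curvR (h : H) : (curvR H h : WeilTilde H) = curv h := rfl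

theorem actR_genR (g h : H) : actR H (WeilTilde H) g (genR H h) = genR H (g * h) :=
  Subtype.ext (actLin_gen g h)

theorem actR_curvR (g h : H) : actR H (WeilTilde H) g (curvR H h) = curvR H (g * h) :=
  Subtype.ext (actLin_curv g h)

theorem projR_one : projR (H := H) (1 : WeilTilde H) = 0 := by
  ext; simp [coe_projR]

/-- The second tensor factor of a form must lie in $W$, whereas the tail $y$ of a word may be the
unit. Replacing $y$ by its projection costs the term with the augmentation, which is what remains
for a word of one letter. -/
theorem projR_gen_mul (h : H) (y : WeilTilde H) : projR (H := H) (gen h * y) =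
    mulRightR H _ (projR y) (genR H h) + aug H y • genR H h := by
  have h0 : aug H (gen h) = 0 := wAug_gen h
  ext
  simp [coe_projR, h0, mul_sub]

theorem projR_curv_mul (h : H) (y : WeilTilde H) : projR (H := H) (curv h * y) =
    mulRightR H _ (projR y) (curvR H h) + aug H y • curvR H h := by
  have h0 : aug H (curv h) = 0 := wAug_curv h
  ext
  simp [coe_projR, h0, mul_sub]

/-- A linear map on `Ω¹(W(H))` that vanishes on graded commutators and on the forms `x di(h)`,
`x dω_h` is zero. -/
theorem form_eq_zero {M : Type*} [AddCommGroup M] [Module ℂ M]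
    (f : Omega1 H (WeilTilde H) →ₗ[ℂ] M) (hf : formComm H (WeilTilde H) ≤ LinearMap.ker f)
    (hg : ∀ x h, f (x ⊗ₜ genR H h) = 0) (hc : ∀ x h, f (x ⊗ₜ curvR H h) = 0) : f = 0 := by
  -- The Leibniz rule modulo commutators: $x\,d(aw)\equiv xa\,dw\pm wx\,da$. If `f` vanishes on all
  -- forms ending in $da$ and on all forms ending in $dw$, it vanishes on all forms ending in
  -- $d(aw)$. The coefficient has to stay arbitrary because both terms change it.
  have step : ∀ (w : List (H ⊕ H)) (j : ℤ) (a : nonunital H (WeilTilde H)),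
      (a : WeilTilde H) ∈ gr H j → (∀ x, f (x ⊗ₜ a) = 0) →
      (∀ x, f (x ⊗ₜ projR (word w)) = 0) → ∀ x, f (x ⊗ₜ mulRightR H _ (projR (word w)) a) = 0 := by
    intro w j a ha h1 h2 x
    refine hom_induction (H := H) (fun k x hx => ?_) (fun x y hx hy => ?_) x
    · have := hf (comm_mem hx ha (projR_mem (H := H) (word_mem w)))
      rw [LinearMap.mem_ker, map_sub, map_sub, map_smul, h1, h2] at this
      simpa using this
    · rw [TensorProduct.add_tmul, map_add, hx, hy, add_zero]
  have key : ∀ w x, f (x ⊗ₜ projR (word w)) = 0 := by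
    intro w
    induction w with
    | nil => intro x; rw [word_nil, projR_one, TensorProduct.tmul_zero, map_zero]
    | cons a w ih =>
      intro x
      rcases a with h | h
      · rw [word_inl, projR_gen_mul, TensorProduct.tmul_add, map_add, TensorProduct.tmul_smul,
          map_smul, hg, step w 1 _ (gen_mem h) (fun x => hg x h) ih, smul_zero, add_zero]
      · rw [word_inr, projR_curv_mul, TensorProduct.tmul_add, map_add, TensorProduct.tmul_smul,
          map_smul, hc, step w 2 _ (curv_mem h) (fun x => hc x h) ih, smul_zero, add_zero]
  refine TensorProduct.ext' fun x z => ?_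
  -- Words span $\tilde W$, not $W$; composing with the projection, which fixes the elements of $W$,
  -- carries the result over.
  have : f ∘ₗ TensorProduct.mk ℂ _ _ x ∘ₗ projR (H := H) = 0 := lin_ext fun w => key w x
  have h2 := LinearMap.congr_fun this (z : WeilTilde H)
  rw [LinearMap.comp_apply, LinearMap.comp_apply, projR_coe] at h2
  exact h2

/-! ### The mutually inverse maps between words and forms. -/

/-- The map `W̃(H) → Ω¹(W(H))` with `1 ↦ 0` and `a x ↦ (-1)^{|a||x|} x da` for a generator `a`. -/
noncomputable def toForm : WeilTilde H →ₗ[ℂ] Omega1 H (WeilTilde H) :=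
  TensorProduct.lift
    (((TensorProduct.mk ℂ (WeilTilde H) (nonunital H (WeilTilde H))).flip ∘ₗ
        genR H ∘ₗ LinearMap.fst ℂ H H).compl₂ sign.toLinearMap +
      (TensorProduct.mk ℂ (WeilTilde H) (nonunital H (WeilTilde H))).flip ∘ₗ
        curvR H ∘ₗ LinearMap.snd ℂ H H) ∘ₗ split

@[simp] theorem toForm_one : toForm (1 : WeilTilde H) = 0 := by simp [toForm, split_one]

@[simp] theorem toForm_gen (h : H) (x : WeilTilde H) :
    toForm (gen h * x) = sign x ⊗ₜ genR H h := by
  have : split (gen h * x) = (h, 0) ⊗ₜ x := split_ι_mul (h, 0) x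
  simp [toForm, this]

@[simp] theorem toForm_curv (h : H) (x : WeilTilde H) :
    toForm (curv h * x) = x ⊗ₜ curvR H h := by
  have : split (curv h * x) = (0, h) ⊗ₜ x := split_ι_mul (0, h) x
  simp [toForm, this]

/-- The bilinear map `(z, x) ↦ ∑_{i<p} t^i((-1)^{|x||z|} z x)` for `z` of length `p`. -/
noncomputable def rotSum : WeilTilde H →ₗ[ℂ] WeilTilde H →ₗ[ℂ] WeilTilde H :=
  DirectSum.toModule ℂ ℕ (WeilTilde H →ₗ[ℂ] WeilTilde H)
      (fun p => (signedOp H (WeilTilde H)).flip.compr₂ (∑ i ∈ Finset.range p, tOp ^ i) ∘ₗ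
        (lenPart H p).subtype) ∘ₗ
    (DirectSum.decomposeLinearEquiv (lenPart H)).toLinearMap

theorem rotSum_of_mem {p : ℕ} {z : WeilTilde H} (hz : z ∈ lenPart H p) (x : WeilTilde H) :
    rotSum z x = ∑ i ∈ Finset.range p, (tOp ^ i) (signedOp H (WeilTilde H) x z) := by
  simp only [rotSum, LinearMap.comp_apply, LinearEquiv.coe_coe,
    DirectSum.decomposeLinearEquiv_apply]
  rw [DirectSum.decompose_of_mem (lenPart H) hz, ← DirectSum.lof_eq_of ℂ, DirectSum.toModule_lof]
  simp

/-- The map `Ω¹(W(H)) → W̃(H)` with `x dz ↦ ∑_{i<p} t^i((-1)^{|x||z|} z x)` for `z` of length `p`. -/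
noncomputable def ofForm : Omega1 H (WeilTilde H) →ₗ[ℂ] WeilTilde H :=
  TensorProduct.lift (rotSum.flip.compl₂ (nonunital H (WeilTilde H)).subtype)

@[simp] theorem ofForm_tmul (x : WeilTilde H) (z : nonunital H (WeilTilde H)) :
    ofForm (x ⊗ₜ z) = rotSum (z : WeilTilde H) x := rfl

theorem signedOp_gen (x : WeilTilde H) (h : H) :
    signedOp H (WeilTilde H) x (gen h) = gen h * sign x := by
  refine hom_induction (H := H) (fun k x hx => ?_) (fun x y hx hy => ?_) x
  · rw [signedOp_of_mem hx (gen_mem h), sign_of_mem hx, mul_one, mul_smul_comm]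
  · simp only [map_add, LinearMap.add_apply, hx, hy, mul_add]

theorem signedOp_curv (x : WeilTilde H) (h : H) :
    signedOp H (WeilTilde H) x (curv h) = curv h * x := by
  refine hom_induction (H := H) (fun k x hx => ?_) (fun x y hx hy => ?_) x
  · rw [signedOp_of_mem hx (curv_mem h), mul_comm k, koszulSign_two_mul, one_smul]
  · simp only [map_add, LinearMap.add_apply, hx, hy, mul_add]

/-- A generator has length one, so only the unrotated term is left. This makes `ofForm` an exact
inverse of `toForm` on forms $x\,da$. -/
theorem rotSum_gen (x : WeilTilde H) (h : H) : rotSum (gen h) x = gen h * sign x := by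
  simp [rotSum_of_mem (gen_len h), signedOp_gen]

theorem rotSum_curv (x : WeilTilde H) (h : H) : rotSum (curv h) x = curv h * x := by
  simp [rotSum_of_mem (curv_len h), signedOp_curv]

/-- With coefficient $1$ the partial cyclic sum is the complete one. This is where the norm operator
meets the universal derivation, since $dz=1\otimes z$. -/
theorem rotSum_one_right (z : WeilTilde H) : rotSum z 1 = nOp z := by
  have : rotSum.flip 1 = nOp (H := H) := lin_ext fun w => by
    have h1 : signedOp H (WeilTilde H) 1 (word w) = word w := by
      rw [signedOp_of_mem one_mem (word_mem w), zero_mul, koszulSign_zero, one_smul, mul_one]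
    rw [LinearMap.flip_apply, rotSum_of_mem (word_len w), nOp_of_mem (word_len w), h1]
  exact LinearMap.congr_fun this z

/-- The word $zrx$ is rotated once for each letter of $zr$. While the letters of $z$ are moved, the
rotations are those of $z$ followed by $rx$. Once $z$ has passed to the end, the word is $\pm rxz$
and the other rotations are those of $r$ followed by $xz$. The identity says exactly that `ofForm`
kills the commutator of $x\,dz$ with $r$. -/
theorem rotSum_mul {i j k : ℤ} {x z r : WeilTilde H} (hx : x ∈ wGr i) (hz : z ∈ wGr j)
    (hr : r ∈ wGr k) :
    rotSum (z * r) x = rotSum r (x * z) + koszulSign ((i + j) * k) • rotSum z (r * x) := by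
  induction hz using Submodule.span_induction with
  | zero => simp
  | add y z _ _ hy hz => simp only [add_mul, mul_add, map_add, LinearMap.add_apply, hy, hz]; module
  | smul c z _ hz =>
    simp only [smul_mul_assoc, mul_smul_comm, map_smul, LinearMap.smul_apply, hz]; module
  | mem z h =>
    obtain ⟨w, rfl, rfl⟩ := h
    induction hr using Submodule.span_induction with
    | zero => simp
    | add y z _ _ hy hz =>
      simp only [add_mul, mul_add, map_add, LinearMap.add_apply, hy, hz]; module
    | smul c z _ hz =>
      simp only [smul_mul_assoc, mul_smul_comm, map_smul, LinearMap.smul_apply, hz]; module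
    | mem r h =>
      obtain ⟨v, rfl, rfl⟩ := h
      have hw : word w ∈ gr H (weight w) := word_mem w
      have hv : word v ∈ gr H (weight v) := word_mem v
      rw [rotSum_of_mem (mul_len (word_len w) (word_len v)), rotSum_of_mem (word_len w),
        rotSum_of_mem (word_len v), signedOp_of_mem hx (HDGAlgebra.mul_mem hw hv),
        signedOp_of_mem (HDGAlgebra.mul_mem hx hw) hv, signedOp_of_mem (HDGAlgebra.mul_mem hv hx) hw,
        Finset.sum_range_add, add_comm, Finset.smul_sum]
      congr 1
      -- The rotations beyond the length of $z$: `tOp_rotate` carries all of $z$ past $rx$, and the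
      -- sign $(-1)^{|x||z|}$ occurs twice and cancels.
      · refine Finset.sum_congr rfl fun m _ => ?_
        rw [add_comm, pow_add, Module.End.mul_apply, map_smul (tOp ^ w.length), mul_assoc,
          tOp_rotate w (HDGAlgebra.mul_mem hv hx), smul_smul, mul_assoc]
        congr 2
        simp only [← koszulSign_add]
        have := koszulSign_two_mul (i * weight w)
        rw [show i * (weight w + weight v) + weight w * (weight v + i) =
          (i + weight w) * weight v + 2 * (i * weight w) by ring, koszulSign_add, this, mul_one]
      -- The rotations inside $z$; now the sign that occurs twice is $(-1)^{|z||r|}$.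
      · refine Finset.sum_congr rfl fun m _ => ?_
        rw [map_smul, map_smul, smul_smul, mul_assoc, ← koszulSign_add]
        congr 1
        have := koszulSign_two_mul (weight w * weight v)
        rw [show (i + weight w) * weight v + (weight v + i) * weight w =
          i * (weight w + weight v) + 2 * (weight w * weight v) by ring, koszulSign_add, this,
          mul_one]

theorem ofForm_comm : formComm H (WeilTilde H) ≤ LinearMap.ker ofForm := by
  refine (comm_le ofForm ⊥ fun {i j k x z r} hx hz hr => ?_)
  rw [Submodule.mem_bot, map_sub, map_sub, map_smul, ofForm_tmul, ofForm_tmul, ofForm_tmul,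
    coe_mulRightR, rotSum_mul hx hz hr]
  abel

/-- On $ax$ the two signs $(-1)^{|a||x|}$ cancel and the cyclic sum has a single term. Only the unit
is lost, as `toForm` sends it to zero, hence the projection. -/
theorem projR_ofForm_toForm (x : WeilTilde H) : projR (H := H) (ofForm (toForm x)) = projR x := by
  have : projR (H := H) ∘ₗ ofForm ∘ₗ toForm = projR (H := H) (A := WeilTilde H) := by
    refine left_ext ?_ (fun h y => ?_) (fun h y => ?_)
    · simp [projR_one]
    · simp [rotSum_gen]
    · simp [rotSum_curv]
  exact LinearMap.congr_fun this x

theorem toForm_projR (x : WeilTilde H) : toForm (projR (H := H) x : WeilTilde H) = toForm x := by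
  rw [coe_projR, map_sub, map_smul, toForm_one, smul_zero, sub_zero]

/-- By `form_eq_zero` it suffices to look at forms $x\,da$, where the composite is the identity on
the nose. The difference respects commutators because `ofForm` kills them and the identity preserves
them. -/
theorem toForm_ofForm_sub_mem (ω : Omega1 H (WeilTilde H)) :
    toForm (ofForm ω) - ω ∈ formComm H (WeilTilde H) := by
  have : (formComm H (WeilTilde H)).mkQ ∘ₗ (toForm ∘ₗ ofForm - LinearMap.id) = 0 := by
    refine form_eq_zero _ (fun ω hω => ?_) (fun x h => ?_) (fun x h => ?_)
    · have := LinearMap.mem_ker.1 (ofForm_comm hω)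
      rw [LinearMap.mem_ker, LinearMap.comp_apply, LinearMap.sub_apply, LinearMap.comp_apply, this]
      simpa using hω
    · simp [rotSum_gen]
    · simp [rotSum_curv]
  exact (Submodule.Quotient.mk_eq_zero _).1 (LinearMap.congr_fun this ω)

/-! ### Correspondence of the horizontal boundaries. -/

/-- Since `ofForm` sends $dz$ to $Nz$, applying `toForm` returns $dz$ up to commutators. -/
theorem toForm_nOp_sub_mem (x : nonunital H (WeilTilde H)) :
    toForm (nOp (x : WeilTilde H)) - univDer H (WeilTilde H) x ∈ formComm H (WeilTilde H) := by
  have := toForm_ofForm_sub_mem (univDer H (WeilTilde H) x)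
  rwa [univDer_apply, ofForm_tmul, rotSum_one_right] at this

/-- For a generator $a$, $(-1)^{|a||x|}[x,a]=(-1)^{|a||x|}xa-ax=t(ax)-ax$. The identity is exact,
with no passage to a quotient. The augmentation term corrects the value at the unit, where $t$ is
zero. -/
theorem formB_toForm (x : WeilTilde H) :
    (formB H (WeilTilde H) (toForm x) : WeilTilde H) = tOp x - (x - aug H x • 1) := by
  have : (nonunital H (WeilTilde H)).subtype ∘ₗ formB H (WeilTilde H) ∘ₗ toForm =
      tOp - (nonunital H (WeilTilde H)).subtype ∘ₗ projR (H := H) := by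
    refine left_ext ?_ (fun h y => ?_) (fun h y => ?_)
    · simp [projR_one]
    · have h0 : aug H (gen h) = 0 := wAug_gen h
      simp [coe_projR, h0, gcomm, signedOp_gen]
    · have h0 : aug H (curv h) = 0 := wAug_curv h
      simp [coe_projR, h0, gcomm, signedOp_curv]
  exact LinearMap.congr_fun this x

/-! ### Correspondence of the vertical boundaries. -/

/-- The Leibniz rule modulo commutators for a product of two letters: $y\,d(ac)\equiv ya\,dc\pm
cy\,da$. The second form comes from the word $acy$, the first from its rotation $\pm cya$. This
lemma and the next two, for the other pairs of letters that occur in $\partial_0$, explain the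
summand $b_t$ of $b$. Here $ac$ has even degree, so $y$ carries no sign. -/
theorem toForm_gen_gen (g h : H) (y : WeilTilde H) :
    toForm (gen g * gen h * y) + toForm (tOp (gen g * gen h * y)) -
      y ⊗ₜ mulRightR H _ (genR H h) (genR H g) ∈ formComm H (WeilTilde H) := by
  refine hom_induction (H := H) (fun k y hy => ?_) (fun x y hx hy => ?_) y
  · have hk := koszulSign_mul_self k
    convert neg_mem (comm_mem (z := genR H g) (r := genR H h) hy (gen_mem g) (gen_mem h)) using 1
    simp only [mul_assoc, toForm_gen, tOp_gen, map_mul, sign_gen, coe_genR, mul_one,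
      sign_of_mem hy, neg_mul, mul_neg, map_neg, koszulSign_add, koszulSign_one, neg_neg,
      TensorProduct.neg_tmul, mul_smul_comm, smul_mul_assoc, ← TensorProduct.smul_tmul', map_smul]
    simp only [smul_smul, hk]
    module
  · convert add_mem hx hy using 1
    simp only [mul_add, map_add, TensorProduct.add_tmul]; abel

/-- The product of the two letters has odd degree $3$, which puts the sign $(-1)^{|y|}$ on the
coefficient; the same holds in the next lemma. -/
theorem toForm_curv_gen (g h : H) (y : WeilTilde H) :
    toForm (curv g * gen h * y) + toForm (tOp (curv g * gen h * y)) -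
      sign y ⊗ₜ mulRightR H _ (genR H h) (curvR H g) ∈ formComm H (WeilTilde H) := by
  refine hom_induction (H := H) (fun k y hy => ?_) (fun x y hx hy => ?_) y
  · have hk := koszulSign_mul_self k
    have h2 : koszulSign 2 = 1 := by simpa using koszulSign_two_mul 1
    convert neg_mem (comm_mem (z := curvR H g) (r := genR H h) (sign_mem hy) (curv_mem g)
      (gen_mem h)) using 1
    simp only [mul_assoc, toForm_gen, toForm_curv, tOp_curv, map_mul, sign_curv,
      coe_genR, coe_curvR, mul_one, sign_of_mem hy, koszulSign_add, h2,
      mul_smul_comm, smul_mul_assoc, ← TensorProduct.smul_tmul']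
    simp only [smul_smul, hk]
    module
  · convert add_mem hx hy using 1
    simp only [mul_add, map_add, TensorProduct.add_tmul]; abel

theorem toForm_gen_curv (g h : H) (y : WeilTilde H) :
    toForm (gen g * curv h * y) + toForm (tOp (gen g * curv h * y)) -
      sign y ⊗ₜ mulRightR H _ (curvR H h) (genR H g) ∈ formComm H (WeilTilde H) := by
  refine hom_induction (H := H) (fun k y hy => ?_) (fun x y hx hy => ?_) y
  · convert neg_mem (comm_mem (z := genR H g) (r := curvR H h) (sign_mem hy) (gen_mem g)
      (curv_mem h)) using 1
    simp only [mul_assoc, toForm_gen, toForm_curv, tOp_gen, map_mul, sign_curv,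
      coe_genR, coe_curvR, mul_comm _ (2 : ℤ), koszulSign_two_mul, one_smul]
    abel
  · convert add_mem hx hy using 1
    simp only [mul_add, map_add, TensorProduct.add_tmul]; abel

open Coalgebra in
-- The quadratic part is written as a sum of products of elements of $W$, so that it can stand
-- behind a $d$ and match the two-letter lemmas term by term.
theorem bdR_genR (h : H) : bdR H (WeilTilde H) (genR H h) =
    curvR H h - ∑ i ∈ (ℛ ℂ h).index, mulRightR H _ (genR H ((ℛ ℂ h).right i))
      (genR H ((ℛ ℂ h).left i)) := by
  ext
  change wBd (gen h) = _
  simp [wBd, conv_repr (ℛ ℂ h)]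
  abel

open Coalgebra in
theorem bdR_curvR (h : H) : bdR H (WeilTilde H) (curvR H h) =
    ∑ i ∈ (ℛ ℂ h).index, (mulRightR H _ (genR H ((ℛ ℂ h).right i)) (curvR H ((ℛ ℂ h).left i)) -
      mulRightR H _ (curvR H ((ℛ ℂ h).right i)) (genR H ((ℛ ℂ h).left i))) := by
  ext
  change wBd (curv h) = _
  simp [wBd, conv_repr (ℛ ℂ h)]

open Coalgebra in
-- On $ax$ the terms pair off. The word $\pm a\,\partial x$ gives the form with $\partial x\,da$,
-- and $d(a)x$ gives the form with $x\,d(da)$. The form with $x\,d(\partial_0a)$ needs both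
-- $\partial_0(a)x$ and $b_t(ax)=t(\partial_0(a)x)$. Only this last match requires commutators.
theorem toForm_bOp_sub_mem (x : WeilTilde H) :
    toForm (bOp x) - formBd H (WeilTilde H) (toForm x) ∈ formComm H (WeilTilde H) := by
  have : (formComm H (WeilTilde H)).mkQ ∘ₗ (toForm ∘ₗ bOp - formBd H (WeilTilde H) ∘ₗ toForm) =
      0 := by
    refine left_ext ?_ (fun h y => ?_) (fun h y => ?_)
    · simp [bOp_apply]
    · refine (Submodule.Quotient.mk_eq_zero _).2 ?_
      have e : wBd (gen h) = bd0 (gen h) + curv h := by simp [wBd]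
      have hb : bd H (sign y) = wBd (sign y) := rfl
      -- The sum runs over the coproduct of $h$; the negation is the sign in $\partial_0i(h)=-\sum
      -- i(h_0)i(h_1)$.
      convert neg_mem (sum_mem fun i (_ : i ∈ (ℛ ℂ h).index) =>
        toForm_gen_gen ((ℛ ℂ h).left i) ((ℛ ℂ h).right i) y) using 1
      rw [LinearMap.sub_apply, LinearMap.comp_apply, LinearMap.comp_apply, bOp_apply, wBd_mul, e,
        pOp_gen, bd0_gen, conv_repr (ℛ ℂ h), toForm_gen, formBd_tmul, bdR_genR, sgn_eq_sign,
        sign_sign, hb, sign_gen]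
      simp only [map_add, add_mul, neg_mul, map_neg, Finset.sum_mul, map_sum, toForm_curv,
        toForm_gen, sign_wBd, TensorProduct.tmul_sub, TensorProduct.tmul_sum,
        TensorProduct.neg_tmul, neg_neg, Finset.sum_sub_distrib, Finset.sum_add_distrib]
      abel
    · refine (Submodule.Quotient.mk_eq_zero _).2 ?_
      have e : wBd (curv h) = bd0 (curv h) := by simp [wBd]
      have hb : bd H y = wBd y := rfl
      -- The difference reflects the opposite signs of $\omega_{h_0}i(h_1)$ and $i(h_0)\omega_{h_1}$
      -- in $\partial_0\omega_h$.
      convert sum_mem fun i (_ : i ∈ (ℛ ℂ h).index) =>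
        sub_mem (toForm_curv_gen ((ℛ ℂ h).left i) ((ℛ ℂ h).right i) y)
          (toForm_gen_curv ((ℛ ℂ h).left i) ((ℛ ℂ h).right i) y) using 1
      rw [LinearMap.sub_apply, LinearMap.comp_apply, LinearMap.comp_apply, bOp_apply, wBd_mul, e,
        pOp_curv, bd0_curv, conv_repr (ℛ ℂ h), conv_repr (ℛ ℂ h), toForm_curv, formBd_tmul,
        bdR_curvR, sgn_eq_sign, hb, sign_curv]
      simp only [map_add, sub_mul, map_sub, Finset.sum_mul, map_sum, toForm_curv,
        TensorProduct.tmul_sub, TensorProduct.tmul_sum, Finset.sum_sub_distrib,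
        Finset.sum_add_distrib]
      abel
  exact (Submodule.Quotient.mk_eq_zero _).1 (LinearMap.congr_fun this x)

/-! ### Compatibility with the coinvariants. -/

/-- Moving the first letter behind the rest turns $\sum h_0(a)h_1(x)$ into $\pm\sum
h_1(x)\,d(h_0(a))$, with the legs of the coproduct in the order opposite to that of the diagonal
action. Lemma `act_tmul_swap_sub_mem` is made for this order. -/
theorem toForm_coinv (δ : H →ₐ[ℂ] ℂ)
    (hδ : twistedAntipode δ ∘ₗ twistedAntipode δ = LinearMap.id) :
    coinvA H (WeilTilde H) δ ≤ (coinvForm H (WeilTilde H) δ).comap toForm := by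
  refine Submodule.span_le.2 ?_
  rintro _ ⟨h, m, rfl⟩
  have : (coinvForm H (WeilTilde H) δ).mkQ ∘ₗ toForm ∘ₗ (actLin h - δ h • LinearMap.id) = 0 := by
    refine left_ext ?_ (fun g y => ?_) (fun g y => ?_)
    · simp [actLin_one]
    · refine (Submodule.Quotient.mk_eq_zero _).2 ?_
      convert act_tmul_swap_sub_mem δ hδ (Coalgebra.Repr.arbitrary ℂ h) (sign y) (genR H g) using 1
      simp [actLin_mul_repr (Coalgebra.Repr.arbitrary ℂ h), act_eq, actLin_sign, actR_genR]
    · refine (Submodule.Quotient.mk_eq_zero _).2 ?_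
      convert act_tmul_swap_sub_mem δ hδ (Coalgebra.Repr.arbitrary ℂ h) y (curvR H g) using 1
      simp [actLin_mul_repr (Coalgebra.Repr.arbitrary ℂ h), act_eq, actR_curvR]
  exact (Submodule.Quotient.mk_eq_zero (coinvForm H (WeilTilde H) δ)).1 (LinearMap.congr_fun this m)

theorem tOp_iterate_mem {S : Submodule ℂ (WeilTilde H)} (hS : ∀ x ∈ S, tOp x ∈ S) {x : WeilTilde H}
    (hx : x ∈ S) (i : ℕ) : (tOp ^ i) x ∈ S := by
  induction i with
  | zero => exact hx
  | succ i ih => rw [pow_succ', Module.End.mul_apply]; exact hS _ ih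

/-- The coefficient stands in front of $dz$ in a form but behind $z$ in the word, so the legs of the
coproduct are again reversed. Before rotation the difference $\sum h_1(z)h_0(x)-\delta(h)zx$ is
coinvariant by `act_swap_sub_mem`, and each rotation preserves coinvariants. -/
theorem rotSum_act (δ : H →ₐ[ℂ] ℂ)
    (hδ : twistedAntipode δ ∘ₗ twistedAntipode δ = LinearMap.id) {ι : Type*} {h : H}
    (r : Coalgebra.Repr ℂ h ι) (x z : WeilTilde H) :
    ∑ i ∈ r.index, rotSum (act (r.right i) z) (act (r.left i) x) - δ h • rotSum z x
      ∈ coinvA H (WeilTilde H) δ := by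
  refine word_induction (p := fun z => ∑ i ∈ r.index, rotSum (act (r.right i) z)
    (act (r.left i) x) - δ h • rotSum z x ∈ coinvA H (WeilTilde H) δ) (fun w => ?_) (fun y z hy hz => ?_) (fun c z hz => ?_) z
  · refine hom_induction (H := H) (fun k x hx => ?_) (fun x y hx hy => ?_) x
    -- The action preserves both length and degree, so all terms have the same number of rotations
    -- and the same sign, and these can be taken out of the sum over the coproduct.
    · have e : ∑ i ∈ r.index, rotSum (act (r.right i) (word w)) (act (r.left i) x) -
          δ h • rotSum (word w) x = ∑ m ∈ Finset.range w.length, koszulSign (k * weight w) •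
          (tOp ^ m) (∑ i ∈ r.index, act (r.right i) (word w) * act (r.left i) x -
            δ h • (word w * x)) := by
        have hw : word w ∈ gr H (weight w) := word_mem w
        simp only [rotSum_of_mem (word_len w), act_eq, rotSum_of_mem (actLin_len (word_len w) _)]
        simp only [← act_eq, signedOp_of_mem hx hw, signedOp_of_mem (act_mem _ hx) (act_mem _ hw)]
        rw [Finset.sum_comm, Finset.smul_sum, ← Finset.sum_sub_distrib]
        refine Finset.sum_congr rfl fun m _ => ?_
        simp only [map_sub, map_sum, map_smul, smul_sub, Finset.smul_sum]
        rw [smul_comm]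
      rw [e]
      exact sum_mem fun m _ => Submodule.smul_mem _ _ (tOp_iterate_mem (fun _ => @tOp_coinv H _ _ δ hδ _)
        (act_swap_sub_mem δ hδ r _ _) m)
    · convert add_mem hx hy using 1
      simp only [map_add, Finset.sum_add_distrib]; module
  · convert add_mem hy hz using 1
    simp only [map_add, LinearMap.add_apply, Finset.sum_add_distrib]; module
  · convert Submodule.smul_mem _ c hz using 1
    simp only [map_smul, LinearMap.smul_apply, ← Finset.smul_sum]; module

theorem ofForm_coinv (δ : H →ₐ[ℂ] ℂ)
    (hδ : twistedAntipode δ ∘ₗ twistedAntipode δ = LinearMap.id) :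
    coinvForm H (WeilTilde H) δ ≤ (coinvA H (WeilTilde H) δ).comap ofForm := by
  refine Submodule.span_le.2 ?_
  rintro _ ⟨h, ω, rfl⟩
  have : (coinvA H (WeilTilde H) δ).mkQ ∘ₗ ofForm ∘ₗ
      (formAct H (WeilTilde H) h - δ h • LinearMap.id) = 0 := by
    refine TensorProduct.ext' fun x z => (Submodule.Quotient.mk_eq_zero _).2 ?_
    convert rotSum_act δ hδ (Coalgebra.Repr.arbitrary ℂ h) x z using 1
    simp [formAct_tmul (Coalgebra.Repr.arbitrary ℂ h)]
  exact (Submodule.Quotient.mk_eq_zero (coinvA H (WeilTilde H) δ)).1 (LinearMap.congr_fun this ω)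

/-! ### Compatibility with the powers of the ideal and with the gradings. -/

/-- Rotation only permutes letters, so the number of $\omega$'s in $zx$ is the same in all its
rotations. -/
theorem rotSum_pow {a b : ℕ} {x z : WeilTilde H} (hx : x ∈ (weilIdeal H).pow a)
    (hz : z ∈ (weilIdeal H).pow b) : rotSum z x ∈ (weilIdeal H).pow (b + a) := by
  refine pow_of_words (f := rotSum.flip x) (fun w hw => ?_) hz
  refine ((weilIdeal H).pow_isHom a).induction (p := fun x => rotSum.flip x (word w) ∈ _)
    (fun k x hx hk => ?_) (fun x y hx hy => ?_) hx
  · rw [LinearMap.flip_apply, rotSum_of_mem (word_len w), signedOp_of_mem hk (word_mem w)]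
    exact sum_mem fun i _ => tOp_iterate_mem (fun _ => tOp_pow)
      (Submodule.smul_mem _ _ ((weilIdeal H).pow_mul_pow _ _ (word_pow hw) hx)) i
  · rw [map_add]; exact add_mem hx hy

theorem rotSum_gr {i j : ℤ} {x z : WeilTilde H} (hx : x ∈ wGr i) (hz : z ∈ wGr j) :
    rotSum z x ∈ wGr (i + j) := by
  refine gr_of_words (f := rotSum.flip x) (fun w hw => ?_) hz
  subst hw
  have hw : word w ∈ gr H (weight w) := word_mem w
  rw [LinearMap.flip_apply, rotSum_of_mem (word_len w), signedOp_of_mem hx hw, add_comm i]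
  exact sum_mem fun i _ => tOp_iterate_mem (fun _ => tOp_mem)
    (Submodule.smul_mem _ _ (wGr_mul hw hx)) i

theorem ofForm_gr (k : ℤ) : formGr H (WeilTilde H) k ≤ (wGr k).comap ofForm := by
  refine Submodule.span_le.2 ?_
  rintro _ ⟨i, j, x, z, hx, hz, rfl, rfl⟩
  exact rotSum_gr hx hz

theorem toForm_gr (k : ℤ) : wGr k ≤ (formGr H (WeilTilde H) k).comap toForm := by
  refine Submodule.span_le.2 ?_
  rintro _ ⟨w, rfl, rfl⟩
  rcases w with _ | ⟨h | h, w⟩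
  · simp
  · exact Submodule.subset_span ⟨weight w, 1, _, _, sign_mem (word_mem w), gen_mem h,
      by rw [weight_inl, add_comm], by rw [word_inl, toForm_gen]⟩
  · exact Submodule.subset_span ⟨weight w, 2, _, _, word_mem w, curv_mem h,
      by rw [weight_inr, add_comm], by rw [word_inr, toForm_curv]⟩

theorem ofForm_formPow (n : ℕ) :
    (weilIdeal H).formPow n ≤ ((weilIdeal H).pow (n + 1)).comap ofForm := by
  refine sup_le (Submodule.span_le.2 ?_) (Submodule.span_le.2 ?_)
  · rintro _ ⟨x, z, hx, rfl⟩
    -- No condition on $z$ is available for $I^{n+1}dW$, so it is taken in $I^0=\tilde W$.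
    have : (z : WeilTilde H) ∈ (weilIdeal H).pow 0 := trivial
    simpa using rotSum_pow hx this
  · rintro _ ⟨x, z, hx, hz, rfl⟩
    -- For $I^ndI$ the factor $z\in I=I^1$ supplies the missing power.
    rw [← (weilIdeal H).pow_one] at hz
    have := rotSum_pow hx hz
    rwa [add_comm] at this

/-- A word with at least $n+1$ letters $\omega$ that begins with $i(h)$ keeps them all in the
coefficient and lands in $I^{n+1}dW$. If it begins with $\omega_h$, one of them goes behind the $d$
and the form lies in $I^ndI$. The two summands of `formPow` are these two cases. -/
theorem toForm_pow (n : ℕ) :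
    (weilIdeal H).pow (n + 1) ≤ ((weilIdeal H).formPow n).comap toForm := by
  rw [pow_eq_span]
  refine Submodule.span_le.2 ?_
  rintro _ ⟨w, hw, rfl⟩
  rw [SetLike.mem_coe, Submodule.mem_comap]
  rcases w with _ | ⟨h | h, w⟩
  · simp
  · rw [word_inl, toForm_gen]
    refine Submodule.mem_sup_left (Submodule.subset_span ⟨_, _, ?_, rfl⟩)
    rw [sign_word]
    exact Submodule.smul_mem _ _ (word_pow (by simpa using hw))
  · rw [word_inr, toForm_curv]
    exact Submodule.mem_sup_right (Submodule.subset_span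
      ⟨_, curvR H h, word_pow (by simpa using hw), curv_mem_ideal h, rfl⟩)

theorem coe_coinvR (δ : H →ₐ[ℂ] ℂ) :
    coinvR H (WeilTilde H) δ ≤
      (coinvA H (WeilTilde H) δ).comap (nonunital H (WeilTilde H)).subtype :=
  coinv_le δ (ρ' := fun h => (act h : WeilTilde H →ₗ[ℂ] WeilTilde H)) _ fun _ _ => rfl

/-! ### Passage to the quotients. -/

/-- The columns $(W_n)_\delta$ and $(W_n^b)_\delta$ have the same underlying space, so the relation
subspace of the even part is also the one to be compared with the odd relations on forms. -/
theorem toForm_evenRel (δ : H →ₐ[ℂ] ℂ)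
    (hδ : twistedAntipode δ ∘ₗ twistedAntipode δ = LinearMap.id) (n : ℕ) :
    (weilIdeal H).evenRel δ n ≤
      ((weilIdeal H).oddRel δ n).comap (toForm ∘ₗ (nonunital H (WeilTilde H)).subtype) :=
  sup_le (fun _ hx => Submodule.mem_sup_right (toForm_pow n hx)) fun _ hx =>
    Submodule.mem_sup_left (Submodule.mem_sup_right (toForm_coinv δ hδ (coe_coinvR δ hx)))

theorem ofForm_oddRel (δ : H →ₐ[ℂ] ℂ)
    (hδ : twistedAntipode δ ∘ₗ twistedAntipode δ = LinearMap.id) (n : ℕ) :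
    (weilIdeal H).oddRel δ n ≤ ((weilIdeal H).evenRel δ n).comap (projR (H := H) ∘ₗ ofForm) := by
  refine sup_le (sup_le (fun ω hω => ?_) fun ω hω => ?_) fun ω hω => ?_
  · have : ofForm ω = 0 := ofForm_comm hω
    rw [Submodule.mem_comap, LinearMap.comp_apply, this, map_zero]
    exact zero_mem _
  · exact Submodule.mem_sup_right (projR_coinv δ (ofForm_coinv δ hδ hω))
  · have h1 : ofForm ω ∈ (weilIdeal H).pow (n + 1) := ofForm_formPow n hω
    refine Submodule.mem_sup_left ?_
    change (projR (H := H) (ofForm ω) : WeilTilde H) ∈ (weilIdeal H).pow (n + 1)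
    -- Since $n+1\ge1$, the power $I^{n+1}$ lies in $W$, and the projection does not move its
    -- elements.
    have h2 : aug H (ofForm ω) = 0 := (weilIdeal H).pow_le n h1
    rwa [coe_projR, h2, zero_smul, sub_zero]

/-- `W_n(H)_δ ≅ Ω¹(W(H))_{♮,δ}`, modulo the relations of level `n`. -/
noncomputable def formEquiv {δ : H →ₐ[ℂ] ℂ}
    (hδ : twistedAntipode δ ∘ₗ twistedAntipode δ = LinearMap.id) (n : ℕ) :
    (nonunital H (WeilTilde H) ⧸ (weilIdeal H).evenRel δ n) ≃ₗ[ℂ]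
      (Omega1 H (WeilTilde H) ⧸ (weilIdeal H).oddRel δ n) :=
  LinearEquiv.ofLinearMap (Submodule.mapQ _ _ _ (toForm_evenRel δ hδ n))
    (Submodule.mapQ _ _ _ (ofForm_oddRel δ hδ n))
    (by
      refine Submodule.linearMap_qext _ (LinearMap.ext fun ω => ?_)
      refine (Submodule.Quotient.eq _).2 ?_
      change toForm (projR (H := H) (ofForm ω) : WeilTilde H) - ω ∈ _
      -- The projection removes a multiple of the unit, which `toForm` sends to zero anyway.
      rw [toForm_projR]
      exact Submodule.mem_sup_left (Submodule.mem_sup_left (toForm_ofForm_sub_mem ω)))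
    (by
      refine Submodule.linearMap_qext _ (LinearMap.ext fun x => ?_)
      refine congrArg (Submodule.mkQ _) ?_
      exact (projR_ofForm_toForm (x : WeilTilde H)).trans (projR_coe x))

/-- The quotient map $W\to W_n$ is equivariant and surjective. This puts the two successive
quotients in the shape required by the third isomorphism theorem. -/
theorem coinvariants_actWn (δ : H →ₐ[ℂ] ℂ) (n : ℕ) : coinvariants δ (actWn (H := H) n) =
    (coinvR H (WeilTilde H) δ).map ((weilIdeal H).powR n).mkQ := by
  refine le_antisymm (Submodule.span_le.2 ?_) (Submodule.map_le_iff_le_comap.2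
    (coinv_le δ (ρ' := actWn n) _ fun _ _ => rfl))
  rintro _ ⟨h, m, rfl⟩
  obtain ⟨m, rfl⟩ := Submodule.mkQ_surjective _ m
  exact ⟨_, Submodule.subset_span ⟨h, m, rfl⟩, rfl⟩

/-- `W_n(H)_δ` as a quotient of `W(H)`. -/
noncomputable def locEquiv (δ : H →ₐ[ℂ] ℂ) (n : ℕ) :
    WnLoc δ n ≃ₗ[ℂ] (nonunital H (WeilTilde H) ⧸ (weilIdeal H).evenRel δ n) :=
  (Submodule.quotEquivOfEq _ _ (coinvariants_actWn δ n)).trans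
    (Submodule.quotientQuotientEquivQuotientSup _ _)

theorem locEquiv_cls (δ : H →ₐ[ℂ] ℂ) (n : ℕ) (x : nonunital H (WeilTilde H)) :
    locEquiv δ n (cls δ n x) = Submodule.Quotient.mk x := rfl

theorem locEquiv_symm_mk (δ : H →ₐ[ℂ] ℂ) (n : ℕ) (x : nonunital H (WeilTilde H)) :
    (locEquiv δ n).symm (Submodule.Quotient.mk x) = cls δ n x := by
  rw [LinearEquiv.symm_apply_eq, locEquiv_cls]

theorem cls_mem_grLoc (δ : H →ₐ[ℂ] ℂ) (n : ℕ) {k : ℤ} {x : nonunital H (WeilTilde H)}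
    (hx : x ∈ grR H (WeilTilde H) k) : cls δ n x ∈ grLoc δ n k :=
  ⟨_, ⟨x, hx, rfl⟩, rfl⟩

/-- `W_n(H)_δ ≅ Ω¹(W(H))_{♮,δ} / ♮(I^{n+1} dW + I^n dI)`. -/
noncomputable def oddEquiv {δ : H →ₐ[ℂ] ℂ}
    (hδ : twistedAntipode δ ∘ₗ twistedAntipode δ = LinearMap.id) (n : ℕ) :
    WnLoc δ n ≃ₗ[ℂ] (Omega1 H (WeilTilde H) ⧸ (weilIdeal H).oddRel δ n) :=
  (locEquiv δ n).trans (formEquiv hδ n)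

theorem oddEquiv_symm_mk {δ : H →ₐ[ℂ] ℂ}
    (hδ : twistedAntipode δ ∘ₗ twistedAntipode δ = LinearMap.id) (n : ℕ)
    (ω : Omega1 H (WeilTilde H)) :
    (oddEquiv hδ n).symm (Submodule.Quotient.mk ω) = cls δ n (projR (ofForm ω)) :=
  locEquiv_symm_mk δ n _

theorem mk_eq_of_sub_mem_formComm {δ : H →ₐ[ℂ] ℂ} {n : ℕ} {ω η : Omega1 H (WeilTilde H)}
    (h : ω - η ∈ formComm H (WeilTilde H)) :
    (Submodule.Quotient.mk ω : Omega1 H (WeilTilde H) ⧸ (weilIdeal H).oddRel δ n) =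
      Submodule.Quotient.mk η :=
  (Submodule.Quotient.eq _).2 (Submodule.mem_sup_left (Submodule.mem_sup_left h))

theorem locEquiv_bd (δ : H →ₐ[ℂ] ℂ) (n : ℕ) (y : WnLoc δ n) :
    locEquiv δ n (opLoc (descends_wBd δ) n y) =
      Submodule.mapQ _ _ (bdR H (WeilTilde H)) ((weilIdeal H).evenRel_bd δ n) (locEquiv δ n y) := by
  obtain ⟨x, rfl⟩ := cls_surj δ n y
  rfl

/-- The commutator error left by `toForm_bOp_sub_mem` belongs to the odd relations, so it disappears
in the quotient. -/
theorem oddEquiv_bd {δ : H →ₐ[ℂ] ℂ}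
    (hδ : twistedAntipode δ ∘ₗ twistedAntipode δ = LinearMap.id) (n : ℕ) (y : WnLoc δ n) :
    oddEquiv hδ n (opLoc (descends_bOp hδ) n y) =
      Submodule.mapQ _ _ (formBd H (WeilTilde H)) ((weilIdeal H).oddRel_bd δ n)
        (oddEquiv hδ n y) := by
  obtain ⟨x, rfl⟩ := cls_surj δ n y
  exact mk_eq_of_sub_mem_formComm (toForm_bOp_sub_mem (x : WeilTilde H))

/-! ### The isomorphism of super-complexes and its periodic form. -/

/-- The even parts of the two super-complexes agree. -/
noncomputable def evenIso (δ : H →ₐ[ℂ] ℂ) (n : ℕ) :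
    ccEven δ n ≅ (weilIdeal H).xEven δ n :=
  gradedIso (locEquiv δ n)
    (fun k => by
      rintro _ ⟨_, ⟨x, hx, rfl⟩, rfl⟩
      exact ⟨x, hx, rfl⟩)
    (fun k => by
      rintro _ ⟨x, hx, rfl⟩
      rw [Submodule.mem_comap]
      erw [locEquiv_symm_mk δ n x]
      exact cls_mem_grLoc δ n hx)
    (locEquiv_bd δ n)

/-- The odd parts of the two super-complexes agree. -/
noncomputable def oddIso {δ : H →ₐ[ℂ] ℂ}
    (hδ : twistedAntipode δ ∘ₗ twistedAntipode δ = LinearMap.id) (n : ℕ) :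
    ccOdd hδ n ≅ (weilIdeal H).xOdd δ n :=
  gradedIso (oddEquiv hδ n)
    (fun k => by
      rintro _ ⟨_, ⟨x, hx, rfl⟩, rfl⟩
      exact ⟨toForm (x : WeilTilde H), toForm_gr k hx, rfl⟩)
    (fun k => by
      rintro _ ⟨ω, hω, rfl⟩
      rw [Submodule.mem_comap]
      erw [oddEquiv_symm_mk hδ n ω]
      -- A homogeneous representative of a class of forms goes to a homogeneous word under `ofForm`,
      -- and the projection to $W$ keeps its degree; this settles the grading condition for the
      -- inverse.
      have hk : ofForm ω ∈ gr H k := ofForm_gr k hω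
      have hp : (projR (H := H) (ofForm ω) : WeilTilde H) ∈ gr H k := projR_mem hk
      exact cls_mem_grLoc δ n hp)
    (oddEquiv_bd hδ n)

/-- The localized cyclic super-complex is isomorphic to the localized relative `X`-complex. -/
noncomputable def ccSuperIso {δ : H →ₐ[ℂ] ℂ}
    (hδ : twistedAntipode δ ∘ₗ twistedAntipode δ = LinearMap.id) (n : ℕ) :
    ccSuper hδ n ≅ weilX hδ n :=
  superIso (hdb' := (weilX hδ n).d_comp_d (0 : Fin 2) (1 : Fin 2) (0 : Fin 2))
    (hbd' := (weilX hδ n).d_comp_d (1 : Fin 2) (0 : Fin 2) (1 : Fin 2)) (evenIso δ n) (oddIso hδ n)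
    -- The square from even to odd, $N$ against $d$; it commutes only up to commutators.
    (gradedHom_square _ _ _ _ _ (fun y => by
        obtain ⟨x, rfl⟩ := Submodule.mkQ_surjective _ y
        exact congrArg (Submodule.mkQ _) (univDer_bdR x)) _ _ (locEquiv_bd δ n) _ _ (oddEquiv_bd hδ n) fun y => by
      obtain ⟨x, rfl⟩ := cls_surj δ n y
      exact (mk_eq_of_sub_mem_formComm (toForm_nOp_sub_mem x)).symm)
    -- The square from odd to even, $t-1$ against $b$; it commutes already for representatives in
    -- $W$.
    (gradedHom_square _ _ _ _ _ (fun y => by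
        obtain ⟨ω, rfl⟩ := Submodule.mkQ_surjective _ y
        exact congrArg (Submodule.mkQ _) (formB_formBd ω)) _ _ (oddEquiv_bd hδ n) _ _ (locEquiv_bd δ n) fun y => by
      obtain ⟨x, rfl⟩ := cls_surj δ n y
      refine congrArg (Submodule.mkQ ((weilIdeal H).evenRel δ n)) (Subtype.ext ?_)
      -- Elements of $W$ have augmentation zero, so the unit correction in `formB_toForm` drops out.
      have hx : aug H (x : WeilTilde H) = 0 := x.2
      refine (formB_toForm (x : WeilTilde H)).trans ?_
      rw [hx, zero_smul, sub_zero]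
      rfl)

end Weil

theorem theorem7p6 {H : Type u} [Ring H] [HopfAlgebra ℂ H] (δ : H →ₐ[ℂ] ℂ)
    (hδ : twistedAntipode δ ∘ₗ twistedAntipode δ = LinearMap.id) (n : ℕ) :
    Nonempty (Weil.ccSuper hδ n ≅ weilX hδ n) ∧
      Nonempty (cyclicBicomplex hδ n ≅
        (HomologicalComplex₂.shiftFunctor₂ (ModuleCat.{u} ℂ) 1).obj (periodicComplex (weilX hδ n))) :=
  -- The statement on bicomplexes is functorial: periodic extension and vertical shift both carry
  -- isomorphisms to isomorphisms.
  ⟨⟨Weil.ccSuperIso hδ n⟩, ⟨(HomologicalComplex₂.shiftFunctor₂ (ModuleCat.{u} ℂ) 1).mapIso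
    (periodicIso (Weil.ccSuperIso hδ n))⟩⟩
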